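/- Let $M$ be a smooth (Hausdorff, second countable) manifold of dimension $m\ge 3$ with a conformal class $\mathcal C=\{e^{2f}g_0 : f\in C^\infty(M)\}$ of Lorentzian metrics of signature $(-,+,\dots,+)$ and a time orientation given by a smooth time-like vector field $T$. For $g\in\mathcal C$ and a future-oriented null $g$-geodesic $\gamma$, let $R_\gamma(t)$ be the endomorphism $\langle J\rangle\mapsto\langle R(\dot\gamma(t),J)\dot\gamma(t)\rangle$ of $\dot\gamma(t)^\perp/\mathbb R\dot\gamma(t)$, where $R(X,Y)Z=\nabla_X\nabla_YZ-\nabla_Y\nabla_XZ-\nabla_{[X,Y]}Z$ is the Riemann curvature of $g$; let $\mathrm{Ric}_\gamma(t)=\operatorname{Tr}R_\gamma(t)$, and put $$D(t)=\det\Big(R_\gamma(t)-\tfrac1{m-2}\mathrm{Ric}_\gamma(t)\,\mathrm{Id}\Big),\qquad \zeta(t)=|D(t)|^{1/(2(m-2))}.$$ Let $\alpha$ be a ray of future null vectors at $p\in M$, write $\alpha^\perp/\alpha$ for the orthogonal space of the line spanned by $\alpha$ modulo this line, and let $\Gamma_\alpha$ be the light ray through $p$ in the direction $\alpha$. A parametrisation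 $\gamma$ of (a piece of) $\Gamma_\alpha$ as a null geodesic of some metric of $\mathcal C$ is called projective if $\mathrm{Ric}_\gamma=0$. The conformal parameter $s$ of $\Gamma_\alpha$ at $p$ is given, for a projective parametrisation $\gamma_P$ with $\gamma_P(t_0)=p$ and $\det R_{\gamma_P}\neq0$, by $s=\int_{t_0}^t|\det R_{\gamma_P}(\tau)|^{1/(2(m-2))}\,d\tau$. If $\gamma_C$ is a parametrisation of $\Gamma_\alpha$ near $p$ by $s$, which is a null geodesic of a metric of $\mathcal C$, with $\gamma_C(0)=p$, then the endomorphism $C_{\Gamma_\alpha}=R_{\gamma_C}(0)$ of $\alpha^\perp/\alpha$ is called the sky-curvature. Theorem. Let $g\in\mathcal C$ and let $\gamma$ be a null $g$-geodesic, defined on an open interval containing $0$, with $\gamma(0)=p$ and $\dot\gamma(0)\in\alpha$. Assume that $D(0)\ne0$. Then $D$ and $\zeta$ are smooth near $0$, the sky-curvature $C_{\Gamma_\alpha}$ exists and does not depend on the choices made in its definition, and, with $\zeta,\zeta',\zeta'',D,D',D''$ evaluated at $t=0$, $$C_{\Gamma_\alpha}=\frac1{\zeta^2}\Big[R_\gamma(0)+\frac12\Big(\frac{\zeta''}{\zeta}-\frac32\Big(\frac{\zeta'}{\zeta}\Big)^2\Big)\mathrm{Id}\Big]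 =\frac1{|D|^{1/(m-2)}}\Big[R_\gamma(0)+\frac1{4(m-2)}\Big(\frac{D''}{D}+\frac{7-4m}{4(m-2)}\Big(\frac{D'}{D}\Big)^2\Big)\mathrm{Id}\Big].$$ -/

import Mathlib

open scoped Manifold ContDiff Topology

noncomputable section

namespace SkyCurv

/-- The model space of an `m`-dimensional manifold. -/
abbrev Model (m : ℕ) : Type := EuclideanSpace ℝ (Fin m)

/-- The tangent space at `x` of a manifold modelled on `Model m`. -/
abbrev Tan (m : ℕ) {M : Type*} [TopologicalSpace M] [ChartedSpace (Model m) M] (x : M) : Type :=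
  TangentSpace 𝓘(ℝ, Model m) x

/-- A smooth Lorentzian metric, of signature `(-, +, …, +)`, on a manifold `M` of dimension `m`. -/
structure LorentzMetric (m : ℕ) (M : Type*) [TopologicalSpace M] [ChartedSpace (Model m) M]
    [IsManifold 𝓘(ℝ, Model m) ∞ M] where
  /-- the bilinear form on the tangent space at `x` -/
  form : ∀ x : M, Tan m x →L[ℝ] Tan m x →L[ℝ] ℝ
  symm : ∀ (x : M) (u v : Tan m x), form x u v = form x v u
  signature : ∀ x : M, ∃ b : Module.Basis (Fin m) ℝ (Tan m x), (∃ i : Fin m, i.val = 0) ∧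
    ∀ i j, form x (b i) (b j) = if i = j then (if i.val = 0 then -1 else 1) else 0
  smooth : ContMDiff 𝓘(ℝ, Model m) (𝓘(ℝ, Model m).prod 𝓘(ℝ, Model m →L[ℝ] Model m →L[ℝ] ℝ)) ∞
    (fun x : M ↦ Bundle.TotalSpace.mk' (Model m →L[ℝ] Model m →L[ℝ] ℝ)
      (E := fun x : M ↦ Tan m x →L[ℝ] Tan m x →L[ℝ] ℝ) x (form x))

/-- The `i`-th coordinate vector of the model space. -/
def coordVec {m : ℕ} (i : Fin m) : Model m := EuclideanSpace.single i 1

/-- The partial derivative of `F` in the direction of the `i`-th coordinate. -/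
def pd {m : ℕ} (i : Fin m) (F : Model m → ℝ) (y : Model m) : ℝ := fderiv ℝ F y (coordVec i)

/-- The derivative at `y` of the inverse of the preferred chart around `x₀`: it sends a vector of
the model space to the tangent vector with these coordinates. -/
def chartDeriv {E : Type*} [NormedAddCommGroup E] [NormedSpace ℝ E] {N : Type*}
    [TopologicalSpace N] [ChartedSpace E N] (x₀ : N) (y : E) :
    E →L[ℝ] TangentSpace 𝓘(ℝ, E) ((extChartAt 𝓘(ℝ, E) x₀).symm y) :=
  mfderiv 𝓘(ℝ, E) 𝓘(ℝ, E) (extChartAt 𝓘(ℝ, E) x₀).symm y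

lemma chartDeriv_self {E : Type*} [NormedAddCommGroup E] [NormedSpace ℝ E] {N : Type*}
    [TopologicalSpace N] [ChartedSpace E N] [IsManifold 𝓘(ℝ, E) ∞ N] (x : N) (v : E) :
    (show E from chartDeriv x (extChartAt 𝓘(ℝ, E) x x) v) = v := by
  have := mfderivWithin_range_extChartAt_symm (I := 𝓘(ℝ, E)) (x := x)
  rw [ModelWithCorners.range_eq_univ, mfderivWithin_univ] at this
  exact congrArg (fun A : E →L[ℝ] E ↦ A v) this

lemma contMDiffAt_chartDeriv {E : Type*} [NormedAddCommGroup E] [NormedSpace ℝ E] {N : Type*}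
    [TopologicalSpace N] [ChartedSpace E N] [IsManifold 𝓘(ℝ, E) ∞ N] (x : N) (v : E) :
    ContMDiffAt 𝓘(ℝ, E) (𝓘(ℝ, E).prod 𝓘(ℝ, E)) ∞
      (fun y : E ↦ Bundle.TotalSpace.mk' E (E := fun x : N ↦ TangentSpace 𝓘(ℝ, E) x)
        ((extChartAt 𝓘(ℝ, E) x).symm y) (chartDeriv x y v)) (extChartAt 𝓘(ℝ, E) x x) := by
  have hopen : IsOpen (extChartAt 𝓘(ℝ, E) x).target := isOpen_extChartAt_target x
  have hmem := mem_extChartAt_target (I := 𝓘(ℝ, E)) x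
  have hT := (contMDiffOn_extChartAt_symm (I := 𝓘(ℝ, E)) (n := ∞) x).contMDiffOn_tangentMapWithin
    (m := ∞) (by simp) hopen.uniqueMDiffOn
  have hsec : ContMDiff 𝓘(ℝ, E) (𝓘(ℝ, E).prod 𝓘(ℝ, E)) ∞
      (fun y : E ↦ (⟨y, v⟩ : TangentBundle 𝓘(ℝ, E) E)) :=
    contMDiff_vectorSpace_iff_contDiff.2 contDiff_const
  have h2 := (hT.comp hsec.contMDiffOn (s := (extChartAt 𝓘(ℝ, E) x).target)
    (fun y hy ↦ hy)).contMDiffAt (hopen.mem_nhds hmem)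
  refine h2.congr_of_eventuallyEq ?_
  filter_upwards [hopen.mem_nhds hmem] with y hy
  simp only [Function.comp, tangentMapWithin, mfderivWithin_of_isOpen hopen hy]
  rfl

section Pure

variable {m : ℕ}

lemma contDiffAt_det {A : Model m → Matrix (Fin m) (Fin m) ℝ} {y₀ : Model m}
    (hA : ∀ i j, ContDiffAt ℝ ∞ (fun y ↦ A y i j) y₀) : ContDiffAt ℝ ∞ (fun y ↦ (A y).det) y₀ := by
  simp only [Matrix.det_apply']
  exact ContDiffAt.sum fun σ _ ↦ contDiffAt_const.mul (contDiffAt_prod fun i _ ↦ hA _ _)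

lemma contDiffAt_inv {A : Model m → Matrix (Fin m) (Fin m) ℝ} {y₀ : Model m}
    (hA : ∀ i j, ContDiffAt ℝ ∞ (fun y ↦ A y i j) y₀) (h₀ : (A y₀).det ≠ 0) (i j : Fin m) :
    ContDiffAt ℝ ∞ (fun y ↦ (A y)⁻¹ i j) y₀ := by
  simp only [Matrix.inv_def, Matrix.smul_apply, Ring.inverse_eq_inv', smul_eq_mul,
    Matrix.adjugate_apply]
  refine ((contDiffAt_det hA).inv h₀).mul (contDiffAt_det fun k l ↦ ?_)
  by_cases hk : k = j
  · subst hk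
    simpa using contDiffAt_const
  · simpa [Matrix.updateRow_ne hk] using hA k l

lemma contDiffAt_pd {F : Model m → ℝ} {y₀ : Model m} (hF : ContDiffAt ℝ ∞ F y₀) (i : Fin m) :
    ContDiffAt ℝ ∞ (pd i F) y₀ :=
  (hF.fderiv_right (m := ∞) (by simp)).clm_apply contDiffAt_const

lemma pd_add {F G : Model m → ℝ} {y : Model m} (hF : ContDiffAt ℝ ∞ F y) (hG : ContDiffAt ℝ ∞ G y)
    (i : Fin m) : pd i (fun z ↦ F z + G z) y = pd i F y + pd i G y := by
  unfold pd
  rw [fderiv_fun_add (hF.differentiableAt (by simp)) (hG.differentiableAt (by simp))]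
  rfl

lemma pd_mul {F G : Model m → ℝ} {y : Model m} (hF : ContDiffAt ℝ ∞ F y) (hG : ContDiffAt ℝ ∞ G y)
    (i : Fin m) : pd i (fun z ↦ F z * G z) y = pd i F y * G y + F y * pd i G y := by
  unfold pd
  rw [fderiv_fun_mul (hF.differentiableAt (by simp)) (hG.differentiableAt (by simp))]
  simp
  ring

lemma pd_sum {ι : Type*} (s : Finset ι) {F : ι → Model m → ℝ} {y : Model m}
    (hF : ∀ a ∈ s, ContDiffAt ℝ ∞ (F a) y) (i : Fin m) :
    pd i (fun z ↦ ∑ a ∈ s, F a z) y = ∑ a ∈ s, pd i (F a) y := by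
  unfold pd
  rw [fderiv_fun_sum fun a ha ↦ (hF a ha).differentiableAt (by simp)]
  simp

lemma pd_comm {F : Model m → ℝ} {y : Model m} (hF : ContDiffAt ℝ ∞ F y) (i j : Fin m) :
    pd i (pd j F) y = pd j (pd i F) y := by
  have hd : DifferentiableAt ℝ (fderiv ℝ F) y :=
    (hF.fderiv_right (m := ∞) (by simp)).differentiableAt (by simp)
  have hs : IsSymmSndFDerivAt ℝ F y := hF.isSymmSndFDerivAt (by simp; exact WithTop.coe_le_coe.2 le_top)
  have : ∀ a b : Fin m, pd a (pd b F) y = fderiv ℝ (fderiv ℝ F) y (coordVec a) (coordVec b) := by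
    intro a b
    unfold pd
    rw [fderiv_clm_apply hd (differentiableAt_const _)]
    simp
  rw [this, this]
  exact hs _ _

end Pure

section Coordinates

variable {m : ℕ} {M : Type*} [TopologicalSpace M] [ChartedSpace (Model m) M]
  [IsManifold 𝓘(ℝ, Model m) ∞ M]

/-- The components `g_ij` of the metric in the preferred chart around `x₀`, as functions of the
coordinates `y`. -/
def gram (g : LorentzMetric m M) (x₀ : M) (y : Model m) : Matrix (Fin m) (Fin m) ℝ :=
  fun i j ↦ g.form ((extChartAt 𝓘(ℝ, Model m) x₀).symm y)
    (chartDeriv x₀ y (coordVec i)) (chartDeriv x₀ y (coordVec j))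

/-- The Christoffel symbols `Γ^k_ij` of the Levi-Civita connection in the preferred chart
around `x₀`. -/
def christoffel (g : LorentzMetric m M) (x₀ : M) (k i j : Fin m) (y : Model m) : ℝ :=
  1 / 2 * ∑ l, (gram g x₀ y)⁻¹ k l *
    (pd i (fun z ↦ gram g x₀ z j l) y + pd j (fun z ↦ gram g x₀ z i l) y
      - pd l (fun z ↦ gram g x₀ z i j) y)

/-- The components of the Riemann tensor, with
`R(∂_i, ∂_j) ∂_k = ∇_i ∇_j ∂_k - ∇_j ∇_i ∂_k = ∑_l R^l_kij ∂_l`. -/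
def riemannCoeff (g : LorentzMetric m M) (x₀ : M) (l k i j : Fin m) (y : Model m) : ℝ :=
  pd i (christoffel g x₀ l j k) y - pd j (christoffel g x₀ l i k) y
    + ∑ n, (christoffel g x₀ l i n y * christoffel g x₀ n j k y
      - christoffel g x₀ l j n y * christoffel g x₀ n i k y)

/-- The `i`-th coordinate vector at `x` of the preferred chart at `x`. -/
def coordTan (x : M) (i : Fin m) : Tan m x := (coordVec i : Model m)

/-- The coordinates of a tangent vector at `x` in the basis of coordinate vector fields of the
preferred chart at `x`. -/
def coord {x : M} (u : Tan m x) (i : Fin m) : ℝ := (show Model m from u) i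

/-- The curvature operator `R(u, v) w` at `x`, where
`R(X, Y) Z = ∇_X ∇_Y Z - ∇_Y ∇_X Z - ∇_[X, Y] Z`. -/
def riemann (g : LorentzMetric m M) (x : M) (u v w : Tan m x) : Tan m x :=
  ∑ l, (∑ k, ∑ i, ∑ j, riemannCoeff g x l k i j (extChartAt 𝓘(ℝ, Model m) x x) *
    (coord u i * coord v j * coord w k)) • coordTan x l


lemma gram_contDiffAt (g : LorentzMetric m M) (x : M) (i j : Fin m) :
    ContDiffAt ℝ ∞ (fun y ↦ gram g x y i j) (extChartAt 𝓘(ℝ, Model m) x x) := by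
  have hsm : ContMDiffAt 𝓘(ℝ, Model m) 𝓘(ℝ, Model m) ∞ (extChartAt 𝓘(ℝ, Model m) x).symm
      (extChartAt 𝓘(ℝ, Model m) x x) :=
    (contMDiffOn_extChartAt_symm x).contMDiffAt
      ((isOpen_extChartAt_target x).mem_nhds (mem_extChartAt_target x))
  have hg := (g.smooth ((extChartAt 𝓘(ℝ, Model m) x).symm (extChartAt 𝓘(ℝ, Model m) x x))).comp
    _ hsm
  have h := ContMDiffAt.clm_bundle_apply₂ (F₁ := Model m) (F₂ := Model m) (F₃ := ℝ)
    (E₁ := fun x : M ↦ Tan m x) (E₂ := fun x : M ↦ Tan m x) (E₃ := fun _ : M ↦ ℝ)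
    (b := (extChartAt 𝓘(ℝ, Model m) x).symm) hg (contMDiffAt_chartDeriv x (coordVec i))
    (contMDiffAt_chartDeriv x (coordVec j))
  rw [Bundle.contMDiffAt_totalSpace] at h
  exact h.2.contDiffAt

lemma sum_coord {x : M} (u : Tan m x) : u = ∑ i, coord u i • coordTan x i := by
  have : ∀ z : Model m, z = ∑ i, z i • (EuclideanSpace.single i (1 : ℝ) : Model m) := by
    intro z
    ext k
    simp [Finset.sum_apply, Pi.single_apply]
  exact this u

lemma gram_self (g : LorentzMetric m M) (x : M) (i j : Fin m) :
    gram g x (extChartAt 𝓘(ℝ, Model m) x x) i j =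
      g.form x (coordTan x i) (coordTan x j) := by
  have key : ∀ (z : M), z = x → ∀ a b : Model m, g.form z (show Tan m z from a) (show Tan m z from b)
      = g.form x (show Tan m x from a) (show Tan m x from b) := by
    rintro z rfl a b; rfl
  have h1 := chartDeriv_self x (coordVec i)
  have h2 := chartDeriv_self x (coordVec j)
  refine Eq.trans ?_ (key _ (extChartAt_to_inv (I := 𝓘(ℝ, Model m)) x) (coordVec i) (coordVec j))
  exact congrArg₂ (fun a b : Model m ↦ g.form _ (show Tan m _ from a) (show Tan m _ from b)) h1 h2

lemma form_eq_sum (g : LorentzMetric m M) (x : M) (u v : Tan m x) :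
    g.form x u v =
      ∑ i, ∑ j, coord u i * coord v j * gram g x (extChartAt 𝓘(ℝ, Model m) x x) i j := by
  have h1 : g.form x u v = g.form x (∑ i, coord u i • coordTan x i)
      (∑ j, coord v j • coordTan x j) := by
    rw [← sum_coord u, ← sum_coord v]
  rw [h1, map_sum (g.form x), sum_apply]
  refine Finset.sum_congr rfl fun i _ ↦ ?_
  rw [map_sum]
  refine Finset.sum_congr rfl fun j _ ↦ ?_
  rw [map_smul, map_smul, smul_apply, gram_self, smul_eq_mul, smul_eq_mul]
  ring

lemma gram_symm (g : LorentzMetric m M) (x : M) (y : Model m) (i j : Fin m) :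
    gram g x y i j = gram g x y j i := g.symm _ _ _

lemma gram_symm' (g : LorentzMetric m M) (x : M) (i j : Fin m) :
    (fun y ↦ gram g x y i j) = fun y ↦ gram g x y j i := funext fun y ↦ gram_symm g x y i j

lemma form_nondegenerate (g : LorentzMetric m M) (x : M) (u : Tan m x)
    (h : ∀ v, g.form x u v = 0) : u = 0 := by
  obtain ⟨b, -, hb⟩ := g.signature x
  have hu := b.sum_repr u
  have hc : ∀ j, b.repr u j = 0 := by
    intro j
    have := h (b j)
    rw [← hu, map_sum, sum_apply, Finset.sum_eq_single j] at this
    · rw [map_smul, smul_apply, hb, smul_eq_mul] at this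
      simp only [if_true] at this
      split_ifs at this <;> linarith
    · intro i _ hij
      rw [map_smul, smul_apply, hb, if_neg hij, smul_zero]
    · simp
  rw [← hu]
  simp [hc]

lemma gram_det_ne_zero (g : LorentzMetric m M) (x : M) :
    (gram g x (extChartAt 𝓘(ℝ, Model m) x x)).det ≠ 0 := by
  intro h
  obtain ⟨v, hv, h0⟩ := Matrix.exists_vecMul_eq_zero_iff.2 h
  apply hv
  have hz : (show Tan m x from (WithLp.toLp 2 v : Model m)) = 0 := by
    apply form_nondegenerate g
    intro w
    rw [form_eq_sum, Finset.sum_comm]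
    refine Finset.sum_eq_zero fun j _ ↦ ?_
    have := congrFun h0 j
    simp only [Matrix.vecMul, dotProduct, Pi.zero_apply] at this
    rw [← mul_zero (coord w j), ← this, Finset.mul_sum]
    refine Finset.sum_congr rfl fun i _ ↦ ?_
    change v i * coord w j * _ = _
    ring
  funext i
  exact congrArg (fun z : Model m ↦ z i) hz

/-- The Christoffel symbols of the first kind. -/
def christoffelLow (g : LorentzMetric m M) (x₀ : M) (n i j : Fin m) (y : Model m) : ℝ :=
  1 / 2 * (pd i (fun z ↦ gram g x₀ z j n) y + pd j (fun z ↦ gram g x₀ z i n) y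
      - pd n (fun z ↦ gram g x₀ z i j) y)

lemma contDiffAt_christoffel (g : LorentzMetric m M) (x : M) (k i j : Fin m) :
    ContDiffAt ℝ ∞ (christoffel g x k i j) (extChartAt 𝓘(ℝ, Model m) x x) := by
  have hp := fun a b c ↦ contDiffAt_pd (gram_contDiffAt g x a b) c
  exact contDiffAt_const.mul (ContDiffAt.sum fun l _ ↦
    (contDiffAt_inv (gram_contDiffAt g x) (gram_det_ne_zero g x) k l).mul
      (((hp j l i).add (hp i l j)).sub (hp i j l)))

lemma contDiffAt_christoffelLow (g : LorentzMetric m M) (x : M) (k i j : Fin m) :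
    ContDiffAt ℝ ∞ (christoffelLow g x k i j) (extChartAt 𝓘(ℝ, Model m) x x) := by
  have hp := fun a b c ↦ contDiffAt_pd (gram_contDiffAt g x a b) c
  exact contDiffAt_const.mul (((hp j k i).add (hp i k j)).sub (hp i j k))

lemma christoffelLow_add (g : LorentzMetric m M) (x : M) (n i l : Fin m) (y : Model m) :
    christoffelLow g x n i l y + christoffelLow g x l i n y = pd i (fun z ↦ gram g x z n l) y := by
  unfold christoffelLow
  rw [gram_symm' g x l n, gram_symm' g x i n, gram_symm' g x i l]
  ring

lemma sum_gram_christoffel (g : LorentzMetric m M) (x : M) (n i j : Fin m) :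
    ∀ᶠ y in 𝓝 (extChartAt 𝓘(ℝ, Model m) x x),
      ∑ l, gram g x y n l * christoffel g x l i j y = christoffelLow g x n i j y := by
  have hd := (contDiffAt_det (gram_contDiffAt g x)).continuousAt.eventually_ne
    (gram_det_ne_zero g x)
  filter_upwards [hd] with y hy
  have hm : gram g x y * (gram g x y)⁻¹ = 1 := Matrix.mul_nonsing_inv _ (by simpa using hy)
  set c : Fin m → ℝ := fun l ↦ pd i (fun z ↦ gram g x z j l) y + pd j (fun z ↦ gram g x z i l) y
      - pd l (fun z ↦ gram g x z i j) y with hc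
  have h1 : ∀ l, christoffel g x l i j y = 1 / 2 * ((gram g x y)⁻¹.mulVec c) l := fun l ↦ rfl
  have h2 : (gram g x y).mulVec ((gram g x y)⁻¹.mulVec c) = c := by
    rw [Matrix.mulVec_mulVec, hm, Matrix.one_mulVec]
  have h3 := congrFun h2 n
  change ∑ l, gram g x y n l * ((gram g x y)⁻¹.mulVec c) l = c n at h3
  change _ = 1 / 2 * c n
  rw [← h3, Finset.mul_sum]
  refine Finset.sum_congr rfl fun l _ ↦ ?_
  rw [h1]
  ring

/-- The lowered Riemann tensor is antisymmetric in its first two indices. -/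
lemma riemannLow_antisymm (g : LorentzMetric m M) (x : M) (n k i j : Fin m) :
    ∑ l, gram g x (extChartAt 𝓘(ℝ, Model m) x x) n l *
        riemannCoeff g x l k i j (extChartAt 𝓘(ℝ, Model m) x x)
      + ∑ l, gram g x (extChartAt 𝓘(ℝ, Model m) x x) k l *
        riemannCoeff g x l n i j (extChartAt 𝓘(ℝ, Model m) x x) = 0 := by
  set y := extChartAt 𝓘(ℝ, Model m) x x with hy
  have hG := gram_contDiffAt g x
  have hC := contDiffAt_christoffel g x
  have hL := contDiffAt_christoffelLow g x
  rw [← hy] at hG hC hL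
  have hder : ∀ n a i j, ∑ l, gram g x y n l * pd a (christoffel g x l i j) y =
      pd a (christoffelLow g x n i j) y
        - ∑ l, (christoffelLow g x n a l y + christoffelLow g x l a n y) *
            christoffel g x l i j y := by
    intro n a i j
    have h1 : pd a (fun z ↦ ∑ l, gram g x z n l * christoffel g x l i j z) y =
        pd a (christoffelLow g x n i j) y := by
      unfold pd
      rw [Filter.EventuallyEq.fderiv_eq (sum_gram_christoffel g x n i j)]
    rw [pd_sum _ (fun l _ ↦ (hG n l).mul (hC l i j))] at h1
    rw [← h1, ← Finset.sum_sub_distrib]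
    refine Finset.sum_congr rfl fun l _ ↦ ?_
    rw [pd_mul (hG n l) (hC l i j), christoffelLow_add]
    ring
  have hlow : ∀ n i j, ∑ l, gram g x y n l * christoffel g x l i j y =
      christoffelLow g x n i j y := fun n i j ↦ (sum_gram_christoffel g x n i j).self_of_nhds
  have hquad : ∀ n a c d, ∑ l, gram g x y n l *
      ∑ p, christoffel g x l a p y * christoffel g x p c d y = ∑ p, christoffelLow g x n a p y * christoffel g x p c d y := by
    intro n a c d
    simp only [Finset.mul_sum]
    rw [Finset.sum_comm]
    refine Finset.sum_congr rfl fun p _ ↦ ?_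
    rw [← hlow, Finset.sum_mul]
    exact Finset.sum_congr rfl fun l _ ↦ by ring
  have hpair : ∀ a b c d : Fin m, ∑ l, christoffelLow g x l a b y * christoffel g x l c d y =
      ∑ l, christoffelLow g x l c d y * christoffel g x l a b y := by
    intro a b c d
    simp only [← hlow, Finset.sum_mul]
    rw [Finset.sum_comm]
    refine Finset.sum_congr rfl fun l _ ↦ Finset.sum_congr rfl fun p _ ↦ ?_
    rw [gram_symm]
    ring
  have hsymC : ∀ l a b, christoffelLow g x l a b y = christoffelLow g x l b a y := by
    intro l a b
    unfold christoffelLow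
    rw [gram_symm' g x b a]
    ring
  have hsymC' : ∀ l a b, christoffel g x l a b = christoffel g x l b a := by
    intro l a b
    funext z
    unfold christoffel
    rw [gram_symm' g x b a]
    congr 1
    refine Finset.sum_congr rfl fun l _ ↦ ?_
    ring
  have hS : ∀ n k, ∑ l, gram g x y n l * riemannCoeff g x l k i j y =
      pd i (christoffelLow g x n j k) y - pd j (christoffelLow g x n i k) y
      - ∑ l, christoffelLow g x l i n y * christoffel g x l j k y
      + ∑ l, christoffelLow g x l j n y * christoffel g x l i k y := by
    intro n k
    simp only [riemannCoeff, mul_add, mul_sub, Finset.sum_add_distrib, Finset.sum_sub_distrib]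
    rw [hder, hder, hquad, hquad]
    simp only [add_mul, Finset.sum_add_distrib]
    ring
  rw [hS, hS]
  have hmix : ∀ a b, pd a (christoffelLow g x n b k) y + pd a (christoffelLow g x k b n) y =
      pd a (pd b (fun z ↦ gram g x z n k)) y := by
    intro a b
    rw [← pd_add (hL n b k) (hL k b n)]
    congr 1
    funext z
    rw [christoffelLow_add]
  have e1 := hmix i j
  have e2 := hmix j i
  have e3 := pd_comm (hG n k) i j
  have e4 := hpair i n j k
  have e5 := hpair i k j n
  linarith

lemma coord_riemann (g : LorentzMetric m M) (x : M) (u v w : Tan m x) (l : Fin m) :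
    coord (riemann g x u v w) l = ∑ k, ∑ i, ∑ j,
      riemannCoeff g x l k i j (extChartAt 𝓘(ℝ, Model m) x x) *
        (coord u i * coord v j * coord w k) := by
  have : ∀ c : Fin m → ℝ, (∑ l, c l • (coordVec l : Model m)) l = c l := by
    intro c
    simp [coordVec, Pi.single_apply]
  exact this _

/-- `R(u, v) w` is orthogonal to `w`. -/
lemma form_riemann_self (g : LorentzMetric m M) (x : M) (u v w : Tan m x) :
    g.form x (riemann g x u v w) w = 0 := by
  set y := extChartAt 𝓘(ℝ, Model m) x x with hy
  have h : g.form x (riemann g x u v w) w = ∑ n, ∑ k, coord w n * coord w k *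
      ∑ i, ∑ j, coord u i * coord v j * ∑ l, gram g x y n l * riemannCoeff g x l k i j y := by
    rw [g.symm, form_eq_sum]
    simp only [coord_riemann, Finset.mul_sum, Finset.sum_mul, ← hy]
    refine Finset.sum_congr rfl fun n _ ↦ ?_
    rw [Finset.sum_comm]
    refine Finset.sum_congr rfl fun k _ ↦ ?_
    rw [Finset.sum_comm]
    refine Finset.sum_congr rfl fun i _ ↦ ?_
    rw [Finset.sum_comm]
    refine Finset.sum_congr rfl fun j _ ↦ Finset.sum_congr rfl fun l _ ↦ ?_
    ring
  have h' : g.form x (riemann g x u v w) w = ∑ n, ∑ k, coord w n * coord w k *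
      ∑ i, ∑ j, coord u i * coord v j * ∑ l, gram g x y k l * riemannCoeff g x l n i j y := by
    rw [h, Finset.sum_comm]
    refine Finset.sum_congr rfl fun n _ ↦ Finset.sum_congr rfl fun k _ ↦ ?_
    ring
  have hsum : g.form x (riemann g x u v w) w + g.form x (riemann g x u v w) w = 0 := by
    nth_rewrite 1 [h]
    rw [h', ← Finset.sum_add_distrib]
    refine Finset.sum_eq_zero fun n _ ↦ ?_
    rw [← Finset.sum_add_distrib]
    refine Finset.sum_eq_zero fun k _ ↦ ?_
    rw [← mul_add, ← Finset.sum_add_distrib]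
    have : ∀ i, ∑ j, coord u i * coord v j * ∑ l, gram g x y n l * riemannCoeff g x l k i j y +
        ∑ j, coord u i * coord v j * ∑ l, gram g x y k l * riemannCoeff g x l n i j y = 0 := by
      intro i
      rw [← Finset.sum_add_distrib]
      refine Finset.sum_eq_zero fun j _ ↦ ?_
      rw [← mul_add, riemannLow_antisymm, mul_zero]
    simp [this]
  linarith

lemma riemann_self (g : LorentzMetric m M) (x : M) (u w : Tan m x) :
    riemann g x u u w = 0 := by
  have hR : ∀ l k i j y, riemannCoeff g x l k i j y = - riemannCoeff g x l k j i y := by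
    intro l k i j y
    simp only [riemannCoeff, Finset.sum_sub_distrib]
    ring
  refine Finset.sum_eq_zero fun l _ ↦ ?_
  rw [Finset.sum_eq_zero, zero_smul]
  intro k _
  have h : ∀ y, ∑ i, ∑ j, riemannCoeff g x l k i j y * (coord u i * coord u j * coord w k) =
      - ∑ i, ∑ j, riemannCoeff g x l k i j y * (coord u i * coord u j * coord w k) := by
    intro y
    nth_rewrite 1 [Finset.sum_comm]
    simp only [← Finset.sum_neg_distrib]
    refine Finset.sum_congr rfl fun i _ ↦ Finset.sum_congr rfl fun j _ ↦ ?_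
    rw [hR]
    ring
  linarith [h (extChartAt 𝓘(ℝ, Model m) x x)]

lemma coord_add {x : M} (u v : Tan m x) (i : Fin m) : coord (u + v) i = coord u i + coord v i := rfl

lemma coord_smul {x : M} (c : ℝ) (u : Tan m x) (i : Fin m) : coord (c • u) i = c * coord u i := rfl

/-- The linear map `v ↦ R(w, v) w`. -/
def jacobiMap (g : LorentzMetric m M) {x : M} (w : Tan m x) : Tan m x →ₗ[ℝ] Tan m x where
  toFun v := riemann g x w v w
  map_add' v v' := by
    simp only [riemann, coord_add, mul_add, add_mul, Finset.sum_add_distrib, add_smul]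
  map_smul' c v := by
    simp only [riemann, coord_smul, RingHom.id_apply, Finset.smul_sum, smul_smul, Finset.mul_sum]
    refine Finset.sum_congr rfl fun l _ ↦ ?_
    congr 1
    refine Finset.sum_congr rfl fun k _ ↦ Finset.sum_congr rfl fun i _ ↦
      Finset.sum_congr rfl fun j _ ↦ ?_
    ring

/-- Two metrics are conformal if `h = e^{2f} g` for a smooth function `f`. -/
def Conformal (g h : LorentzMetric m M) : Prop :=
  ∃ f : M → ℝ, ContMDiff 𝓘(ℝ, Model m) 𝓘(ℝ, ℝ) ∞ f ∧
    ∀ (x : M) (u v : Tan m x), h.form x u v = Real.exp (2 * f x) * g.form x u v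

/-- The velocity of a curve. -/
def velocity (γ : ℝ → M) (t : ℝ) : Tan m (γ t) := mfderiv 𝓘(ℝ, ℝ) 𝓘(ℝ, Model m) γ t (1 : ℝ)

/-- The `k`-th coordinate of `γ` in the preferred chart around `x₀`. -/
def curveCoord (γ : ℝ → M) (x₀ : M) (k : Fin m) (t : ℝ) : ℝ := extChartAt 𝓘(ℝ, Model m) x₀ (γ t) k

/-- The geodesic equation `∇_γ' γ' = 0` at time `t`, in the preferred chart around `γ t`. -/
def GeodesicEqAt (g : LorentzMetric m M) (γ : ℝ → M) (t : ℝ) : Prop :=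
  ∀ k : Fin m, deriv (deriv (curveCoord γ (γ t) k)) t
    + ∑ i, ∑ j, christoffel g (γ t) k i j (extChartAt 𝓘(ℝ, Model m) (γ t) (γ t)) *
        (deriv (curveCoord γ (γ t) i) t * deriv (curveCoord γ (γ t) j) t) = 0

end Coordinates

/-- A time-oriented conformal Lorentzian structure on an `m`-dimensional manifold: a conformal class
of Lorentzian metrics and a smooth time-like vector field. -/
structure Spacetime (m : ℕ) (M : Type*) [TopologicalSpace M] [ChartedSpace (Model m) M]
    [IsManifold 𝓘(ℝ, Model m) ∞ M] where
  /-- the conformal class -/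
  metrics : Set (LorentzMetric m M)
  isClass : ∃ g₀, metrics = {g | Conformal g₀ g}
  /-- the time orientation -/
  time : ∀ x : M, Tan m x
  time_smooth : ContMDiff 𝓘(ℝ, Model m) (𝓘(ℝ, Model m).prod 𝓘(ℝ, Model m)) ∞
    (fun x : M ↦ Bundle.TotalSpace.mk' (Model m) (E := fun x : M ↦ Tan m x) x (time x))
  time_timelike : ∀ g ∈ metrics, ∀ x, g.form x (time x) (time x) < 0

namespace Spacetime

variable {m : ℕ} {M : Type*} [TopologicalSpace M] [ChartedSpace (Model m) M]
  [IsManifold 𝓘(ℝ, Model m) ∞ M] (S : Spacetime m M)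

lemma form_eq_zero_of_mem {g h : LorentzMetric m M} (hg : g ∈ S.metrics) (hh : h ∈ S.metrics)
    {x : M} {u v : Tan m x} (h0 : g.form x u v = 0) : h.form x u v = 0 := by
  obtain ⟨g₀, hS⟩ := S.isClass
  rw [hS] at hg hh
  obtain ⟨a, -, ha⟩ := hg
  obtain ⟨b, -, hb⟩ := hh
  rw [ha] at h0
  rw [hb, (mul_eq_zero.1 h0).resolve_left (Real.exp_ne_zero _), mul_zero]

/-- The orthogonal space `ℓ^⊥` of a subspace `ℓ` of a tangent space; it is the same for all metrics
of the conformal class. -/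
def perp {x : M} (ℓ : Submodule ℝ (Tan m x)) : Submodule ℝ (Tan m x) where
  carrier := {v | ∀ g ∈ S.metrics, ∀ u ∈ ℓ, g.form x u v = 0}
  add_mem' hv hv' g hg u hu := by rw [map_add, hv g hg u hu, hv' g hg u hu, add_zero]
  zero_mem' g _ u _ := map_zero _
  smul_mem' c v hv g hg u hu := by rw [map_smul, hv g hg u hu, smul_zero]

/-- The quotient `ℓ^⊥ / ℓ` (for a null line `ℓ`, so that `ℓ ⊆ ℓ^⊥`). -/
abbrev PerpQuot {x : M} (ℓ : Submodule ℝ (Tan m x)) : Type :=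
  S.perp ℓ ⧸ ℓ.submoduleOf (S.perp ℓ)

variable {S}

lemma jacobiMap_mem {g : LorentzMetric m M} (hg : g ∈ S.metrics) {x : M}
    {ℓ : Submodule ℝ (Tan m x)} {w : Tan m x} (hw : ℝ ∙ w = ℓ) (v : Tan m x) :
    jacobiMap g w v ∈ S.perp ℓ := by
  intro h hh u hu
  rw [← hw] at hu
  obtain ⟨c, rfl⟩ := Submodule.mem_span_singleton.1 hu
  refine S.form_eq_zero_of_mem hg hh ?_
  rw [map_smul, smul_apply, g.symm]
  change c • g.form x (riemann g x w v w) w = 0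
  rw [form_riemann_self, smul_zero]

/-- For `ℓ` spanned by `w`, the endomorphism `⟨J⟩ ↦ ⟨R(w, J) w⟩` of `ℓ^⊥ / ℓ`. -/
def jacobiEnd {g : LorentzMetric m M} (hg : g ∈ S.metrics) {x : M} {ℓ : Submodule ℝ (Tan m x)}
    {w : Tan m x} (hw : ℝ ∙ w = ℓ) : Module.End ℝ (S.PerpQuot ℓ) :=
  Submodule.mapQ _ _ ((jacobiMap g w).restrict fun v _ ↦ jacobiMap_mem hg hw v) <| by
    rintro ⟨v, hv⟩ hvℓ
    have hv' : v ∈ ℓ := hvℓ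
    rw [← hw] at hv'
    obtain ⟨c, rfl⟩ := Submodule.mem_span_singleton.1 hv'
    change jacobiMap g w (c • w) ∈ ℓ
    have : jacobiMap g w w = 0 := riemann_self g x w w
    rw [map_smul, this, smul_zero]
    exact ℓ.zero_mem

variable (S)

/-- `γ`, restricted to the open interval `I`, is a smooth future-oriented null geodesic of `g`. -/
structure IsNullGeodesicOn (g : LorentzMetric m M) (γ : ℝ → M) (I : Set ℝ) : Prop where
  isOpen : IsOpen I
  ordConnected : I.OrdConnected
  smooth : ContMDiffOn 𝓘(ℝ, ℝ) 𝓘(ℝ, Model m) ∞ γ I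
  null : ∀ t ∈ I, g.form (γ t) (velocity γ t) (velocity γ t) = 0
  future : ∀ t ∈ I, g.form (γ t) (velocity γ t) (S.time (γ t)) < 0
  geodesic : ∀ t ∈ I, GeodesicEqAt g γ t

variable {S}

/-- The parametric curvature `R_γ(t)`, an endomorphism of `γ'(t)^⊥ / γ'(t)`, for a curve `γ` which is
a null geodesic of the metric `g` of the conformal class. -/
def paramCurvature {g : LorentzMetric m M} (hg : g ∈ S.metrics) (γ : ℝ → M) (t : ℝ) :
    Module.End ℝ (S.PerpQuot (ℝ ∙ velocity γ t)) :=
  jacobiEnd hg rfl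

/-- `Ric_γ(t)`, the trace of `R_γ(t)`. -/
def paramRicci {g : LorentzMetric m M} (hg : g ∈ S.metrics) (γ : ℝ → M) (t : ℝ) : ℝ :=
  LinearMap.trace ℝ _ (paramCurvature hg γ t)

/-- `D(t) = det (R_γ(t) - Ric_γ(t) / (m - 2) Id)`. -/
def tracelessDet {g : LorentzMetric m M} (hg : g ∈ S.metrics) (γ : ℝ → M) (t : ℝ) : ℝ :=
  LinearMap.det (paramCurvature hg γ t - (paramRicci hg γ t / ((m : ℝ) - 2)) • LinearMap.id)

/-- `ζ_γ(t)`, the `2(m - 2)`-th root of `|det (R_γ(t) - Ric_γ(t) / (m - 2) Id)|`. -/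
def zeta {g : LorentzMetric m M} (hg : g ∈ S.metrics) (γ : ℝ → M) (t : ℝ) : ℝ :=
  |tracelessDet hg γ t| ^ (1 / (2 * ((m : ℝ) - 2)))

/-- The `2(m - 2)`-th root of `|det R_γ(t)|`. -/
def zetaProj {g : LorentzMetric m M} (hg : g ∈ S.metrics) (γ : ℝ → M) (t : ℝ) : ℝ :=
  |LinearMap.det (paramCurvature hg γ t)| ^ (1 / (2 * ((m : ℝ) - 2)))

variable (S)

/-- A point of `ℙℕ⁺`: a ray `α = {c u | c > 0}` spanned by a future null vector `u`. -/
structure NullRay where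
  /-- the base point `p` -/
  pt : M
  /-- the ray, as a set of tangent vectors at `p` -/
  carrier : Set (Tan m pt)
  isRay : ∃ u : Tan m pt, (∀ g ∈ S.metrics, g.form pt u u = 0 ∧ g.form pt u (S.time pt) < 0) ∧
    carrier = {v | ∃ c : ℝ, 0 < c ∧ v = c • u}

variable {S}

/-- The line in the tangent space spanned by a ray. -/
def NullRay.line (α : S.NullRay) : Submodule ℝ (Tan m α.pt) := Submodule.span ℝ α.carrier

lemma NullRay.span_eq_line (α : S.NullRay) {w : Tan m α.pt} (hw : w ∈ α.carrier) :
    ℝ ∙ w = α.line := by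
  obtain ⟨u, -, hu⟩ := α.isRay
  refine le_antisymm (Submodule.span_mono (Set.singleton_subset_iff.2 hw)) ?_
  rw [hu] at hw
  obtain ⟨c, hc, rfl⟩ := hw
  refine Submodule.span_le.2 ?_
  rw [hu]
  rintro _ ⟨d, -, rfl⟩
  refine Submodule.mem_span_singleton.2 ⟨d / c, ?_⟩
  rw [smul_smul, div_mul_cancel₀ _ hc.ne']

/-- The space `α^⊥ / α`, which is the tangent space of the sky of `p` at the light ray `Γ_α`. -/
abbrev NullRay.SkyTangent (α : S.NullRay) : Type := S.PerpQuot α.line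

/-- For `w` in the ray `α`, the endomorphism `⟨J⟩ ↦ ⟨R(w, J) w⟩` of `α^⊥ / α`. It is `R_γ(0)` for a
null geodesic `γ` of `g` with `γ(0) = p` and `γ'(0) = w`. -/
def NullRay.curvature (α : S.NullRay) {g : LorentzMetric m M} (hg : g ∈ S.metrics)
    {w : Tan m α.pt} (hw : w ∈ α.carrier) : Module.End ℝ α.SkyTangent :=
  jacobiEnd hg (α.span_eq_line hw)

/-- `γ(0) = p` and `γ'(0) = w`, where `w` is a tangent vector at `p`. -/
def StartsAt (γ : ℝ → M) {p : M} (w : Tan m p) : Prop :=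
  (⟨γ 0, velocity γ 0⟩ : TangentBundle 𝓘(ℝ, Model m) M) = ⟨p, w⟩

/-- `C` is the sky-curvature of the light ray `Γ_α`: `C = R_{γ_C}(0)` for a parametrisation `γ_C` of
`Γ_α` by its conformal parameter `s` (near `p`, with `γ_C(0) = p`). Here a parametrisation is a
null geodesic of some metric of the conformal class. A parametrisation `γ_P` is projective if
`Ric_{γ_P} = 0`, and the conformal parameter is `s = ∫ ζ_{γ_P}`: `γ_C(s) = γ_P(ψ(s))`, where
`s = ∫_{ψ(0)}^{ψ(s)} ζ_{γ_P}(τ) dτ` and `ζ_{γ_P} = |det R_{γ_P}|^{1 / (2(m - 2))}` is positive. -/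
def IsSkyCurvature (α : S.NullRay) (C : Module.End ℝ α.SkyTangent) : Prop :=
  ∃ (gP : LorentzMetric m M) (hP : gP ∈ S.metrics) (γP : ℝ → M) (I : Set ℝ)
    (gC : LorentzMetric m M) (hC : gC ∈ S.metrics) (γC : ℝ → M) (J : Set ℝ)
    (ψ : ℝ → ℝ) (w : Tan m α.pt) (hw : w ∈ α.carrier),
    S.IsNullGeodesicOn gP γP I ∧ (∀ t ∈ I, paramRicci hP γP t = 0) ∧
    (∀ t ∈ I, 0 < zetaProj hP γP t) ∧
    S.IsNullGeodesicOn gC γC J ∧ 0 ∈ J ∧ StartsAt γC w ∧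
    (∀ s ∈ J, ψ s ∈ I ∧ s = ∫ τ in (ψ 0)..(ψ s), zetaProj hP γP τ) ∧
    (∀ s ∈ J, γC s = γP (ψ s)) ∧
    C = α.curvature hC hw

end Spacetime

end SkyCurv
end

/-!
The argument computes how everything changes when the metric and the parametrisation are changed
simultaneously. Let `h = e^{2f} g`, let `γ` be a null geodesic of `g` and `F = f ∘ γ`. The light
ray is also a null geodesic of `h`, up to a reparametrisation `φ` with `φ' = c e^{-2 F(φ)}`
(`geodesicEqAt_conformal`), and on `w^⊥ / w` the Jacobi endomorphism becomes `φ'² (R_γ + (F'' -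
F'²) Id)` (`Spacetime.jacobiEnd_conformal`, `conformalTerm_velocity`). The trace-free part is
therefore only rescaled, and since the quotient has dimension `m - 2`, the function `ζ` transforms
as the density `|φ'| ζ(φ)` (`Spacetime.IsNullGeodesicOn.zeta_reparam`).

*Uniqueness.* Along a projective parametrisation, `ζ` is the integrand of the conformal parameter,
so `ζ = 1` along every parametrisation `γ_C` by the conformal parameter
(`Spacetime.zeta_eq_one_of_integral`). By uniqueness of geodesics `γ_C = γ ∘ φ` for some `φ` as
above, hence `ζ_γ` is a constant multiple of `e^{2F}`: then `ζ'/ζ = 2F'` and `ζ''/ζ = 2F'' +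
4F'²`, so that `F'' - F'² = (ζ''/ζ - (3/2) (ζ'/ζ)²) / 2`, which is the first formula
(`Spacetime.curvature_of_zeta_eq_one`). The second one follows by writing `ζ = |D|^{1/(2(m-2))}`.

*Existence.* Every positive speed `ρ` near the starting point is realised by a null geodesic of
some metric of the class: it suffices that `e^{-2f} = ρ` along the curve, and a smooth function of
the parameter of a regular curve extends to the manifold
(`Spacetime.IsNullGeodesicOn.exists_reparam`). The speed `u²`, with `u'' = Ric_γ u / (m - 2)`,
gives a projective parametrisation, and then the speed `1 / ζ` gives the conformal parameter.

Since the definitions are in terms of the preferred chart at each point, the transformation laws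
are proved in a fixed chart: `IsLeviCivitaOn` abstracts a metric and its connection on an open set
of the model space, and the Koszul formula yields at once the change of coordinates, which makes
the geodesic equation and the curvature independent of the chart, and the conformal change.
Smoothness of `D` is not evident from its definition as a determinant on a varying quotient; it is
identified with the determinant of a smooth family of endomorphisms of the model space
(`Spacetime.nullDet_eq_det`).
-/

open Filter

namespace SkyCurv

/-! ### Ordinary differential equations and inverse functions -/

/-- An integral curve is as smooth as the vector field along it, by bootstrapping. -/
lemma contDiffAt_of_integralCurve {E : Type*} [NormedAddCommGroup E] [NormedSpace ℝ E]
    {X : ℝ → E} {V : E → E} {U : Set ℝ} (hU : IsOpen U)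
    (hX : ∀ t ∈ U, HasDerivAt X (V (X t)) t) (hV : ∀ t ∈ U, ContDiffAt ℝ ∞ V (X t)) :
    ∀ t ∈ U, ContDiffAt ℝ ∞ X t := by
  have key : ∀ n : ℕ, ∀ t ∈ U, ContDiffAt ℝ n X t := by
    intro n
    induction n with
    | zero =>
      intro t ht
      simp only [Nat.cast_zero, contDiffAt_zero]
      exact ⟨U, hU.mem_nhds ht, fun s hs ↦ (hX s hs).continuousAt.continuousWithinAt⟩
    | succ n ih =>
      intro t ht
      rw [Nat.cast_succ, contDiffAt_succ_iff_hasFDerivAt]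
      refine ⟨fun s ↦ ContinuousLinearMap.toSpanSingleton ℝ (V (X s)),
        ⟨U, hU.mem_nhds ht, fun s hs ↦ (hX s hs).hasFDerivAt⟩, ?_⟩
      have h : ContDiffAt ℝ n (fun s ↦ V (X s)) t :=
        ((hV t ht).of_le (by exact_mod_cast le_top)).comp t (ih t ht)
      exact ((ContinuousLinearMap.toSpanSingletonCLE (𝕜 := ℝ) (E := E)).contDiff
        (n := n)).contDiffAt.comp t h
  intro t ht
  exact contDiffAt_infty.2 fun n ↦ key n t ht

lemma exists_integralCurve {E : Type*} [NormedAddCommGroup E] [NormedSpace ℝ E] [CompleteSpace E]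
    {V : E → E} {x₀ : E} (hV : ∀ᶠ x in 𝓝 x₀, ContDiffAt ℝ ∞ V x) :
    ∃ X : ℝ → E, X 0 = x₀ ∧
      ∀ᶠ t in 𝓝 (0 : ℝ), HasDerivAt X (V (X t)) t ∧ ContDiffAt ℝ ∞ X t := by
  obtain ⟨X, hX0, ε, hε, hX⟩ :=
    (hV.self_of_nhds.of_le (n := ∞) (m := 1) (by exact_mod_cast le_top)
      ).exists_forall_mem_closedBall_exists_eq_forall_mem_Ioo_hasDerivAt₀ 0
  refine ⟨X, hX0, ?_⟩
  have h0 : (0 : ℝ) ∈ Set.Ioo (0 - ε) (0 + ε) := by constructor <;> linarith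
  have hc : ContinuousAt X 0 := (hX 0 h0).continuousAt
  have h1 : ∀ᶠ t in 𝓝 (0 : ℝ), ContDiffAt ℝ ∞ V (X t) := by
    rw [← hX0] at hV
    exact hc.eventually hV
  obtain ⟨U, hU, hUo, h0U⟩ := eventually_nhds_iff.1
    (h1.and ((isOpen_Ioo (a := 0 - ε) (b := 0 + ε)).mem_nhds h0))
  have := contDiffAt_of_integralCurve hUo (fun t ht ↦ hX t (hU t ht).2) fun t ht ↦ (hU t ht).1
  filter_upwards [hUo.mem_nhds h0U] with t ht using ⟨hX t (hU t ht).2, this t ht⟩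

/-- Solutions of a second order equation `c'' = A (c, c')` with the same initial data agree. -/
lemma eventuallyEq_of_second_order {E : Type*} [NormedAddCommGroup E] [NormedSpace ℝ E]
    {A : E × E → E} {c₁ c₂ : ℝ → E} (hA : ContDiffAt ℝ 1 A (c₁ 0, deriv c₁ 0))
    (h₁ : ∀ᶠ t in 𝓝 (0 : ℝ), ContDiffAt ℝ ∞ c₁ t ∧ deriv (deriv c₁) t = A (c₁ t, deriv c₁ t))
    (h₂ : ∀ᶠ t in 𝓝 (0 : ℝ), ContDiffAt ℝ ∞ c₂ t ∧ deriv (deriv c₂) t = A (c₂ t, deriv c₂ t))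
    (h0 : c₁ 0 = c₂ 0) (h0' : deriv c₁ 0 = deriv c₂ 0) : c₁ =ᶠ[𝓝 0] c₂ := by
  have hV : ContDiffAt ℝ 1 (fun X : E × E ↦ (X.2, A X)) (c₁ 0, deriv c₁ 0) :=
    contDiffAt_snd.prodMk hA
  obtain ⟨K, s, hs, hK⟩ := hV.exists_lipschitzOnWith
  have main : ∀ c : ℝ → E, (∀ᶠ t in 𝓝 (0 : ℝ), ContDiffAt ℝ ∞ c t ∧
      deriv (deriv c) t = A (c t, deriv c t)) → s ∈ 𝓝 (c 0, deriv c 0) →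
      ∀ᶠ t in 𝓝 (0 : ℝ), HasDerivAt (fun t ↦ (c t, deriv c t))
        ((fun X : E × E ↦ (X.2, A X)) (c t, deriv c t)) t ∧ (c t, deriv c t) ∈ s := by
    intro c hc hsc
    have hd : ∀ᶠ t in 𝓝 (0 : ℝ), HasDerivAt (fun t ↦ (c t, deriv c t))
        ((fun X : E × E ↦ (X.2, A X)) (c t, deriv c t)) t := by
      filter_upwards [hc] with t ht
      have h2 : DifferentiableAt ℝ (deriv c) t :=
        (ht.1.derivWithin (m := ∞) (by simp)).differentiableAt (by simp)
      have := (ht.1.differentiableAt (by simp)).hasDerivAt.prodMk h2.hasDerivAt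
      rw [ht.2] at this
      exact this
    exact hd.and (hd.self_of_nhds.continuousAt.eventually hsc)
  have := ODE_solution_unique_of_eventually (v := fun _ X ↦ (X.2, A X)) (s := fun _ ↦ s)
    (K := K) (t₀ := 0) (.of_forall fun _ ↦ hK) (main c₁ h₁ hs) (main c₂ h₂ (by rwa [← h0, ← h0']))
    (by simp [h0, h0'])
  filter_upwards [this] with t ht using congrArg Prod.fst ht

/-- The linear equation `u'' = r u` has a solution with `u 0 = 1`, smooth near `0`. -/
lemma exists_linear_second_order {r : ℝ → ℝ} (hr : ∀ᶠ t in 𝓝 (0 : ℝ), ContDiffAt ℝ ∞ r t) :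
    ∃ u : ℝ → ℝ, u 0 = 1 ∧ ∀ᶠ t in 𝓝 (0 : ℝ), ContDiffAt ℝ ∞ u t ∧
      deriv (deriv u) t = r t * u t := by
  -- The time is added as a first component, to make the equation autonomous.
  have hV : ∀ᶠ x : ℝ × ℝ × ℝ in 𝓝 (0, 1, 0),
      ContDiffAt ℝ ∞ (fun x : ℝ × ℝ × ℝ ↦ ((1 : ℝ), x.2.2, r x.1 * x.2.1)) x := by
    have : Tendsto (fun x : ℝ × ℝ × ℝ ↦ x.1) (𝓝 (0, 1, 0)) (𝓝 0) :=
      (continuous_fst.tendsto _)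
    filter_upwards [this.eventually hr] with x hx
    have h1 : ContDiffAt ℝ ∞ (fun x : ℝ × ℝ × ℝ ↦ r x.1) x := hx.comp x contDiffAt_fst
    fun_prop
  obtain ⟨X, hX0, hX⟩ := exists_integralCurve hV
  have htime : (fun t ↦ (X t).1) =ᶠ[𝓝 0] fun t ↦ t := by
    refine ODE_solution_unique_of_eventually (v := fun _ _ ↦ (1 : ℝ)) (s := fun _ ↦ Set.univ)
      (K := 0) (t₀ := 0) (.of_forall fun _ ↦ ?_) ?_ (.of_forall fun t ↦ ⟨hasDerivAt_id t, trivial⟩)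
      (by simp [hX0])
    · exact (LipschitzWith.const (1 : ℝ)).lipschitzOnWith
    · filter_upwards [hX] with t ht using ⟨ht.1.fst, trivial⟩
  refine ⟨fun t ↦ (X t).2.1, by simp [hX0], ?_⟩
  filter_upwards [hX.eventually_nhds, htime] with t ht htt
  have hd1 : ∀ s a b c, HasDerivAt X (a, b, c) s → HasDerivAt (fun t ↦ (X t).2.1) b s :=
    fun s a b c h ↦ by simpa using (HasFDerivAt.fst (HasFDerivAt.snd h.hasFDerivAt)).hasDerivAt
  have hd2 : ∀ s a b c, HasDerivAt X (a, b, c) s → HasDerivAt (fun t ↦ (X t).2.2) c s :=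
    fun s a b c h ↦ by simpa using (HasFDerivAt.snd (HasFDerivAt.snd h.hasFDerivAt)).hasDerivAt
  have h1 : deriv (fun t ↦ (X t).2.1) =ᶠ[𝓝 t] fun t ↦ (X t).2.2 := by
    filter_upwards [ht] with s hs using (hd1 _ _ _ _ hs.1).deriv
  refine ⟨ht.self_of_nhds.2.snd.fst, ?_⟩
  rw [h1.deriv_eq, (hd2 _ _ _ _ ht.self_of_nhds.1).deriv]
  rw [htt]

lemma exists_local_leftInverse {F : ℝ → ℝ} {a : ℝ} (hF : ∀ᶠ t in 𝓝 a, ContDiffAt ℝ ∞ F t)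
    (h0 : deriv F a ≠ 0) :
    ∃ σ : ℝ → ℝ, (∀ᶠ y in 𝓝 (F a), ContDiffAt ℝ ∞ σ y) ∧ ∀ᶠ t in 𝓝 a, σ (F t) = t := by
  have hs : HasStrictFDerivAt F (ContinuousLinearEquiv.unitsEquivAut ℝ (Units.mk0 _ h0) : ℝ →L[ℝ] ℝ)
      a := (hF.self_of_nhds.hasStrictDerivAt (by simp)).hasStrictFDerivAt_equiv h0
  set Φ := hs.toOpenPartialHomeomorph F with hΦ
  have hΦF : (Φ : ℝ → ℝ) = F := rfl
  refine ⟨Φ.symm, ?_, hs.eventually_left_inverse⟩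
  have hcont : ContinuousAt Φ.symm (F a) := hs.localInverse_continuousAt
  have hΦa : Φ.symm (F a) = a := hs.localInverse_apply_image
  have hd : ContinuousAt (deriv F) a :=
    (hF.self_of_nhds.derivWithin (m := ∞) (by simp)).continuousAt
  have h1 : ∀ᶠ t in 𝓝 a, ContDiffAt ℝ ∞ F t ∧ deriv F t ≠ 0 := hF.and (hd.eventually_ne h0)
  have hcont' : Tendsto Φ.symm (𝓝 (F a)) (𝓝 a) := by
    have := hcont.tendsto
    rwa [hΦa] at this
  filter_upwards [hcont'.eventually h1,
    Φ.open_target.mem_nhds hs.image_mem_toOpenPartialHomeomorph_target] with y hy hyt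
  exact Φ.contDiffAt_symm_deriv hy.2 hyt (hy.1.differentiableAt (by simp)).hasDerivAt hy.1

lemma exists_contDiff_eventuallyEq {Φ : ℝ → ℝ} {a : ℝ} (hΦ : ∀ᶠ t in 𝓝 a, ContDiffAt ℝ ∞ Φ t) :
    ∃ Ψ : ℝ → ℝ, ContDiff ℝ ∞ Ψ ∧ Ψ =ᶠ[𝓝 a] Φ := by
  obtain ⟨ε, hε, h⟩ := Metric.eventually_nhds_iff_ball.1 hΦ
  let b : ContDiffBump a := ⟨ε / 3, ε / 2, by positivity, by linarith⟩
  refine ⟨fun t ↦ b t * Φ t, ?_, ?_⟩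
  · refine contDiff_iff_contDiffAt.2 fun t ↦ ?_
    by_cases ht : t ∈ Metric.ball a ε
    · exact b.contDiffAt.mul (h t ht)
    · have : (fun t ↦ b t * Φ t) =ᶠ[𝓝 t] fun _ ↦ 0 := by
        have hm : (tsupport b)ᶜ ∈ 𝓝 t := by
          refine (isClosed_tsupport _).isOpen_compl.mem_nhds fun hm ↦ ht ?_
          rw [b.tsupport_eq] at hm
          exact Metric.closedBall_subset_ball (show ε / 2 < ε by linarith) hm
        filter_upwards [hm] with s hs
        rw [image_eq_zero_of_notMem_tsupport hs, zero_mul]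
      exact contDiffAt_const.congr_of_eventuallyEq this
  · filter_upwards [b.eventuallyEq_one] with t ht
    simp [ht]

/-! ### Metrics and connections on an open subset of a vector space -/

section Local

variable {E : Type*} [NormedAddCommGroup E] [NormedSpace ℝ E]

/-- `Γ` is the Levi-Civita connection of the pseudo-Riemannian metric `G` on the open set `U`, in
the sense that `∇_u v = D_u v + Γ u v`; the last field is the Koszul formula. -/
structure IsLeviCivitaOn (G : E → E →L[ℝ] E →L[ℝ] ℝ) (Γ : E → E →L[ℝ] E →L[ℝ] E) (U : Set E) :
    Prop where
  isOpen : IsOpen U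
  contDiffAt_metric : ∀ z ∈ U, ContDiffAt ℝ ∞ G z
  contDiffAt_connection : ∀ z ∈ U, ContDiffAt ℝ ∞ Γ z
  symm : ∀ z ∈ U, ∀ u v, G z u v = G z v u
  nondegenerate : ∀ z ∈ U, ∀ u, (∀ v, G z u v = 0) → u = 0
  koszul : ∀ z ∈ U, ∀ u v w, 2 * G z (Γ z u v) w =
    fderiv ℝ G z u v w + fderiv ℝ G z v u w - fderiv ℝ G z w u v

/-- The Jacobi operator `v ↦ R(w, v) w` at `y` of the connection `Γ`. -/
noncomputable def localJacobi (Γ : E → E →L[ℝ] E →L[ℝ] E) (y w v : E) : E :=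
  fderiv ℝ Γ y w v w - fderiv ℝ Γ y v w w + Γ y w (Γ y v w) - Γ y v (Γ y w w)

lemma fderiv_fderiv_comm {F : Type*} [NormedAddCommGroup F] [NormedSpace ℝ F] {f : E → F} {y : E}
    (hf : ContDiffAt ℝ ∞ f y) (a b : E) :
    fderiv ℝ (fderiv ℝ f) y a b = fderiv ℝ (fderiv ℝ f) y b a :=
  (hf.isSymmSndFDerivAt (by simp; exact WithTop.coe_le_coe.2 le_top)) a b

lemma fderiv_clm_apply_const₂ {F : Type*} [NormedAddCommGroup F] [NormedSpace ℝ F]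
    {B : E → E →L[ℝ] E →L[ℝ] F} {y : E} (hB : DifferentiableAt ℝ B y) (v w x : E) :
    fderiv ℝ (fun z ↦ B z v w) y x = fderiv ℝ B y x v w := by
  have h := (hB.hasFDerivAt.clm_apply (hasFDerivAt_const v y)).clm_apply (hasFDerivAt_const w y)
  rw [h.fderiv]
  simp

namespace IsLeviCivitaOn

variable {G : E → E →L[ℝ] E →L[ℝ] ℝ} {Γ : E → E →L[ℝ] E →L[ℝ] E} {U : Set E}

lemma fderiv_symm (h : IsLeviCivitaOn G Γ U) {z : E} (hz : z ∈ U) (u v w : E) :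
    fderiv ℝ G z u v w = fderiv ℝ G z u w v := by
  have hd := (h.contDiffAt_metric z hz).differentiableAt (by simp)
  rw [← fderiv_clm_apply_const₂ hd, ← fderiv_clm_apply_const₂ hd]
  have : (fun z ↦ G z v w) =ᶠ[𝓝 z] fun z ↦ G z w v := by
    filter_upwards [h.isOpen.mem_nhds hz] with z' hz' using h.symm z' hz' v w
  rw [this.fderiv_eq]

lemma ext_of_metric (h : IsLeviCivitaOn G Γ U) {z : E} (hz : z ∈ U) {u v : E}
    (huv : ∀ w, G z u w = G z v w) : u = v := by
  refine sub_eq_zero.1 (h.nondegenerate z hz _ fun w ↦ ?_)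
  rw [map_sub, sub_apply, huv, sub_self]

lemma connection_symm (h : IsLeviCivitaOn G Γ U) {z : E} (hz : z ∈ U) (u v : E) :
    Γ z u v = Γ z v u := by
  refine h.ext_of_metric hz fun w ↦ ?_
  have h1 := h.koszul z hz u v w
  have h2 := h.koszul z hz v u w
  rw [h.fderiv_symm hz w v u] at h2
  linarith

/-- The transformation law of the Levi-Civita connection under a change of coordinates `τ`. -/
lemma connection_pullback {G' : E → E →L[ℝ] E →L[ℝ] ℝ} {Γ' : E → E →L[ℝ] E →L[ℝ] E} {U' : Set E}
    (h : IsLeviCivitaOn G Γ U) (h' : IsLeviCivitaOn G' Γ' U') {τ : E → E} {z : E}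
    (hz' : z ∈ U') (hz : τ z ∈ U) (hτ : ContDiffAt ℝ ∞ τ z)
    (hsurj : Function.Surjective (fderiv ℝ τ z))
    (hpull : ∀ᶠ y in 𝓝 z, ∀ v w, G' y v w = G (τ y) (fderiv ℝ τ y v) (fderiv ℝ τ y w)) (u v : E) :
    fderiv ℝ τ z (Γ' z u v) =
      Γ (τ z) (fderiv ℝ τ z u) (fderiv ℝ τ z v) + fderiv ℝ (fderiv ℝ τ) z u v := by
  have hd' := (h'.contDiffAt_metric z hz').differentiableAt (by simp)
  have hd := (h.contDiffAt_metric _ hz).differentiableAt (by simp)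
  have hdτ := hτ.differentiableAt (by simp)
  have hddτ : DifferentiableAt ℝ (fderiv ℝ τ) z :=
    (hτ.fderiv_right (m := ∞) (by simp)).differentiableAt (by simp)
  have hsymτ : ∀ a b, fderiv ℝ (fderiv ℝ τ) z a b = fderiv ℝ (fderiv ℝ τ) z b a :=
    fderiv_fderiv_comm hτ
  have hder : ∀ x a b, fderiv ℝ G' z x a b =
      fderiv ℝ G (τ z) (fderiv ℝ τ z x) (fderiv ℝ τ z a) (fderiv ℝ τ z b)
      + G (τ z) (fderiv ℝ (fderiv ℝ τ) z x a) (fderiv ℝ τ z b)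
      + G (τ z) (fderiv ℝ τ z a) (fderiv ℝ (fderiv ℝ τ) z x b) := by
    intro x a b
    rw [← fderiv_clm_apply_const₂ hd']
    have he : (fun y ↦ G' y a b) =ᶠ[𝓝 z] fun y ↦ G (τ y) (fderiv ℝ τ y a) (fderiv ℝ τ y b) := by
      filter_upwards [hpull] with y hy using hy a b
    rw [he.fderiv_eq]
    have h1 := fun a ↦ hddτ.hasFDerivAt.clm_apply (hasFDerivAt_const a z)
    have h2 := ((hd.hasFDerivAt.comp z hdτ.hasFDerivAt).clm_apply (h1 a)).clm_apply (h1 b)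
    refine (congrArg (fun A : E →L[ℝ] ℝ ↦ A x) h2.fderiv).trans ?_
    simp
    ring
  refine h.ext_of_metric hz fun w ↦ ?_
  obtain ⟨w, rfl⟩ := hsurj w
  have k' := h'.koszul z hz' u v w
  have k := h.koszul _ hz (fderiv ℝ τ z u) (fderiv ℝ τ z v) (fderiv ℝ τ z w)
  rw [hpull.self_of_nhds, hder, hder, hder, hsymτ v u, hsymτ w u, hsymτ w v] at k'
  rw [map_add, add_apply]
  linarith [h.symm _ hz (fderiv ℝ τ z u) (fderiv ℝ (fderiv ℝ τ) z v w),
    h.symm _ hz (fderiv ℝ τ z v) (fderiv ℝ (fderiv ℝ τ) z u w)]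

end IsLeviCivitaOn

/-- The Jacobi operator is a tensor: two connections which are related by the transformation law of
connections under `τ` have `τ`-related Jacobi operators. -/
lemma localJacobi_pullback {Γ Γ' : E → E →L[ℝ] E →L[ℝ] E} {τ : E → E} {y : E}
    (hΓ : DifferentiableAt ℝ Γ (τ y)) (hΓ' : DifferentiableAt ℝ Γ' y) (hτ : ContDiffAt ℝ ∞ τ y)
    (hlaw : ∀ᶠ z in 𝓝 y, ∀ u v, fderiv ℝ τ z (Γ' z u v) =
      Γ (τ z) (fderiv ℝ τ z u) (fderiv ℝ τ z v) + fderiv ℝ (fderiv ℝ τ) z u v) (w v : E) :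
    fderiv ℝ τ y (localJacobi Γ' y w v) =
      localJacobi Γ (τ y) (fderiv ℝ τ y w) (fderiv ℝ τ y v) := by
  have hdτ := hτ.differentiableAt (by simp)
  have hτ1 : ContDiffAt ℝ ∞ (fderiv ℝ τ) y := hτ.fderiv_right (m := ∞) (by simp)
  have hτ2 : ContDiffAt ℝ ∞ (fderiv ℝ (fderiv ℝ τ)) y := hτ1.fderiv_right (m := ∞) (by simp)
  have hddτ := hτ1.differentiableAt (by simp)
  have hdddτ := hτ2.differentiableAt (by simp)
  have hsym : ∀ a b, fderiv ℝ (fderiv ℝ τ) y a b = fderiv ℝ (fderiv ℝ τ) y b a :=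
    fderiv_fderiv_comm hτ
  have hsym3 : ∀ a b c, fderiv ℝ (fderiv ℝ (fderiv ℝ τ)) y a b c =
      fderiv ℝ (fderiv ℝ (fderiv ℝ τ)) y b a c := fun a b c ↦
    congrArg (fun A : E →L[ℝ] E ↦ A c) (fderiv_fderiv_comm hτ1 a b)
  have hder : ∀ x a b, fderiv ℝ (fderiv ℝ τ) y x (Γ' y a b)
      + fderiv ℝ τ y (fderiv ℝ Γ' y x a b) =
      fderiv ℝ Γ (τ y) (fderiv ℝ τ y x) (fderiv ℝ τ y a) (fderiv ℝ τ y b)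
      + Γ (τ y) (fderiv ℝ (fderiv ℝ τ) y x a) (fderiv ℝ τ y b)
      + Γ (τ y) (fderiv ℝ τ y a) (fderiv ℝ (fderiv ℝ τ) y x b)
      + fderiv ℝ (fderiv ℝ (fderiv ℝ τ)) y x a b := by
    intro x a b
    have he : (fun z ↦ fderiv ℝ τ z (Γ' z a b)) =ᶠ[𝓝 y]
        fun z ↦ Γ (τ z) (fderiv ℝ τ z a) (fderiv ℝ τ z b) + fderiv ℝ (fderiv ℝ τ) z a b := by
      filter_upwards [hlaw] with z hz using hz a b
    have h1 := fun a ↦ hddτ.hasFDerivAt.clm_apply (hasFDerivAt_const a y)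
    have hl := hddτ.hasFDerivAt.clm_apply
      ((hΓ'.hasFDerivAt.clm_apply (hasFDerivAt_const a y)).clm_apply (hasFDerivAt_const b y))
    have hr := (((hΓ.hasFDerivAt.comp y hdτ.hasFDerivAt).clm_apply (h1 a)).clm_apply (h1 b)).add
      ((hdddτ.hasFDerivAt.clm_apply (hasFDerivAt_const a y)).clm_apply (hasFDerivAt_const b y))
    have := congrArg (fun A : E →L[ℝ] E ↦ A x) (hl.fderiv.symm.trans (he.fderiv_eq.trans hr.fderiv))
    simp at this
    rw [add_comm, this]
    abel
  have e1 := hder w v w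
  have e2 := hder v w w
  have hlaw' := hlaw.self_of_nhds
  have e3 := hlaw' w (Γ' y v w)
  have e4 := hlaw' v (Γ' y w w)
  rw [hlaw' v w, map_add] at e3
  rw [hlaw' w w, map_add] at e4
  rw [hsym3 v w w, hsym v w] at e2
  unfold localJacobi
  simp only [map_add, map_sub]
  rw [e3, e4, hsym v w]
  linear_combination (norm := module) e1 - e2

/-- The Hessian of `f` with respect to the connection `Γ`, on the diagonal. -/
noncomputable def localHessian (Γ : E → E →L[ℝ] E →L[ℝ] E) (f : E → ℝ) (y w : E) : ℝ :=
  fderiv ℝ (fderiv ℝ f) y w w - fderiv ℝ f y (Γ y w w)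

section Conformal

variable {G G' : E → E →L[ℝ] E →L[ℝ] ℝ} {Γ Γ' : E → E →L[ℝ] E →L[ℝ] E} {U : Set E} {f : E → ℝ}

lemma IsLeviCivitaOn.fderiv_conformal (h : IsLeviCivitaOn G Γ U)
    (h' : IsLeviCivitaOn G' Γ' U) (hf : ∀ z ∈ U, ContDiffAt ℝ ∞ f z)
    (hconf : ∀ z ∈ U, ∀ u v, G' z u v = Real.exp (2 * f z) * G z u v) {z : E} (hz : z ∈ U)
    (x a b : E) : fderiv ℝ G' z x a b = Real.exp (2 * f z) *
      (2 * fderiv ℝ f z x * G z a b + fderiv ℝ G z x a b) := by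
  have hd' := (h'.contDiffAt_metric z hz).differentiableAt (by simp)
  have hd := (h.contDiffAt_metric z hz).differentiableAt (by simp)
  have hdf := (hf z hz).differentiableAt (by simp)
  rw [← fderiv_clm_apply_const₂ hd', ← fderiv_clm_apply_const₂ hd]
  have he : (fun y ↦ G' y a b) =ᶠ[𝓝 z] fun y ↦ Real.exp (2 * f y) * G y a b := by
    filter_upwards [h.isOpen.mem_nhds hz] with y hy using hconf y hy a b
  have hG : DifferentiableAt ℝ (fun y ↦ G y a b) z :=
    (hd.clm_apply (differentiableAt_const _)).clm_apply (differentiableAt_const _)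
  rw [he.fderiv_eq]
  refine (congrArg (fun A : E →L[ℝ] ℝ ↦ A x)
    ((hdf.hasFDerivAt.const_mul 2).exp.mul hG.hasFDerivAt).fderiv).trans ?_
  simp
  ring

/-- How the Levi-Civita connection changes when the metric is multiplied by `e^{2f}`; `N` is the
gradient of `f`. -/
lemma IsLeviCivitaOn.connection_conformal (h : IsLeviCivitaOn G Γ U)
    (h' : IsLeviCivitaOn G' Γ' U) (hf : ∀ z ∈ U, ContDiffAt ℝ ∞ f z)
    (hconf : ∀ z ∈ U, ∀ u v, G' z u v = Real.exp (2 * f z) * G z u v) {z N : E} (hz : z ∈ U)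
    (hN : ∀ w, G z N w = fderiv ℝ f z w) (u v : E) :
    Γ' z u v = Γ z u v + fderiv ℝ f z u • v + fderiv ℝ f z v • u - G z u v • N := by
  have hder := h.fderiv_conformal h' hf hconf hz
  refine h.ext_of_metric hz fun w ↦ ?_
  have k' := h'.koszul z hz u v w
  have k := h.koszul z hz u v w
  rw [hconf z hz, hder, hder, hder] at k'
  simp only [map_add, map_sub, map_smul, add_apply, sub_apply, smul_apply, smul_eq_mul, hN]
  refine mul_left_cancel₀ (mul_ne_zero two_ne_zero (Real.exp_ne_zero (2 * f z))) ?_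
  rw [h.symm z hz v w, h.symm z hz u w]
  linear_combination k' - Real.exp (2 * f z) * k + Real.exp (2 * f z) * 2 *
    (fderiv ℝ f z v * h.symm z hz u w + fderiv ℝ f z u * h.symm z hz v w)

/-- The gradient of `f` is smooth where the metric does not vanish identically. It is recovered
from the difference of the connections of `G` and of `e^{2f} G`, so that no inverse of the metric
is needed. -/
lemma IsLeviCivitaOn.exists_gradient (h : IsLeviCivitaOn G Γ U)
    (h' : IsLeviCivitaOn G' Γ' U) (hf : ∀ z ∈ U, ContDiffAt ℝ ∞ f z)
    (hconf : ∀ z ∈ U, ∀ u v, G' z u v = Real.exp (2 * f z) * G z u v) {y u₀ : E} (hy : y ∈ U)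
    (hu₀ : G y u₀ u₀ ≠ 0) : ∃ N : E → E, DifferentiableAt ℝ N y ∧
      ∀ᶠ z in 𝓝 y, ∀ w, G z (N z) w = fderiv ℝ f z w := by
  have hG : ∀ z ∈ U, DifferentiableAt ℝ (fun z ↦ G z u₀ u₀) z := fun z hz ↦
    ((((h.contDiffAt_metric z hz).differentiableAt (by simp)).clm_apply
      (differentiableAt_const _)).clm_apply (differentiableAt_const _))
  refine ⟨fun z ↦ (G z u₀ u₀)⁻¹ • (Γ z u₀ u₀ + (2 * fderiv ℝ f z u₀) • u₀ - Γ' z u₀ u₀), ?_, ?_⟩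
  · have h1 := (h.contDiffAt_connection y hy).differentiableAt (by simp)
    have h2 := (h'.contDiffAt_connection y hy).differentiableAt (by simp)
    have h3 : DifferentiableAt ℝ (fderiv ℝ f) y :=
      ((hf y hy).fderiv_right (m := ∞) (by simp)).differentiableAt (by simp)
    have h4 := (hG y hy).inv hu₀
    refine h4.smul (((h1.clm_apply (differentiableAt_const _)).clm_apply
      (differentiableAt_const _)).add (((h3.clm_apply (differentiableAt_const _)).const_mul
        _).smul_const _) |>.sub ((h2.clm_apply (differentiableAt_const _)).clm_apply
      (differentiableAt_const _)))
  · filter_upwards [h.isOpen.mem_nhds hy, (hG y hy).continuousAt.eventually_ne hu₀] with z hz hne w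
    have hder := h.fderiv_conformal h' hf hconf hz
    have k' := h'.koszul z hz u₀ u₀ w
    have k := h.koszul z hz u₀ u₀ w
    rw [hconf z hz, hder, hder] at k'
    simp only [map_add, map_sub, map_smul, add_apply, sub_apply, smul_apply, smul_eq_mul]
    rw [inv_mul_eq_iff_eq_mul₀ hne]
    refine mul_left_cancel₀ (mul_ne_zero two_ne_zero (Real.exp_ne_zero (2 * f z))) ?_
    linear_combination Real.exp (2 * f z) * k - k'

/-- The Jacobi operator of a null vector `w` on `w^⊥`, modulo `w`, changes by a multiple of the
identity when the metric is multiplied by `e^{2f}`. -/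
lemma IsLeviCivitaOn.localJacobi_conformal (h : IsLeviCivitaOn G Γ U)
    (h' : IsLeviCivitaOn G' Γ' U) (hf : ∀ z ∈ U, ContDiffAt ℝ ∞ f z)
    (hconf : ∀ z ∈ U, ∀ u v, G' z u v = Real.exp (2 * f z) * G z u v) {y u₀ : E} (hy : y ∈ U)
    (hu₀ : G y u₀ u₀ ≠ 0) {w v : E} (hw : G y w w = 0) (hv : G y w v = 0) :
    ∃ c : ℝ, localJacobi Γ' y w v = localJacobi Γ y w v +
      (localHessian Γ f y w - fderiv ℝ f y w ^ 2) • v + c • w := by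
  obtain ⟨N, hNd, hN⟩ := h.exists_gradient h' hf hconf hy hu₀
  have hd := (h.contDiffAt_metric y hy).differentiableAt (by simp)
  have hdΓ := (h.contDiffAt_connection y hy).differentiableAt (by simp)
  have hdΓ' := (h'.contDiffAt_connection y hy).differentiableAt (by simp)
  have hddf : DifferentiableAt ℝ (fderiv ℝ f) y :=
    ((hf y hy).fderiv_right (m := ∞) (by simp)).differentiableAt (by simp)
  have hlaw : ∀ᶠ z in 𝓝 y, ∀ a b, Γ' z a b =
      Γ z a b + fderiv ℝ f z a • b + fderiv ℝ f z b • a - G z a b • N z := by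
    filter_upwards [h.isOpen.mem_nhds hy, hN] with z hz hNz a b
    exact h.connection_conformal h' hf hconf hz hNz a b
  have hder : ∀ x a b, fderiv ℝ Γ' y x a b = fderiv ℝ Γ y x a b
      + fderiv ℝ (fderiv ℝ f) y x a • b + fderiv ℝ (fderiv ℝ f) y x b • a
      - (fderiv ℝ G y x a b • N y + G y a b • fderiv ℝ N y x) := by
    intro x a b
    rw [← fderiv_clm_apply_const₂ hdΓ']
    have he : (fun z ↦ Γ' z a b) =ᶠ[𝓝 y] fun z ↦
        Γ z a b + fderiv ℝ f z a • b + fderiv ℝ f z b • a - G z a b • N z := by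
      filter_upwards [hlaw] with z hz using hz a b
    have h1 := (hdΓ.hasFDerivAt.clm_apply (hasFDerivAt_const a y)).clm_apply (hasFDerivAt_const b y)
    have h2 := fun a ↦ hddf.hasFDerivAt.clm_apply (hasFDerivAt_const a y)
    have h3 := (hd.hasFDerivAt.clm_apply (hasFDerivAt_const a y)).clm_apply (hasFDerivAt_const b y)
    have h4 := ((h1.add ((h2 a).smul_const b)).add ((h2 b).smul_const a)).sub
      (h3.smul hNd.hasFDerivAt)
    rw [he.fderiv_eq]
    refine (congrArg (fun A : E →L[ℝ] E ↦ A x) h4.fderiv).trans ?_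
    simp
    abel
  have hlaw' := hlaw.self_of_nhds
  have hsymG := h.symm y hy
  -- The coefficient of the gradient vanishes by the Koszul formula.
  have k1 := h.koszul y hy w v w
  have k2 := h.koszul y hy w w v
  have hgrad : fderiv ℝ G y w v w - fderiv ℝ G y v w w + G y w (Γ y v w) - G y v (Γ y w w) = 0 := by
    rw [h.connection_symm hy v w, hsymG w, hsymG v]
    linear_combination (1 / 2 : ℝ) * k1 - (1 / 2 : ℝ) * k2 + (3 / 2 : ℝ) * h.fderiv_symm hy w v w
  refine ⟨- fderiv ℝ (fderiv ℝ f) y w v + fderiv ℝ f y (Γ y v w)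
    + fderiv ℝ f y v * fderiv ℝ f y w, ?_⟩
  unfold localJacobi localHessian
  rw [hder, hder, hlaw' v w, hlaw' w w, hlaw' w, hlaw' v]
  simp only [hsymG v w, hv, hw, map_add, map_smul, zero_smul, sub_zero, smul_eq_mul]
  rw [fderiv_fderiv_comm (hf y hy) v w, h.connection_symm hy w v]
  have : (fderiv ℝ G y w v w - fderiv ℝ G y v w w + G y w (Γ y v w) - G y v (Γ y w w)) • N y =
      0 := by
    rw [hgrad, zero_smul]
  linear_combination (norm := module) -this

end Conformal

end Local

/-! ### The metric and its connection in a chart -/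

lemma contDiffAt_smul_const {E F : Type*} [NormedAddCommGroup E] [NormedSpace ℝ E]
    [NormedAddCommGroup F] [NormedSpace ℝ F] {f : E → ℝ} {y : E} (h : ContDiffAt ℝ ∞ f y) (c : F) :
    ContDiffAt ℝ ∞ (fun z ↦ f z • c) y :=
  h.smul contDiffAt_const

lemma sum_rotate {ι : Type*} [Fintype ι] (F : ι → ι → ι → ℝ) :
    ∑ k, ∑ i, ∑ j, F k i j = ∑ i, ∑ j, ∑ k, F k i j := by
  rw [Finset.sum_comm]
  exact Finset.sum_congr rfl fun i _ ↦ Finset.sum_comm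

section Chart

variable {m : ℕ} {M : Type*} [TopologicalSpace M] [ChartedSpace (Model m) M]

/-- Tangent spaces at different points are all copies of the model space, which allows vectors at
points that are only propositionally equal to be compared. -/
lemma form_congr {g : ∀ x : M, Tan m x →L[ℝ] Tan m x →L[ℝ] ℝ} {z z' : M} (h : z = z')
    {u v : Tan m z} {u' v' : Tan m z'} (hu : (show Model m from u) = u')
    (hv : (show Model m from v) = v') : g z u v = g z' u' v' := by
  subst h
  change u = u' at hu
  change v = v' at hv
  rw [hu, hv]

lemma totalSpace_ext {x x' : M} (h : x = x') {v : Tan m x} {v' : Tan m x'}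
    (hv : (show Model m from v) = v') : (⟨x, v⟩ : TangentBundle 𝓘(ℝ, Model m) M) = ⟨x', v'⟩ := by
  subst h
  change v = v' at hv
  rw [hv]

/-- The coordinate change from the chart at `x` to the chart at `x₀`. -/
noncomputable def transition (x x₀ : M) : Model m → Model m :=
  extChartAt 𝓘(ℝ, Model m) x₀ ∘ (extChartAt 𝓘(ℝ, Model m) x).symm

lemma symm_transition {x x₀ : M} {y : Model m}
    (hx : (extChartAt 𝓘(ℝ, Model m) x).symm y ∈ (chartAt (Model m) x₀).source) :
    (extChartAt 𝓘(ℝ, Model m) x₀).symm (transition x x₀ y) =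
      (extChartAt 𝓘(ℝ, Model m) x).symm y :=
  (extChartAt 𝓘(ℝ, Model m) x₀).left_inv (by rwa [extChartAt_source])

lemma transition_mem_target {x x₀ : M} {y : Model m}
    (hx : (extChartAt 𝓘(ℝ, Model m) x).symm y ∈ (chartAt (Model m) x₀).source) :
    transition x x₀ y ∈ (extChartAt 𝓘(ℝ, Model m) x₀).target :=
  (extChartAt 𝓘(ℝ, Model m) x₀).map_source (by rwa [extChartAt_source])

/-- The domain of `transition x x₀` is open. -/
lemma eventually_mem_source {x x₀ : M} {y : Model m}
    (hy : y ∈ (extChartAt 𝓘(ℝ, Model m) x).target)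
    (hx : (extChartAt 𝓘(ℝ, Model m) x).symm y ∈ (chartAt (Model m) x₀).source) :
    ∀ᶠ z in 𝓝 y, z ∈ (extChartAt 𝓘(ℝ, Model m) x).target ∧
      (extChartAt 𝓘(ℝ, Model m) x).symm z ∈ (chartAt (Model m) x₀).source :=
  ((isOpen_extChartAt_target x).eventually_mem hy).and
    ((continuousAt_extChartAt_symm'' hy).preimage_mem_nhds ((chartAt _ x₀).open_source.mem_nhds hx))

variable [IsManifold 𝓘(ℝ, Model m) ∞ M]

/-- The chain rule in the chart at `x₀`. -/
lemma mfderiv_eq_chartDeriv {N : Type*} [NormedAddCommGroup N] [NormedSpace ℝ N] {F : N → M} {p : N}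
    (x₀ : M) (hF : MDifferentiableAt 𝓘(ℝ, N) 𝓘(ℝ, Model m) F p)
    (hp : F p ∈ (chartAt (Model m) x₀).source) (v : N) :
    (show Model m from mfderiv 𝓘(ℝ, N) 𝓘(ℝ, Model m) F p v) =
      (show Model m from chartDeriv x₀ (extChartAt 𝓘(ℝ, Model m) x₀ (F p))
        (fderiv ℝ (extChartAt 𝓘(ℝ, Model m) x₀ ∘ F) p v)) := by
  have hp' : F p ∈ (extChartAt 𝓘(ℝ, Model m) x₀).source := by rwa [extChartAt_source]
  have he : F =ᶠ[𝓝 p] (extChartAt 𝓘(ℝ, Model m) x₀).symm ∘ (extChartAt 𝓘(ℝ, Model m) x₀ ∘ F) := by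
    filter_upwards [hF.continuousAt.preimage_mem_nhds
      ((isOpen_extChartAt_source x₀).mem_nhds hp')] with q hq
    exact ((extChartAt 𝓘(ℝ, Model m) x₀).left_inv hq).symm
  have h1 : MDifferentiableAt 𝓘(ℝ, N) 𝓘(ℝ, Model m) (extChartAt 𝓘(ℝ, Model m) x₀ ∘ F) p :=
    (mdifferentiableAt_extChartAt hp).comp p hF
  have h2 : MDifferentiableAt 𝓘(ℝ, Model m) 𝓘(ℝ, Model m) (extChartAt 𝓘(ℝ, Model m) x₀).symm
      ((extChartAt 𝓘(ℝ, Model m) x₀ ∘ F) p) :=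
    (mdifferentiableOn_extChartAt_symm.mdifferentiableAt
      ((isOpen_extChartAt_target x₀).mem_nhds ((extChartAt 𝓘(ℝ, Model m) x₀).map_source hp')))
  have h3 := mfderiv_comp p h2 h1
  have h4 : mfderiv 𝓘(ℝ, N) 𝓘(ℝ, Model m) F p = (show N →L[ℝ] Model m from
    mfderiv 𝓘(ℝ, N) 𝓘(ℝ, Model m)
      ((extChartAt 𝓘(ℝ, Model m) x₀).symm ∘ (extChartAt 𝓘(ℝ, Model m) x₀ ∘ F)) p) := he.mfderiv_eq
  have h5 : mfderiv 𝓘(ℝ, N) 𝓘(ℝ, Model m) (extChartAt 𝓘(ℝ, Model m) x₀ ∘ F) p =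
    fderiv ℝ (extChartAt 𝓘(ℝ, Model m) x₀ ∘ F) p := mfderiv_eq_fderiv
  rw [h5] at h3
  exact (congrArg (fun A : N →L[ℝ] Model m ↦ A v) h4).trans
    (congrArg (fun A : N →L[ℝ] Model m ↦ A v) h3)

lemma chartDeriv_bijective (x₀ : M) {y : Model m} (hy : y ∈ (extChartAt 𝓘(ℝ, Model m) x₀).target) :
    Function.Bijective (chartDeriv (E := Model m) x₀ y) := by
  have := isInvertible_mfderivWithin_extChartAt_symm (I := 𝓘(ℝ, Model m)) hy
  rw [ModelWithCorners.range_eq_univ, mfderivWithin_univ] at this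
  exact this.bijective

/-- The components of the metric are smooth on the whole domain of the chart, not only at its
centre. -/
lemma gram_contDiffAt_of_mem (g : LorentzMetric m M) (x : M) {y : Model m}
    (hy : y ∈ (extChartAt 𝓘(ℝ, Model m) x).target) (i j : Fin m) :
    ContDiffAt ℝ ∞ (fun y ↦ gram g x y i j) y := by
  have hopen := isOpen_extChartAt_target (I := 𝓘(ℝ, Model m)) x
  have hd : ∀ v : Model m, ContMDiffAt 𝓘(ℝ, Model m) (𝓘(ℝ, Model m).prod 𝓘(ℝ, Model m)) ∞
      (fun y : Model m ↦ Bundle.TotalSpace.mk' (Model m) (E := fun x : M ↦ Tan m x)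
        ((extChartAt 𝓘(ℝ, Model m) x).symm y) (chartDeriv x y v)) y := by
    intro v
    have hT := (contMDiffOn_extChartAt_symm (I := 𝓘(ℝ, Model m)) (n := ∞)
      x).contMDiffOn_tangentMapWithin (m := ∞) (by simp) hopen.uniqueMDiffOn
    have hsec : ContMDiff 𝓘(ℝ, Model m) (𝓘(ℝ, Model m).prod 𝓘(ℝ, Model m)) ∞
        (fun y : Model m ↦ (⟨y, v⟩ : TangentBundle 𝓘(ℝ, Model m) (Model m))) :=
      contMDiff_vectorSpace_iff_contDiff.2 contDiff_const
    have h2 := (hT.comp hsec.contMDiffOn (s := (extChartAt 𝓘(ℝ, Model m) x).target)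
      (fun y hy ↦ hy)).contMDiffAt (hopen.mem_nhds hy)
    refine h2.congr_of_eventuallyEq ?_
    filter_upwards [hopen.mem_nhds hy] with y hy
    simp only [Function.comp, tangentMapWithin, mfderivWithin_of_isOpen hopen hy]
    rfl
  have hsm : ContMDiffAt 𝓘(ℝ, Model m) 𝓘(ℝ, Model m) ∞ (extChartAt 𝓘(ℝ, Model m) x).symm y :=
    (contMDiffOn_extChartAt_symm x).contMDiffAt (hopen.mem_nhds hy)
  have hg := (g.smooth ((extChartAt 𝓘(ℝ, Model m) x).symm y)).comp _ hsm
  have h := ContMDiffAt.clm_bundle_apply₂ (F₁ := Model m) (F₂ := Model m) (F₃ := ℝ)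
    (E₁ := fun x : M ↦ Tan m x) (E₂ := fun x : M ↦ Tan m x) (E₃ := fun _ : M ↦ ℝ)
    (b := (extChartAt 𝓘(ℝ, Model m) x).symm) hg (hd (coordVec i)) (hd (coordVec j))
  rw [Bundle.contMDiffAt_totalSpace] at h
  exact h.2.contDiffAt

lemma model_sum (z : Model m) : z = ∑ i, z i • coordVec i := by
  ext k
  simp [coordVec, Finset.sum_apply, Pi.single_apply]

/-- The metric in the chart at `x₀`, as a field of bilinear forms on the model space. -/
noncomputable def localMetric (g : LorentzMetric m M) (x₀ : M) (y : Model m) :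
    Model m →L[ℝ] Model m →L[ℝ] ℝ :=
  ∑ i, ∑ j, gram g x₀ y i j • (EuclideanSpace.proj i : Model m →L[ℝ] ℝ).smulRight
    (EuclideanSpace.proj j : Model m →L[ℝ] ℝ)

/-- The Levi-Civita connection in the chart at `x₀`, as a field of bilinear maps on the model
space whose components are the Christoffel symbols. -/
noncomputable def localConnection (g : LorentzMetric m M) (x₀ : M) (y : Model m) :
    Model m →L[ℝ] Model m →L[ℝ] Model m :=
  ∑ k, ∑ i, ∑ j, christoffel g x₀ k i j y • (EuclideanSpace.proj i : Model m →L[ℝ] ℝ).smulRight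
    ((EuclideanSpace.proj j : Model m →L[ℝ] ℝ).smulRight (coordVec k))

lemma localMetric_eq_sum (g : LorentzMetric m M) (x₀ : M) (y u v : Model m) :
    localMetric g x₀ y u v = ∑ i, ∑ j, u i * v j * gram g x₀ y i j := by
  simp [localMetric]
  refine Finset.sum_congr rfl fun i _ ↦ Finset.sum_congr rfl fun j _ ↦ ?_
  ring

lemma localMetric_apply (g : LorentzMetric m M) (x₀ : M) (y u v : Model m) :
    localMetric g x₀ y u v = g.form ((extChartAt 𝓘(ℝ, Model m) x₀).symm y)
      (chartDeriv x₀ y u) (chartDeriv x₀ y v) := by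
  rw [localMetric_eq_sum]
  conv_rhs => rw [model_sum u, model_sum v]
  simp only [map_sum, map_smul, sum_apply, smul_apply, smul_eq_mul, Finset.mul_sum]
  rw [Finset.sum_comm]
  refine Finset.sum_congr rfl fun i _ ↦ Finset.sum_congr rfl fun j _ ↦ ?_
  simp only [gram]
  ring

lemma localConnection_apply (g : LorentzMetric m M) (x₀ : M) (y u v : Model m) (k : Fin m) :
    localConnection g x₀ y u v k = ∑ i, ∑ j, christoffel g x₀ k i j y * (u i * v j) := by
  simp [localConnection, coordVec, Pi.single_apply]

lemma gram_det_ne_zero_of_mem (g : LorentzMetric m M) (x : M) {y : Model m}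
    (hy : y ∈ (extChartAt 𝓘(ℝ, Model m) x).target) : (gram g x y).det ≠ 0 := by
  intro h
  obtain ⟨v, hv, h0⟩ := Matrix.exists_vecMul_eq_zero_iff.2 h
  apply hv
  have hz : chartDeriv x y (WithLp.toLp 2 v : Model m) = 0 := by
    apply form_nondegenerate g
    intro w
    obtain ⟨w, rfl⟩ := (chartDeriv_bijective x hy).2 w
    rw [← localMetric_apply, localMetric_eq_sum, Finset.sum_comm]
    refine Finset.sum_eq_zero fun j _ ↦ ?_
    have := congrFun h0 j
    simp only [Matrix.vecMul, dotProduct, Pi.zero_apply] at this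
    rw [← mul_zero (w j), ← this, Finset.mul_sum]
    refine Finset.sum_congr rfl fun i _ ↦ ?_
    change v i * w j * _ = _
    ring
  have := (chartDeriv_bijective x hy).1 (hz.trans (map_zero _).symm)
  funext i
  exact congrArg (fun z : Model m ↦ z i) this

lemma contDiffAt_christoffel_of_mem (g : LorentzMetric m M) (x : M) {y : Model m}
    (hy : y ∈ (extChartAt 𝓘(ℝ, Model m) x).target) (k i j : Fin m) :
    ContDiffAt ℝ ∞ (christoffel g x k i j) y := by
  have hp := fun a b c ↦ contDiffAt_pd (gram_contDiffAt_of_mem g x hy a b) c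
  exact contDiffAt_const.mul (ContDiffAt.sum fun l _ ↦
    (contDiffAt_inv (gram_contDiffAt_of_mem g x hy) (gram_det_ne_zero_of_mem g x hy) k l).mul
      (((hp j l i).add (hp i l j)).sub (hp i j l)))

lemma sum_gram_christoffel_of_mem (g : LorentzMetric m M) (x : M) {y : Model m}
    (hy : y ∈ (extChartAt 𝓘(ℝ, Model m) x).target) (n i j : Fin m) :
    ∑ l, gram g x y n l * christoffel g x l i j y = christoffelLow g x n i j y := by
  have hm : gram g x y * (gram g x y)⁻¹ = 1 :=
    Matrix.mul_nonsing_inv _ (by simpa using gram_det_ne_zero_of_mem g x hy)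
  set c : Fin m → ℝ := fun l ↦ pd i (fun z ↦ gram g x z j l) y + pd j (fun z ↦ gram g x z i l) y
      - pd l (fun z ↦ gram g x z i j) y with hc
  have h1 : ∀ l, christoffel g x l i j y = 1 / 2 * ((gram g x y)⁻¹.mulVec c) l := fun l ↦ rfl
  have h2 : (gram g x y).mulVec ((gram g x y)⁻¹.mulVec c) = c := by
    rw [Matrix.mulVec_mulVec, hm, Matrix.one_mulVec]
  have h3 := congrFun h2 n
  change ∑ l, gram g x y n l * ((gram g x y)⁻¹.mulVec c) l = c n at h3
  change _ = 1 / 2 * c n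
  rw [← h3, Finset.mul_sum]
  refine Finset.sum_congr rfl fun l _ ↦ ?_
  rw [h1]
  ring

lemma fderiv_eq_sum_pd (F : Model m → ℝ) (y u : Model m) :
    fderiv ℝ F y u = ∑ a, u a * pd a F y := by
  conv_lhs => rw [model_sum u]
  simp [pd]

lemma contDiffAt_localMetric (g : LorentzMetric m M) (x₀ : M) {y : Model m}
    (hy : y ∈ (extChartAt 𝓘(ℝ, Model m) x₀).target) : ContDiffAt ℝ ∞ (localMetric g x₀) y :=
  ContDiffAt.sum fun i _ ↦ ContDiffAt.sum fun j _ ↦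
    contDiffAt_smul_const (gram_contDiffAt_of_mem g x₀ hy i j) _

lemma contDiffAt_localConnection (g : LorentzMetric m M) (x₀ : M) {y : Model m}
    (hy : y ∈ (extChartAt 𝓘(ℝ, Model m) x₀).target) : ContDiffAt ℝ ∞ (localConnection g x₀) y :=
  ContDiffAt.sum fun k _ ↦ ContDiffAt.sum fun i _ ↦ ContDiffAt.sum fun j _ ↦
    contDiffAt_smul_const (contDiffAt_christoffel_of_mem g x₀ hy k i j) _

lemma fderiv_localMetric (g : LorentzMetric m M) (x₀ : M) {y : Model m}
    (hy : y ∈ (extChartAt 𝓘(ℝ, Model m) x₀).target) (u v w : Model m) :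
    fderiv ℝ (localMetric g x₀) y u v w =
      ∑ a, ∑ i, ∑ j, u a * v i * w j * pd a (fun z ↦ gram g x₀ z i j) y := by
  rw [← fderiv_clm_apply_const₂ ((contDiffAt_localMetric g x₀ hy).differentiableAt (by simp))]
  simp only [localMetric_eq_sum]
  rw [fderiv_eq_sum_pd]
  have h := gram_contDiffAt_of_mem g x₀ hy
  refine Finset.sum_congr rfl fun a _ ↦ ?_
  rw [pd_sum _ fun i _ ↦ ContDiffAt.sum fun j _ ↦ contDiffAt_const.mul (h i j), Finset.mul_sum]
  refine Finset.sum_congr rfl fun i _ ↦ ?_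
  rw [pd_sum _ fun j _ ↦ contDiffAt_const.mul (h i j), Finset.mul_sum]
  refine Finset.sum_congr rfl fun j _ ↦ ?_
  rw [pd_mul contDiffAt_const (h i j)]
  simp only [pd, fderiv_const_apply]
  simp
  ring

/-- In a chart, the Christoffel symbols satisfy the Koszul formula. -/
lemma isLeviCivitaOn_chart (g : LorentzMetric m M) (x₀ : M) :
    IsLeviCivitaOn (localMetric g x₀) (localConnection g x₀)
      (extChartAt 𝓘(ℝ, Model m) x₀).target where
  isOpen := isOpen_extChartAt_target x₀
  contDiffAt_metric z hz := contDiffAt_localMetric g x₀ hz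
  contDiffAt_connection z hz := contDiffAt_localConnection g x₀ hz
  symm z _ u v := by rw [localMetric_apply, localMetric_apply, g.symm]
  nondegenerate z hz u h := by
    refine (chartDeriv_bijective x₀ hz).1 ((form_nondegenerate g _ _ fun v ↦ ?_).trans
      (map_zero _).symm)
    obtain ⟨v, rfl⟩ := (chartDeriv_bijective x₀ hz).2 v
    rw [← localMetric_apply, h]
  koszul z hz u v w := by
    have h1 : localMetric g x₀ z (localConnection g x₀ z u v) w =
        ∑ i, ∑ j, ∑ l, u i * v j * w l * christoffelLow g x₀ l i j z := by
      rw [localMetric_eq_sum]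
      simp only [localConnection_apply, ← sum_gram_christoffel_of_mem g x₀ hz, Finset.mul_sum,
        Finset.sum_mul]
      rw [Finset.sum_congr rfl fun k _ ↦ sum_rotate _, sum_rotate]
      refine Finset.sum_congr rfl fun i _ ↦ Finset.sum_congr rfl fun j _ ↦ ?_
      rw [Finset.sum_comm]
      refine Finset.sum_congr rfl fun l _ ↦ Finset.sum_congr rfl fun k _ ↦ ?_
      rw [gram_symm g x₀ z l k]
      ring
    rw [h1, fderiv_localMetric g x₀ hz, fderiv_localMetric g x₀ hz, fderiv_localMetric g x₀ hz,
      Finset.sum_comm (f := fun a i ↦ ∑ j, v a * u i * w j * pd a (fun z ↦ gram g x₀ z i j) z),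
      sum_rotate (fun a i j ↦ w a * u i * v j * pd a (fun z ↦ gram g x₀ z i j) z)]
    simp only [Finset.mul_sum, ← Finset.sum_add_distrib, ← Finset.sum_sub_distrib]
    refine Finset.sum_congr rfl fun i _ ↦ Finset.sum_congr rfl fun j _ ↦
      Finset.sum_congr rfl fun l _ ↦ ?_
    unfold christoffelLow
    ring

/-- At the centre of the chart, the Jacobi map is the local Jacobi operator. -/
lemma jacobiMap_eq_localJacobi (g : LorentzMetric m M) {x : M} (w v : Tan m x) :
    (show Model m from jacobiMap g w v) =
      localJacobi (localConnection g x) (extChartAt 𝓘(ℝ, Model m) x x)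
        (show Model m from w) (show Model m from v) := by
  set y := extChartAt 𝓘(ℝ, Model m) x x with hy
  have hyt : y ∈ (extChartAt 𝓘(ℝ, Model m) x).target := mem_extChartAt_target x
  have hC := fun k i j ↦ contDiffAt_christoffel_of_mem g x hyt k i j
  have hd := (contDiffAt_localConnection g x hyt).differentiableAt (by simp)
  have hder : ∀ (a b c : Model m) (l : Fin m), fderiv ℝ (localConnection g x) y a b c l =
      ∑ i, ∑ j, ∑ k, pd i (christoffel g x l j k) y * (a i * b j * c k) := by
    intro a b c l
    rw [← fderiv_clm_apply_const₂ hd]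
    have hd' : DifferentiableAt ℝ (fun z ↦ localConnection g x z b c) y :=
      (hd.clm_apply (differentiableAt_const _)).clm_apply (differentiableAt_const _)
    have h1 := ((EuclideanSpace.proj l : Model m →L[ℝ] ℝ).hasFDerivAt.comp y
      hd'.hasFDerivAt).fderiv
    refine (congrArg (fun A : Model m →L[ℝ] ℝ ↦ A a) h1).symm.trans ?_
    have h2 : (EuclideanSpace.proj l : Model m →L[ℝ] ℝ) ∘ (fun z ↦ localConnection g x z b c) =
        fun z ↦ ∑ j, ∑ k, christoffel g x l j k z * (b j * c k) :=
      funext fun z ↦ localConnection_apply g x z b c l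
    rw [h2, fderiv_eq_sum_pd]
    refine Finset.sum_congr rfl fun i _ ↦ ?_
    rw [pd_sum _ fun j _ ↦ ContDiffAt.sum fun k _ ↦ (hC l j k).mul contDiffAt_const, Finset.mul_sum]
    refine Finset.sum_congr rfl fun j _ ↦ ?_
    rw [pd_sum _ fun k _ ↦ (hC l j k).mul contDiffAt_const, Finset.mul_sum]
    refine Finset.sum_congr rfl fun k _ ↦ ?_
    rw [pd_mul (hC l j k) contDiffAt_const]
    simp only [pd, fderiv_const_apply]
    simp
    ring
  have hquad : ∀ (a b c : Model m) (l : Fin m),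
      localConnection g x y a (localConnection g x y b c) l =
      ∑ i, ∑ j, ∑ k, (∑ n, christoffel g x l i n y * christoffel g x n j k y)
        * (a i * b j * c k) := by
    intro a b c l
    simp only [localConnection_apply, Finset.mul_sum, Finset.sum_mul]
    refine Finset.sum_congr rfl fun i _ ↦ ?_
    rw [sum_rotate]
    refine Finset.sum_congr rfl fun j _ ↦ Finset.sum_congr rfl fun k _ ↦
      Finset.sum_congr rfl fun n _ ↦ ?_
    ring
  ext l
  have h0 : (show Model m from jacobiMap g w v) l = ∑ i, ∑ j, ∑ k, riemannCoeff g x l k i j y *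
      (coord w i * coord v j * coord w k) :=
    (coord_riemann g x w v w l).trans (sum_rotate _)
  refine h0.trans ?_
  change _ = fderiv ℝ (localConnection g x) y (show Model m from w) (show Model m from v)
    (show Model m from w) l
    - fderiv ℝ (localConnection g x) y (show Model m from v) (show Model m from w)
    (show Model m from w) l
    + localConnection g x y (show Model m from w) (localConnection g x y (show Model m from v)
      (show Model m from w)) l
    - localConnection g x y (show Model m from v) (localConnection g x y (show Model m from w)
      (show Model m from w)) l
  rw [hder, (hder (show Model m from v) _ _ l).trans Finset.sum_comm, hquad,
    (hquad (show Model m from v) _ _ l).trans Finset.sum_comm]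
  simp only [← Finset.sum_add_distrib, ← Finset.sum_sub_distrib]
  refine Finset.sum_congr rfl fun i _ ↦ Finset.sum_congr rfl fun j _ ↦
    Finset.sum_congr rfl fun k _ ↦ ?_
  simp only [riemannCoeff, coord, Finset.sum_sub_distrib]
  ring

section Transition

variable {x x₀ : M} {y : Model m}

lemma contDiffAt_transition (hy : y ∈ (extChartAt 𝓘(ℝ, Model m) x).target)
    (hx : (extChartAt 𝓘(ℝ, Model m) x).symm y ∈ (chartAt (Model m) x₀).source) :
    ContDiffAt ℝ ∞ (transition x x₀) y := by
  have h1 : ContMDiffAt 𝓘(ℝ, Model m) 𝓘(ℝ, Model m) ∞ (extChartAt 𝓘(ℝ, Model m) x).symm y :=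
    (contMDiffOn_extChartAt_symm x).contMDiffAt ((isOpen_extChartAt_target x).mem_nhds hy)
  exact ((contMDiffAt_extChartAt' (n := ∞) hx).comp y h1).contDiffAt

lemma chartDeriv_transition (hy : y ∈ (extChartAt 𝓘(ℝ, Model m) x).target)
    (hx : (extChartAt 𝓘(ℝ, Model m) x).symm y ∈ (chartAt (Model m) x₀).source) (v : Model m) :
    (show Model m from chartDeriv x y v) =
      chartDeriv x₀ (transition x x₀ y) (fderiv ℝ (transition x x₀) y v) :=
  mfderiv_eq_chartDeriv x₀ (mdifferentiableOn_extChartAt_symm.mdifferentiableAt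
    ((isOpen_extChartAt_target x).mem_nhds hy)) hx v

lemma localMetric_transition (g : LorentzMetric m M)
    (hy : y ∈ (extChartAt 𝓘(ℝ, Model m) x).target)
    (hx : (extChartAt 𝓘(ℝ, Model m) x).symm y ∈ (chartAt (Model m) x₀).source) (v w : Model m) :
    localMetric g x y v w = localMetric g x₀ (transition x x₀ y)
      (fderiv ℝ (transition x x₀) y v) (fderiv ℝ (transition x x₀) y w) := by
  rw [localMetric_apply, localMetric_apply]
  exact form_congr (symm_transition hx).symm (chartDeriv_transition hy hx v)
    (chartDeriv_transition hy hx w)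

lemma fderiv_transition_bijective (hy : y ∈ (extChartAt 𝓘(ℝ, Model m) x).target)
    (hx : (extChartAt 𝓘(ℝ, Model m) x).symm y ∈ (chartAt (Model m) x₀).source) :
    Function.Bijective (fderiv ℝ (transition x x₀) y) := by
  have hinj : Function.Injective (fderiv ℝ (transition x x₀) y) := by
    intro u v huv
    refine (chartDeriv_bijective x hy).1 ?_
    have h1 := chartDeriv_transition hy hx u
    have h2 := chartDeriv_transition hy hx v
    rw [huv] at h1
    exact h1.trans h2.symm
  exact ⟨hinj, LinearMap.injective_iff_surjective
    (f := (fderiv ℝ (transition x x₀) y : Model m →ₗ[ℝ] Model m)) |>.1 hinj⟩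

lemma localConnection_transition (g : LorentzMetric m M)
    (hy : y ∈ (extChartAt 𝓘(ℝ, Model m) x).target)
    (hx : (extChartAt 𝓘(ℝ, Model m) x).symm y ∈ (chartAt (Model m) x₀).source) (u v : Model m) :
    fderiv ℝ (transition x x₀) y (localConnection g x y u v) =
      localConnection g x₀ (transition x x₀ y) (fderiv ℝ (transition x x₀) y u)
        (fderiv ℝ (transition x x₀) y v) + fderiv ℝ (fderiv ℝ (transition x x₀)) y u v := by
  refine (isLeviCivitaOn_chart g x₀).connection_pullback (isLeviCivitaOn_chart g x) hy
    (transition_mem_target hx) (contDiffAt_transition hy hx) (fderiv_transition_bijective hy hx).2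
    ?_ u v
  filter_upwards [eventually_mem_source hy hx] with z hz v w
  exact localMetric_transition g hz.1 hz.2 v w

end Transition

/-- The Jacobi map is represented by the local Jacobi operator in every chart. -/
lemma jacobiMap_chartDeriv (g : LorentzMetric m M) {x x₀ : M}
    (hx : x ∈ (chartAt (Model m) x₀).source) {w v : Tan m x} {w' v' : Model m}
    (hw : (show Model m from w) = chartDeriv x₀ (extChartAt 𝓘(ℝ, Model m) x₀ x) w')
    (hv : (show Model m from v) = chartDeriv x₀ (extChartAt 𝓘(ℝ, Model m) x₀ x) v') :
    (show Model m from jacobiMap g w v) = chartDeriv x₀ (extChartAt 𝓘(ℝ, Model m) x₀ x)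
      (localJacobi (localConnection g x₀) (extChartAt 𝓘(ℝ, Model m) x₀ x) w' v') := by
  set y := extChartAt 𝓘(ℝ, Model m) x x with hy
  have hyt : y ∈ (extChartAt 𝓘(ℝ, Model m) x).target := mem_extChartAt_target x
  have hyx : (extChartAt 𝓘(ℝ, Model m) x).symm y = x := extChartAt_to_inv x
  have hx' : (extChartAt 𝓘(ℝ, Model m) x).symm y ∈ (chartAt (Model m) x₀).source := by rwa [hyx]
  have hτ : transition x x₀ y = extChartAt 𝓘(ℝ, Model m) x₀ x := by
    rw [transition, Function.comp_apply, hyx]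
  have hself : ∀ v : Model m, (show Model m from chartDeriv x₀ (extChartAt 𝓘(ℝ, Model m) x₀ x)
      (fderiv ℝ (transition x x₀) y v)) = v := by
    intro v
    rw [← hτ]
    exact (chartDeriv_transition hyt hx' v).symm.trans (chartDeriv_self x v)
  have hinj := (chartDeriv_bijective (m := m) x₀ (hτ ▸ transition_mem_target hx')).1
  have hw' : fderiv ℝ (transition x x₀) y (show Model m from w) = w' :=
    hinj ((hself _).trans hw)
  have hv' : fderiv ℝ (transition x x₀) y (show Model m from v) = v' :=
    hinj ((hself _).trans hv)
  have key := localJacobi_pullback (τ := transition x x₀) (y := y)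
    (((isLeviCivitaOn_chart g x₀).contDiffAt_connection _
      (transition_mem_target hx')).differentiableAt (by simp))
    (((isLeviCivitaOn_chart g x).contDiffAt_connection _ hyt).differentiableAt (by simp))
    (contDiffAt_transition hyt hx')
    (by filter_upwards [eventually_mem_source hyt hx'] with z hz u v
        exact localConnection_transition g hz.1 hz.2 u v)
    (show Model m from w) (show Model m from v)
  rw [hw', hv', hτ] at key
  rw [← key, jacobiMap_eq_localJacobi]
  exact (hself _).symm

end Chart

/-! ### Curves and geodesics in charts -/

lemma deriv_comp_eq {E F : Type*} [NormedAddCommGroup E] [NormedSpace ℝ E] [NormedAddCommGroup F]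
    [NormedSpace ℝ F] {τ : E → F} {c : ℝ → E} {t : ℝ} (hτ : ContDiffAt ℝ ∞ τ (c t))
    (hc : ContDiffAt ℝ ∞ c t) : deriv (τ ∘ c) t = fderiv ℝ τ (c t) (deriv c t) :=
  ((hτ.differentiableAt (by simp)).hasFDerivAt.comp_hasDerivAt t
    (hc.differentiableAt (by simp)).hasDerivAt).deriv

lemma eventually_differentiableAt {E F : Type*} [NormedAddCommGroup E] [NormedSpace ℝ E]
    [NormedAddCommGroup F] [NormedSpace ℝ F] {f : E → F} {x : E} (hf : ContDiffAt ℝ ∞ f x) :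
    ∀ᶠ y in 𝓝 x, DifferentiableAt ℝ f y := by
  have h1 : ContDiffAt ℝ 1 f x := hf.of_le (by exact_mod_cast le_top)
  filter_upwards [h1.eventually (by simp)] with y hy using hy.differentiableAt (by simp)

lemma differentiableAt_deriv {F : Type*} [NormedAddCommGroup F] [NormedSpace ℝ F] {f : ℝ → F}
    {t : ℝ} (hf : ContDiffAt ℝ ∞ f t) : DifferentiableAt ℝ (deriv f) t :=
  (hf.derivWithin (m := ∞) (by simp)).differentiableAt (by simp)

lemma deriv_deriv_comp_eq {E F : Type*} [NormedAddCommGroup E] [NormedSpace ℝ E]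
    [NormedAddCommGroup F] [NormedSpace ℝ F] {τ : E → F} {c : ℝ → E} {t : ℝ}
    (hτ : ContDiffAt ℝ ∞ τ (c t)) (hc : ContDiffAt ℝ ∞ c t) :
    deriv (deriv (τ ∘ c)) t =
      fderiv ℝ (fderiv ℝ τ) (c t) (deriv c t) (deriv c t) +
        fderiv ℝ τ (c t) (deriv (deriv c) t) := by
  have he : deriv (τ ∘ c) =ᶠ[𝓝 t] fun s ↦ fderiv ℝ τ (c s) (deriv c s) := by
    filter_upwards [hc.continuousAt.eventually (eventually_differentiableAt hτ),
      eventually_differentiableAt hc] with s hs hs'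
    exact (hs.hasFDerivAt.comp_hasDerivAt s hs'.hasDerivAt).deriv
  have hd : DifferentiableAt ℝ (fderiv ℝ τ) (c t) :=
    (hτ.fderiv_right (m := ∞) (by simp)).differentiableAt (by simp)
  have h1 := hd.hasFDerivAt.comp_hasDerivAt t (hc.differentiableAt (by simp)).hasDerivAt
  rw [he.deriv_eq]
  exact (h1.clm_apply (differentiableAt_deriv hc).hasDerivAt).deriv

/-- Second derivative of a reparametrised curve. -/
lemma deriv_deriv_reparam {E : Type*} [NormedAddCommGroup E] [NormedSpace ℝ E] {c : ℝ → E}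
    {φ : ℝ → ℝ} {s : ℝ} (hc : ContDiffAt ℝ ∞ c (φ s)) (hφ : ContDiffAt ℝ ∞ φ s) :
    deriv (deriv (c ∘ φ)) s =
      deriv φ s ^ 2 • deriv (deriv c) (φ s) + deriv (deriv φ) s • deriv c (φ s) := by
  have he : deriv (c ∘ φ) =ᶠ[𝓝 s] fun s ↦ deriv φ s • deriv c (φ s) := by
    filter_upwards [hφ.continuousAt.eventually (eventually_differentiableAt hc),
      eventually_differentiableAt hφ] with r hr hr'
    exact (hr.hasDerivAt.scomp r hr'.hasDerivAt).deriv
  rw [he.deriv_eq]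
  have h1 := (differentiableAt_deriv hc).hasDerivAt.scomp s
    (hφ.differentiableAt (by simp)).hasDerivAt
  have h2 := (differentiableAt_deriv hφ).hasDerivAt.smul h1
  refine h2.deriv.trans ?_
  simp [smul_smul, pow_two]

section Curve

variable {m : ℕ} {M : Type*} [TopologicalSpace M] [ChartedSpace (Model m) M]
  [IsManifold 𝓘(ℝ, Model m) ∞ M]

/-- The curve `γ` in the chart at `x₀`. -/
noncomputable def chartCurve (x₀ : M) (γ : ℝ → M) : ℝ → Model m := extChartAt 𝓘(ℝ, Model m) x₀ ∘ γ

variable {γ : ℝ → M} {t : ℝ} {x₀ : M}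

lemma contDiffAt_chartCurve (hγ : ContMDiffAt 𝓘(ℝ, ℝ) 𝓘(ℝ, Model m) ∞ γ t)
    (hx : γ t ∈ (chartAt (Model m) x₀).source) : ContDiffAt ℝ ∞ (chartCurve (m := m) x₀ γ) t :=
  ((contMDiffAt_extChartAt' (n := ∞) hx).comp t hγ).contDiffAt

lemma velocity_eq_chartDeriv (hγ : ContMDiffAt 𝓘(ℝ, ℝ) 𝓘(ℝ, Model m) ∞ γ t)
    (hx : γ t ∈ (chartAt (Model m) x₀).source) : (show Model m from velocity γ t) =
      chartDeriv x₀ (extChartAt 𝓘(ℝ, Model m) x₀ (γ t)) (deriv (chartCurve x₀ γ) t) := by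
  have h := mfderiv_eq_chartDeriv x₀ (hγ.mdifferentiableAt (by simp)) hx (1 : ℝ)
  rw [fderiv_apply_one_eq_deriv] at h
  exact h

lemma velocity_eq_deriv (hγ : ContMDiffAt 𝓘(ℝ, ℝ) 𝓘(ℝ, Model m) ∞ γ t) :
    (show Model m from velocity γ t) = deriv (chartCurve (γ t) γ) t :=
  (velocity_eq_chartDeriv hγ (mem_chart_source _ _)).trans (chartDeriv_self _ _)

/-- The acceleration `∇_γ' γ'` in the chart at `x₀`. -/
noncomputable def chartAccel (g : LorentzMetric m M) (x₀ : M) (c : ℝ → Model m) (t : ℝ) : Model m :=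
  deriv (deriv c) t + localConnection g x₀ (c t) (deriv c t) (deriv c t)

lemma geodesicEqAt_iff_self (g : LorentzMetric m M)
    (hγ : ContMDiffAt 𝓘(ℝ, ℝ) 𝓘(ℝ, Model m) ∞ γ t) :
    GeodesicEqAt g γ t ↔ chartAccel g (γ t) (chartCurve (γ t) γ) t = 0 := by
  have hc : ContDiffAt ℝ ∞ (chartCurve (m := m) (γ t) γ) t :=
    contDiffAt_chartCurve hγ (mem_chart_source _ _)
  have h1 : ∀ k, deriv (curveCoord (m := m) γ (γ t) k) =ᶠ[𝓝 t]
      fun s ↦ deriv (chartCurve (m := m) (γ t) γ) s k := by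
    intro k
    filter_upwards [eventually_differentiableAt hc] with s hs
    exact ((EuclideanSpace.proj k : Model m →L[ℝ] ℝ).hasFDerivAt.comp_hasDerivAt s
      hs.hasDerivAt).deriv
  have h2 : ∀ k, deriv (deriv (curveCoord (m := m) γ (γ t) k)) t =
      deriv (deriv (chartCurve (m := m) (γ t) γ)) t k := by
    intro k
    rw [(h1 k).deriv_eq]
    exact ((EuclideanSpace.proj k : Model m →L[ℝ] ℝ).hasFDerivAt.comp_hasDerivAt t
      (differentiableAt_deriv hc).hasDerivAt).deriv
  have h3 : ∀ k, chartAccel g (γ t) (chartCurve (m := m) (γ t) γ) t k =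
      deriv (deriv (curveCoord (m := m) γ (γ t) k)) t
    + ∑ i, ∑ j, christoffel g (γ t) k i j (extChartAt 𝓘(ℝ, Model m) (γ t) (γ t)) *
        (deriv (curveCoord (m := m) γ (γ t) i) t * deriv (curveCoord (m := m) γ (γ t) j) t) := by
    intro k
    have : chartAccel g (γ t) (chartCurve (m := m) (γ t) γ) t k =
      deriv (deriv (chartCurve (γ t) γ)) t k +
      localConnection g (γ t) (chartCurve (m := m) (γ t) γ t) (deriv (chartCurve (γ t) γ) t)
        (deriv (chartCurve (m := m) (γ t) γ) t) k := rfl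
    rw [this, h2, localConnection_apply]
    simp only [fun k ↦ (h1 k).self_of_nhds]
    rfl
  constructor
  · intro h
    ext k
    exact (h3 k).trans (h k)
  · intro h k
    rw [← h3, h]
    rfl

lemma chartAccel_transition (g : LorentzMetric m M) (hγ : ContMDiffAt 𝓘(ℝ, ℝ) 𝓘(ℝ, Model m) ∞ γ t)
    (hx : γ t ∈ (chartAt (Model m) x₀).source) :
    chartAccel g x₀ (chartCurve x₀ γ) t =
      fderiv ℝ (transition (γ t) x₀) (extChartAt 𝓘(ℝ, Model m) (γ t) (γ t))
        (chartAccel g (γ t) (chartCurve (m := m) (γ t) γ) t) := by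
  set x := γ t with hxdef
  have hc : ContDiffAt ℝ ∞ (chartCurve (m := m) x γ) t :=
    contDiffAt_chartCurve hγ (mem_chart_source _ _)
  have hct : chartCurve x γ t = extChartAt 𝓘(ℝ, Model m) x x := rfl
  have hyt : chartCurve x γ t ∈ (extChartAt 𝓘(ℝ, Model m) x).target := mem_extChartAt_target x
  have hx' : (extChartAt 𝓘(ℝ, Model m) x).symm (chartCurve x γ t) ∈
      (chartAt (Model m) x₀).source := by
    rw [hct, extChartAt_to_inv x]; exact hx
  have hτ := contDiffAt_transition hyt hx'
  have he : chartCurve (m := m) x₀ γ =ᶠ[𝓝 t] transition x x₀ ∘ chartCurve x γ := by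
    filter_upwards [hγ.continuousAt.preimage_mem_nhds
      (extChartAt_source_mem_nhds (I := 𝓘(ℝ, Model m)) x)] with s hs
    simp only [chartCurve, transition, Function.comp_apply]
    rw [(extChartAt 𝓘(ℝ, Model m) x).left_inv hs]
  unfold chartAccel
  rw [he.deriv.deriv_eq, he.deriv_eq, he.self_of_nhds, deriv_deriv_comp_eq hτ hc,
    deriv_comp_eq hτ hc, ← hct, map_add, localConnection_transition g hyt hx']
  simp only [Function.comp_apply]
  abel

/-- The geodesic equation may be checked in any chart. -/
lemma geodesicEqAt_iff (g : LorentzMetric m M) (hγ : ContMDiffAt 𝓘(ℝ, ℝ) 𝓘(ℝ, Model m) ∞ γ t)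
    (hx : γ t ∈ (chartAt (Model m) x₀).source) :
    GeodesicEqAt g γ t ↔ chartAccel g x₀ (chartCurve x₀ γ) t = 0 := by
  rw [geodesicEqAt_iff_self g hγ, chartAccel_transition g hγ hx]
  have hx' : (extChartAt 𝓘(ℝ, Model m) (γ t)).symm (extChartAt 𝓘(ℝ, Model m) (γ t) (γ t)) ∈
      (chartAt (Model m) x₀).source := by
    rw [extChartAt_to_inv]; exact hx
  have hinj := (fderiv_transition_bijective (mem_extChartAt_target (γ t)) hx').1
  exact ⟨fun h ↦ by rw [h, map_zero], fun h ↦ hinj (h.trans (map_zero _).symm)⟩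

/-- Geodesics with the same initial velocity agree near the starting point. -/
lemma eventuallyEq_of_geodesicEqAt (g : LorentzMetric m M) {γ₁ γ₂ : ℝ → M}
    (h₁ : ∀ᶠ t in 𝓝 (0 : ℝ), ContMDiffAt 𝓘(ℝ, ℝ) 𝓘(ℝ, Model m) ∞ γ₁ t ∧ GeodesicEqAt g γ₁ t)
    (h₂ : ∀ᶠ t in 𝓝 (0 : ℝ), ContMDiffAt 𝓘(ℝ, ℝ) 𝓘(ℝ, Model m) ∞ γ₂ t ∧ GeodesicEqAt g γ₂ t)
    (h0 : (⟨γ₁ 0, velocity γ₁ 0⟩ : TangentBundle 𝓘(ℝ, Model m) M) = ⟨γ₂ 0, velocity γ₂ 0⟩) :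
    γ₁ =ᶠ[𝓝 0] γ₂ := by
  set x₀ := γ₁ 0 with hx₀
  have hpt : γ₁ 0 = γ₂ 0 := congrArg Bundle.TotalSpace.proj h0
  have hx₁ : γ₁ 0 ∈ (chartAt (Model m) x₀).source := mem_chart_source _ _
  have hx₂ : γ₂ 0 ∈ (chartAt (Model m) x₀).source := hpt ▸ hx₁
  have hev : ∀ γ : ℝ → M, (∀ᶠ t in 𝓝 (0 : ℝ), ContMDiffAt 𝓘(ℝ, ℝ) 𝓘(ℝ, Model m) ∞ γ t ∧
      GeodesicEqAt g γ t) → γ 0 ∈ (chartAt (Model m) x₀).source →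
      ∀ᶠ t in 𝓝 (0 : ℝ), γ t ∈ (chartAt (Model m) x₀).source := fun γ h hx ↦
    h.self_of_nhds.1.continuousAt.preimage_mem_nhds ((chartAt _ x₀).open_source.mem_nhds hx)
  have hode : ∀ γ : ℝ → M, (∀ᶠ t in 𝓝 (0 : ℝ), ContMDiffAt 𝓘(ℝ, ℝ) 𝓘(ℝ, Model m) ∞ γ t ∧
      GeodesicEqAt g γ t) → γ 0 ∈ (chartAt (Model m) x₀).source →
      ∀ᶠ t in 𝓝 (0 : ℝ), ContDiffAt ℝ ∞ (chartCurve (m := m) x₀ γ) t ∧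
        deriv (deriv (chartCurve x₀ γ)) t = (fun X : Model m × Model m ↦
          -localConnection g x₀ X.1 X.2 X.2) (chartCurve x₀ γ t, deriv (chartCurve x₀ γ) t) := by
    intro γ h hx
    filter_upwards [h, hev γ h hx] with t ht hxt
    exact ⟨contDiffAt_chartCurve ht.1 hxt,
      eq_neg_of_add_eq_zero_left ((geodesicEqAt_iff g ht.1 hxt).1 ht.2)⟩
  have hmem : extChartAt 𝓘(ℝ, Model m) x₀ (γ₁ 0) ∈ (extChartAt 𝓘(ℝ, Model m) x₀).target :=
    mem_extChartAt_target x₀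
  have hA : ContDiffAt ℝ 1 (fun X : Model m × Model m ↦ -localConnection g x₀ X.1 X.2 X.2)
      (chartCurve x₀ γ₁ 0, deriv (chartCurve x₀ γ₁) 0) := by
    have h1 : ContDiffAt ℝ ∞ (fun X : Model m × Model m ↦ localConnection g x₀ X.1)
      (chartCurve x₀ γ₁ 0, deriv (chartCurve x₀ γ₁) 0) :=
      (contDiffAt_localConnection g x₀ hmem).comp (g := localConnection g x₀)
        (chartCurve x₀ γ₁ 0, deriv (chartCurve x₀ γ₁) 0) contDiffAt_fst
    exact (((h1.clm_apply contDiffAt_snd).clm_apply contDiffAt_snd).neg).of_le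
      (by exact_mod_cast le_top)
  have hcc : chartCurve (m := m) x₀ γ₁ =ᶠ[𝓝 0] chartCurve x₀ γ₂ := by
    refine eventuallyEq_of_second_order hA (hode γ₁ h₁ hx₁) (hode γ₂ h₂ hx₂) ?_ ?_
    · simp only [chartCurve, Function.comp_apply, hpt]
    · have e1 := velocity_eq_chartDeriv (x₀ := x₀) h₁.self_of_nhds.1 hx₁
      have e2 := velocity_eq_chartDeriv (x₀ := x₀) h₂.self_of_nhds.1 hx₂
      have e3 : (show Model m from velocity γ₁ 0) = (show Model m from velocity γ₂ 0) :=
        congrArg (fun X : TangentBundle 𝓘(ℝ, Model m) M ↦ (show Model m from X.2)) h0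
      rw [← hpt] at e2
      exact (chartDeriv_bijective x₀ hmem).1 (e1.symm.trans (e3.trans e2))
  filter_upwards [hcc, hev γ₁ h₁ hx₁, hev γ₂ h₂ hx₂] with t ht ht1 ht2
  rw [← extChartAt_source 𝓘(ℝ, Model m)] at ht1 ht2
  exact (extChartAt 𝓘(ℝ, Model m) x₀).injOn ht1 ht2 ht

end Curve

/-! ### Endomorphisms of a subquotient -/

section LinearAlgebra

variable {V : Type*} [AddCommGroup V] [Module ℝ V] [FiniteDimensional ℝ V] {W ℓ : Submodule ℝ V}

/-- If `L` is the identity on `ℓ` and on `V / W`, then its determinant is that of the endomorphism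
which it induces on `W / ℓ`. -/
lemma det_subquotient {L : V →ₗ[ℝ] V} (h1 : ∀ v, L v - v ∈ W)
    (h2 : ∀ v ∈ ℓ, L v = v) {B : Module.End ℝ (W ⧸ ℓ.submoduleOf W)}
    (hB : ∀ v (hv : v ∈ W) (hv' : L v ∈ W),
      B ((ℓ.submoduleOf W).mkQ ⟨v, hv⟩) = (ℓ.submoduleOf W).mkQ ⟨L v, hv'⟩) :
    LinearMap.det B = LinearMap.det L := by
  have hW : W ≤ W.comap L := fun v hv ↦ by
    have := W.add_mem (h1 v) hv
    rwa [sub_add_cancel] at this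
  have hℓ' : ℓ.submoduleOf W ≤ (ℓ.submoduleOf W).comap (L.restrict hW) := by
    rintro ⟨v, hv⟩ hvℓ
    change L v ∈ ℓ
    rw [h2 v hvℓ]
    exact hvℓ
  have e1 : W.mapQ W L hW = LinearMap.id := by
    refine Submodule.linearMap_qext _ (LinearMap.ext fun v ↦ ?_)
    exact (Submodule.Quotient.eq W).2 (h1 v)
  have e2 : (L.restrict hW).restrict hℓ' = LinearMap.id := by
    ext ⟨⟨v, hv⟩, hvℓ⟩
    exact h2 v hvℓ
  have e3 : (ℓ.submoduleOf W).mapQ _ (L.restrict hW) hℓ' = B := by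
    refine Submodule.linearMap_qext _ (LinearMap.ext fun v ↦ ?_)
    exact (hB v v.2 (hW v.2)).symm
  rw [LinearMap.det_eq_det_mul_det W L hW, LinearMap.det_eq_det_mul_det (ℓ.submoduleOf W) _ hℓ', e1,
    e2, e3]
  simp

/-- If `A` vanishes on `ℓ` and on `V / W`, then its trace is that of the endomorphism which it
induces on `W / ℓ`. -/
lemma trace_subquotient {A : V →ₗ[ℝ] V} (h1 : ∀ v, A v ∈ W)
    (h2 : ∀ v ∈ ℓ, A v = 0) {B : Module.End ℝ (W ⧸ ℓ.submoduleOf W)}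
    (hB : ∀ v (hv : v ∈ W), B ((ℓ.submoduleOf W).mkQ ⟨v, hv⟩) =
      (ℓ.submoduleOf W).mkQ ⟨A v, h1 v⟩) :
    LinearMap.trace ℝ _ B = LinearMap.trace ℝ V A := by
  set A' : V →ₗ[ℝ] W := A.codRestrict W h1
  set C : (W ⧸ ℓ.submoduleOf W) →ₗ[ℝ] W := (ℓ.submoduleOf W).liftQ (A' ∘ₗ W.subtype) (by
    rintro ⟨v, hv⟩ hvℓ
    exact Subtype.ext (h2 v hvℓ))
  have e1 : C ∘ₗ (ℓ.submoduleOf W).mkQ = A' ∘ₗ W.subtype := Submodule.liftQ_mkQ _ _ _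
  have e2 : (ℓ.submoduleOf W).mkQ ∘ₗ C = B := by
    refine Submodule.linearMap_qext _ (LinearMap.ext fun v ↦ ?_)
    exact (hB v v.2).symm
  have e3 : W.subtype ∘ₗ A' = A := LinearMap.ext fun v ↦ rfl
  rw [← e2, LinearMap.trace_comp_comm', e1, ← LinearMap.trace_comp_comm', e3]

end LinearAlgebra

section Quotient

variable {m : ℕ} {M : Type*} [TopologicalSpace M] [ChartedSpace (Model m) M]

instance {x : M} : FiniteDimensional ℝ (Tan m x) :=
  inferInstanceAs (FiniteDimensional ℝ (Model m))

lemma finrank_tan (x : M) : Module.finrank ℝ (Tan m x) = m :=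
  (finrank_euclideanSpace_fin (𝕜 := ℝ) (n := m))

variable [IsManifold 𝓘(ℝ, Model m) ∞ M]

namespace Spacetime

variable {S : Spacetime m M} {g h : LorentzMetric m M} {x : M}

lemma mem_perp_span (hg : g ∈ S.metrics) {w v : Tan m x} :
    v ∈ S.perp (ℝ ∙ w) ↔ g.form x w v = 0 := by
  refine ⟨fun hv ↦ hv g hg w (Submodule.mem_span_singleton_self w), fun hv h hh u hu ↦ ?_⟩
  obtain ⟨c, rfl⟩ := Submodule.mem_span_singleton.1 hu
  rw [map_smul, smul_apply, S.form_eq_zero_of_mem hg hh hv, smul_zero]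

lemma finrank_perpQuot (hg : g ∈ S.metrics) {w : Tan m x} (hw : g.form x w w = 0) (hw0 : w ≠ 0) :
    Module.finrank ℝ (S.PerpQuot (ℝ ∙ w)) + 2 = m := by
  have hle : ℝ ∙ w ≤ S.perp (ℝ ∙ w) := by
    rw [Submodule.span_singleton_le_iff_mem, mem_perp_span hg]
    exact hw
  have h1 := Submodule.finrank_quotient_add_finrank ((ℝ ∙ w).submoduleOf (S.perp (ℝ ∙ w)))
  have h2 : Module.finrank ℝ ((ℝ ∙ w).submoduleOf (S.perp (ℝ ∙ w))) = 1 := by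
    rw [(Submodule.submoduleOfEquivOfLe hle).finrank_eq, finrank_span_singleton hw0]
  have h3 : S.perp (ℝ ∙ w) = LinearMap.ker (g.form x w : Tan m x →ₗ[ℝ] ℝ) := by
    ext v
    exact mem_perp_span hg
  have h4 := LinearMap.finrank_range_add_finrank_ker (g.form x w : Tan m x →ₗ[ℝ] ℝ)
  have h5 : LinearMap.range (g.form x w : Tan m x →ₗ[ℝ] ℝ) = ⊤ := by
    refine LinearMap.range_eq_top.2 (LinearMap.surjective ?_)
    intro h0
    exact hw0 (form_nondegenerate g x w fun v ↦ congrArg (fun A : Tan m x →ₗ[ℝ] ℝ ↦ A v) h0)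
  rw [h5, finrank_top, Module.finrank_self, ← h3, finrank_tan] at h4
  rw [h2] at h1
  change Module.finrank ℝ (S.PerpQuot (ℝ ∙ w)) + 1 = Module.finrank ℝ (S.perp (ℝ ∙ w)) at h1
  change 1 + Module.finrank ℝ (S.perp (ℝ ∙ w)) = m at h4
  omega

end Spacetime

end Quotient

/-! ### Conformal changes of the metric -/

section Conformal

variable {m : ℕ} {M : Type*} [TopologicalSpace M] [ChartedSpace (Model m) M]

/-- The function `f` in the chart at `x₀`. -/
noncomputable def chartFun (f : M → ℝ) (x₀ : M) : Model m → ℝ :=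
  f ∘ (extChartAt 𝓘(ℝ, Model m) x₀).symm

lemma chartFun_comp_chartCurve {f : M → ℝ} {γ : ℝ → M} {t : ℝ} (x₀ : M) (hγ : ContinuousAt γ t)
    (hx : γ t ∈ (chartAt (Model m) x₀).source) :
    f ∘ γ =ᶠ[𝓝 t] chartFun f x₀ ∘ chartCurve (m := m) x₀ γ := by
  filter_upwards [hγ.preimage_mem_nhds ((chartAt _ x₀).open_source.mem_nhds hx)] with s hs
  simp only [chartFun, chartCurve, Function.comp_apply]
  rw [(extChartAt 𝓘(ℝ, Model m) x₀).left_inv (by rwa [extChartAt_source])]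

variable [IsManifold 𝓘(ℝ, Model m) ∞ M] {g h : LorentzMetric m M} {f : M → ℝ}

lemma contDiffAt_chartFun (hf : ContMDiff 𝓘(ℝ, Model m) 𝓘(ℝ, ℝ) ∞ f) (x₀ : M) {y : Model m}
    (hy : y ∈ (extChartAt 𝓘(ℝ, Model m) x₀).target) : ContDiffAt ℝ ∞ (chartFun f x₀) y := by
  have h1 : ContMDiffAt 𝓘(ℝ, Model m) 𝓘(ℝ, Model m) ∞ (extChartAt 𝓘(ℝ, Model m) x₀).symm y :=
    (contMDiffOn_extChartAt_symm x₀).contMDiffAt ((isOpen_extChartAt_target x₀).mem_nhds hy)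
  exact ((hf _).comp y h1).contDiffAt

lemma localMetric_conformal
    (hfg : ∀ (x : M) (u v : Tan m x), h.form x u v = Real.exp (2 * f x) * g.form x u v)
    (x₀ : M) (y u v : Model m) :
    localMetric h x₀ y u v = Real.exp (2 * chartFun f x₀ y) * localMetric g x₀ y u v := by
  rw [localMetric_apply, localMetric_apply, hfg]
  rfl

/-- The number `Hess f (w, w) - (df w) ^ 2`, where the Hessian is that of the metric `g`. -/
noncomputable def conformalTerm (g : LorentzMetric m M) (f : M → ℝ) {x : M} (w : Tan m x) : ℝ :=
  localHessian (localConnection g x) (chartFun f x) (extChartAt 𝓘(ℝ, Model m) x x)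
    (show Model m from w) -
  fderiv ℝ (chartFun f x) (extChartAt 𝓘(ℝ, Model m) x x) (show Model m from w) ^ 2

lemma localMetric_self (g : LorentzMetric m M) (x : M) (u v : Tan m x) :
    localMetric g x (extChartAt 𝓘(ℝ, Model m) x x) (show Model m from u) (show Model m from v) =
      g.form x u v := by
  rw [localMetric_apply]
  exact form_congr (extChartAt_to_inv x) (chartDeriv_self x _) (chartDeriv_self x _)

lemma exists_form_self_ne_zero (g : LorentzMetric m M) (x : M) :
    ∃ u : Tan m x, g.form x u u ≠ 0 := by
  obtain ⟨b, ⟨i, hi⟩, hb⟩ := g.signature x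
  exact ⟨b i, by rw [hb]; simp [hi]⟩

lemma jacobiMap_conformal (hf : ContMDiff 𝓘(ℝ, Model m) 𝓘(ℝ, ℝ) ∞ f)
    (hfg : ∀ (x : M) (u v : Tan m x), h.form x u v = Real.exp (2 * f x) * g.form x u v)
    {x : M} {w v : Tan m x} (hw : g.form x w w = 0) (hv : g.form x w v = 0) :
    ∃ c : ℝ, jacobiMap h w v = jacobiMap g w v + conformalTerm g f w • v + c • w := by
  obtain ⟨u, hu⟩ := exists_form_self_ne_zero g x
  rw [← localMetric_self] at hu hw hv
  obtain ⟨c, hc⟩ := (isLeviCivitaOn_chart g x).localJacobi_conformal (isLeviCivitaOn_chart h x)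
    (fun z hz ↦ contDiffAt_chartFun hf x hz) (fun z _ ↦ localMetric_conformal hfg x z)
    (mem_extChartAt_target x) hu hw hv
  refine ⟨c, ?_⟩
  rw [← jacobiMap_eq_localJacobi, ← jacobiMap_eq_localJacobi] at hc
  exact hc

lemma jacobiMap_smul_left (g : LorentzMetric m M) {x : M} (c : ℝ) (w v : Tan m x) :
    jacobiMap g (c • w) v = c ^ 2 • jacobiMap g w v := by
  change riemann g x _ _ _ = c ^ 2 • riemann g x _ _ _
  simp only [riemann, coord_smul, Finset.smul_sum, smul_smul, Finset.mul_sum]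
  refine Finset.sum_congr rfl fun l _ ↦ ?_
  congr 1
  refine Finset.sum_congr rfl fun k _ ↦ Finset.sum_congr rfl fun i _ ↦
    Finset.sum_congr rfl fun j _ ↦ ?_
  ring

variable {γ : ℝ → M} {t : ℝ}

/-- Along a geodesic, the Hessian is a second derivative. -/
lemma conformalTerm_velocity (hf : ContMDiff 𝓘(ℝ, Model m) 𝓘(ℝ, ℝ) ∞ f)
    (hγ : ContMDiffAt 𝓘(ℝ, ℝ) 𝓘(ℝ, Model m) ∞ γ t) (hgeo : GeodesicEqAt g γ t) :
    conformalTerm g f (velocity γ t) = deriv (deriv (f ∘ γ)) t - deriv (f ∘ γ) t ^ 2 := by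
  have hc : ContDiffAt ℝ ∞ (chartCurve (m := m) (γ t) γ) t :=
    contDiffAt_chartCurve hγ (mem_chart_source _ _)
  have hct : chartCurve (m := m) (γ t) γ t = extChartAt 𝓘(ℝ, Model m) (γ t) (γ t) := rfl
  have hF : ContDiffAt ℝ ∞ (chartFun f (γ t)) (chartCurve (m := m) (γ t) γ t) :=
    contDiffAt_chartFun hf (γ t) (mem_extChartAt_target (γ t))
  have he := chartFun_comp_chartCurve (f := f) (γ t) hγ.continuousAt (mem_chart_source (Model m) _)
  rw [geodesicEqAt_iff_self g hγ] at hgeo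
  rw [he.deriv.deriv_eq, he.deriv_eq, deriv_deriv_comp_eq hF hc, deriv_comp_eq hF hc,
    eq_neg_of_add_eq_zero_left hgeo, map_neg]
  unfold conformalTerm localHessian
  rw [velocity_eq_deriv hγ, ← hct]
  ring

/-- A reparametrised null geodesic of `g` is a geodesic of `e^{2f} g`, if `φ' e^{2f}` is stationary
along it. -/
lemma geodesicEqAt_conformal (hf : ContMDiff 𝓘(ℝ, Model m) 𝓘(ℝ, ℝ) ∞ f)
    (hfg : ∀ (x : M) (u v : Tan m x), h.form x u v = Real.exp (2 * f x) * g.form x u v)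
    {φ : ℝ → ℝ} {s : ℝ} (hφ : ContDiffAt ℝ ∞ φ s)
    (hγ : ContMDiffAt 𝓘(ℝ, ℝ) 𝓘(ℝ, Model m) ∞ γ (φ s)) (hgeo : GeodesicEqAt g γ (φ s))
    (hnull : g.form (γ (φ s)) (velocity γ (φ s)) (velocity γ (φ s)) = 0)
    (hφf : deriv (deriv φ) s + 2 * deriv φ s ^ 2 * deriv (f ∘ γ) (φ s) = 0) :
    GeodesicEqAt h (γ ∘ φ) s := by
  have hγφ : ContMDiffAt 𝓘(ℝ, ℝ) 𝓘(ℝ, Model m) ∞ (γ ∘ φ) s := hγ.comp s hφ.contMDiffAt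
  set x := γ (φ s) with hx
  set c := chartCurve (m := m) x γ with hcdef
  have hc : ContDiffAt ℝ ∞ c (φ s) := contDiffAt_chartCurve hγ (mem_chart_source _ _)
  have hct : c (φ s) = extChartAt 𝓘(ℝ, Model m) x x := rfl
  have hyt : c (φ s) ∈ (extChartAt 𝓘(ℝ, Model m) x).target := mem_extChartAt_target x
  have hF : ContDiffAt ℝ ∞ (chartFun f x) (c (φ s)) := contDiffAt_chartFun hf x hyt
  have he := chartFun_comp_chartCurve (f := f) x hγ.continuousAt (mem_chart_source (Model m) _)
  rw [he.deriv_eq, deriv_comp_eq hF hc] at hφf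
  rw [geodesicEqAt_iff_self g hγ] at hgeo
  rw [geodesicEqAt_iff_self h hγφ]
  have hcomp : chartCurve (m := m) ((γ ∘ φ) s) (γ ∘ φ) = c ∘ φ := rfl
  have hd : deriv (c ∘ φ) s = deriv φ s • deriv c (φ s) :=
    ((hc.differentiableAt (by simp)).hasDerivAt.scomp s
      (hφ.differentiableAt (by simp)).hasDerivAt).deriv
  obtain ⟨u, hu⟩ := exists_form_self_ne_zero g x
  rw [← localMetric_self, ← hct] at hu
  obtain ⟨N, -, hN⟩ := (isLeviCivitaOn_chart g x).exists_gradient (isLeviCivitaOn_chart h x)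
    (fun z hz ↦ contDiffAt_chartFun hf x hz) (fun z _ ↦ localMetric_conformal hfg x z) hyt hu
  have hconn := (isLeviCivitaOn_chart g x).connection_conformal (isLeviCivitaOn_chart h x)
    (fun z hz ↦ contDiffAt_chartFun hf x hz) (fun z _ ↦ localMetric_conformal hfg x z) hyt
    hN.self_of_nhds (deriv c (φ s)) (deriv c (φ s))
  have hnull' : localMetric g x (c (φ s)) (deriv c (φ s)) (deriv c (φ s)) = 0 := by
    have := localMetric_self g x (velocity γ (φ s)) (velocity γ (φ s))
    rw [velocity_eq_deriv hγ, hnull] at this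
    exact this
  rw [hnull', zero_smul, sub_zero] at hconn
  have hgeo' : deriv (deriv c) (φ s) +
    localConnection g x (c (φ s)) (deriv c (φ s)) (deriv c (φ s)) = 0 := hgeo
  unfold chartAccel
  rw [hcomp, deriv_deriv_reparam hc hφ, hd]
  simp only [map_smul, smul_apply]
  change _ + deriv φ s • deriv φ s • localConnection h x (c (φ s)) _ _ = 0
  rw [hconn]
  linear_combination (norm := module) deriv φ s ^ 2 • hgeo' + hφf • deriv c (φ s)

end Conformal

lemma span_smul_eq {V : Type*} [AddCommGroup V] [Module ℝ V] {w : V} {c : ℝ} (hc : c ≠ 0) :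
    ℝ ∙ (c • w) = ℝ ∙ w :=
  Submodule.span_singleton_smul_eq (IsUnit.mk0 c hc) w

namespace Spacetime

variable {m : ℕ} {M : Type*} [TopologicalSpace M] [ChartedSpace (Model m) M]
  [IsManifold 𝓘(ℝ, Model m) ∞ M] {S : Spacetime m M} {g h : LorentzMetric m M}

lemma exists_conformal_factor (hg : g ∈ S.metrics) (hh : h ∈ S.metrics) :
    ∃ f : M → ℝ, ContMDiff 𝓘(ℝ, Model m) 𝓘(ℝ, ℝ) ∞ f ∧
      ∀ (x : M) (u v : Tan m x), h.form x u v = Real.exp (2 * f x) * g.form x u v := by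
  obtain ⟨g₀, hS⟩ := S.isClass
  rw [hS] at hg hh
  obtain ⟨a, ha, hga⟩ := hg
  obtain ⟨b, hb, hhb⟩ := hh
  refine ⟨fun x ↦ b x - a x, hb.sub ha, fun x u v ↦ ?_⟩
  rw [hga, hhb, ← mul_assoc, ← Real.exp_add]
  ring_nf

/-- On `w^⊥ / w`, the Jacobi endomorphism of a null vector changes by a multiple of the identity
when the metric is multiplied by `e^{2f}`; rescaling the null vector by `c` contributes a factor `c²`. -/
lemma jacobiEnd_conformal (hg : g ∈ S.metrics) (hh : h ∈ S.metrics) {f : M → ℝ}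
    (hf : ContMDiff 𝓘(ℝ, Model m) 𝓘(ℝ, ℝ) ∞ f)
    (hfg : ∀ (x : M) (u v : Tan m x), h.form x u v = Real.exp (2 * f x) * g.form x u v)
    {x : M} {ℓ : Submodule ℝ (Tan m x)} {w : Tan m x} {c : ℝ} (hw : ℝ ∙ w = ℓ)
    (hcw : ℝ ∙ (c • w) = ℓ) (hnull : g.form x w w = 0) :
    jacobiEnd hh hcw =
      c ^ 2 • (jacobiEnd hg hw + conformalTerm g f w • (LinearMap.id : Module.End ℝ _)) := by
  refine Submodule.linearMap_qext _ (LinearMap.ext ?_)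
  rintro ⟨v, hv⟩
  have hwv : g.form x w v = 0 := hv g hg w (hw ▸ Submodule.mem_span_singleton_self w)
  obtain ⟨b, hb⟩ := jacobiMap_conformal hf hfg hnull hwv
  refine (Submodule.Quotient.eq (p := ℓ.submoduleOf (S.perp ℓ))
    (x := ⟨jacobiMap h (c • w) v, jacobiMap_mem hh hcw v⟩)
    (y := c ^ 2 • (⟨jacobiMap g w v, jacobiMap_mem hg hw v⟩ + conformalTerm g f w • ⟨v, hv⟩))).2 ?_
  change jacobiMap h (c • w) v - c ^ 2 • (jacobiMap g w v + conformalTerm g f w • v) ∈ ℓ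
  rw [jacobiMap_smul_left, ← smul_sub, hb, add_sub_cancel_left, smul_smul, ← hw]
  exact Submodule.smul_mem _ _ (Submodule.mem_span_singleton_self w)

/-- The Ricci curvature of a null vector, as the trace of its Jacobi endomorphism. -/
noncomputable def nullRicci (hg : g ∈ S.metrics) (X : TangentBundle 𝓘(ℝ, Model m) M) : ℝ :=
  LinearMap.trace ℝ _ (jacobiEnd hg (rfl : ℝ ∙ X.2 = _))

/-- The determinant of the trace-free part of the Jacobi endomorphism of a null vector. -/
noncomputable def nullDet (hg : g ∈ S.metrics) (X : TangentBundle 𝓘(ℝ, Model m) M) : ℝ :=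
  LinearMap.det (jacobiEnd hg (rfl : ℝ ∙ X.2 = _) -
    (nullRicci hg X / ((m : ℝ) - 2)) • LinearMap.id)

/-- The `2(m - 2)`-th root of `|nullDet|`. On null vectors, it is positively homogeneous of degree
one, and it depends on the conformal class only. -/
noncomputable def nullZeta (hg : g ∈ S.metrics) (X : TangentBundle 𝓘(ℝ, Model m) M) : ℝ :=
  |nullDet hg X| ^ (1 / (2 * ((m : ℝ) - 2)))

/-- The line is allowed to be only propositionally equal to the span of `w`. -/
lemma nullRicci_eq (hg : g ∈ S.metrics) {x : M} {ℓ : Submodule ℝ (Tan m x)} {w : Tan m x}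
    (hw : ℝ ∙ w = ℓ) : nullRicci hg ⟨x, w⟩ = LinearMap.trace ℝ _ (jacobiEnd hg hw) := by
  subst hw
  rfl

lemma nullDet_eq (hg : g ∈ S.metrics) {x : M} {ℓ : Submodule ℝ (Tan m x)} {w : Tan m x}
    (hw : ℝ ∙ w = ℓ) : nullDet hg ⟨x, w⟩ = LinearMap.det (jacobiEnd hg hw -
    (nullRicci hg ⟨x, w⟩ / ((m : ℝ) - 2)) • LinearMap.id) := by
  subst hw
  rfl

lemma nullRicci_conformal (hg : g ∈ S.metrics) (hh : h ∈ S.metrics) {f : M → ℝ}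
    (hf : ContMDiff 𝓘(ℝ, Model m) 𝓘(ℝ, ℝ) ∞ f)
    (hfg : ∀ (x : M) (u v : Tan m x), h.form x u v = Real.exp (2 * f x) * g.form x u v)
    {x : M} {w : Tan m x} {c : ℝ} (hnull : g.form x w w = 0) (hw : w ≠ 0) (hc : c ≠ 0) :
    nullRicci hh ⟨x, c • w⟩ =
      c ^ 2 * (nullRicci hg ⟨x, w⟩ + ((m : ℝ) - 2) * conformalTerm g f w) := by
  have hm : (Module.finrank ℝ (S.PerpQuot (ℝ ∙ w)) : ℝ) = (m : ℝ) - 2 := by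
    rw [eq_sub_iff_add_eq]
    exact_mod_cast finrank_perpQuot hg hnull hw
  rw [nullRicci_eq hh (span_smul_eq hc), nullRicci_eq hg rfl,
    jacobiEnd_conformal hg hh hf hfg rfl _ hnull, map_smul, map_add, map_smul,
    LinearMap.trace_id, hm, smul_eq_mul, smul_eq_mul, mul_comm (conformalTerm g f w)]

lemma nullDet_conformal (hm : 3 ≤ m) (hg : g ∈ S.metrics) (hh : h ∈ S.metrics)
    {x : M} {w : Tan m x} {c : ℝ} (hnull : g.form x w w = 0) (hw : w ≠ 0) (hc : c ≠ 0) :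
    nullDet hh ⟨x, c • w⟩ = (c ^ 2) ^ (m - 2) * nullDet hg ⟨x, w⟩ := by
  obtain ⟨f, hf, hfg⟩ := exists_conformal_factor hg hh
  have hm' : Module.finrank ℝ (S.PerpQuot (ℝ ∙ w)) = m - 2 := by
    have := finrank_perpQuot hg hnull hw
    omega
  have hm0 : (m : ℝ) - 2 ≠ 0 := by
    have : (3 : ℝ) ≤ m := by exact_mod_cast hm
    linarith
  rw [nullDet_eq hh (span_smul_eq hc), nullDet_eq hg rfl,
    nullRicci_conformal hg hh hf hfg hnull hw hc, jacobiEnd_conformal hg hh hf hfg rfl _ hnull, ← hm',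
    ← LinearMap.det_smul]
  congr 1
  rw [mul_div_assoc, add_div, mul_div_cancel_left₀ _ hm0]
  module

/-- The determinant on a space of dimension `m - 2` of `c²` times an endomorphism acquires the
factor `c^{2(m - 2)}`, whose `2(m - 2)`-th root is `|c|`. -/
lemma nullZeta_conformal (hm : 3 ≤ m) (hg : g ∈ S.metrics) (hh : h ∈ S.metrics)
    {x : M} {w : Tan m x} {c : ℝ} (hnull : g.form x w w = 0) (hw : w ≠ 0) (hc : c ≠ 0) :
    nullZeta hh ⟨x, c • w⟩ = |c| * nullZeta hg ⟨x, w⟩ := by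
  have hm0 : 0 < (m : ℝ) - 2 := by
    have : (3 : ℝ) ≤ m := by exact_mod_cast hm
    linarith
  have e : (((m - 2 : ℕ) : ℝ)) = (m : ℝ) - 2 := by
    rw [Nat.cast_sub (by omega)]
    norm_num
  unfold nullZeta
  rw [nullDet_conformal hm hg hh hnull hw hc, abs_mul, Real.mul_rpow (abs_nonneg _) (abs_nonneg _),
    abs_pow, abs_pow, ← pow_mul, ← Real.rpow_natCast, ← Real.rpow_mul (abs_nonneg _)]
  congr 1
  push_cast
  rw [e, mul_one_div_cancel (by positivity), Real.rpow_one]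

lemma zeta_pos {hg : g ∈ S.metrics} {γ : ℝ → M} {t : ℝ} (h0 : tracelessDet hg γ t ≠ 0) :
    0 < zeta hg γ t :=
  Real.rpow_pos_of_pos (abs_pos.2 h0) _

lemma zeta_eq_nullZeta (hg : g ∈ S.metrics) (γ : ℝ → M) (t : ℝ) :
    zeta hg γ t = nullZeta hg ⟨γ t, velocity γ t⟩ := rfl

lemma zetaProj_eq_zeta {hg : g ∈ S.metrics} {γ : ℝ → M} {t : ℝ} (h0 : paramRicci hg γ t = 0) :
    zetaProj hg γ t = zeta hg γ t := by
  unfold zetaProj zeta tracelessDet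
  rw [h0, zero_div, zero_smul, sub_zero]

end Spacetime

/-! ### Smoothness of the curvature along a null geodesic -/

section Operators

variable {m : ℕ}

lemma contDiffAt_linearMap_det {A : ℝ → Model m →ₗ[ℝ] Model m} {t : ℝ}
    (hA : ∀ v, ContDiffAt ℝ ∞ (fun s ↦ A s v) t) :
    ContDiffAt ℝ ∞ (fun s ↦ LinearMap.det (A s)) t := by
  set b := (EuclideanSpace.basisFun (Fin m) ℝ).toBasis
  have hA' : ∀ i j, ContDiffAt ℝ ∞ (fun s ↦ LinearMap.toMatrix b b (A s) i j) t := by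
    intro i j
    simp only [LinearMap.toMatrix_apply]
    exact (LinearMap.toContinuousLinearMap (b.coord i)).contDiff.contDiffAt.comp t (hA (b j))
  simp only [← LinearMap.det_toMatrix b, Matrix.det_apply']
  exact ContDiffAt.sum fun σ _ ↦ contDiffAt_const.mul (contDiffAt_prod fun i _ ↦ hA' _ _)

lemma contDiffAt_linearMap_trace {A : ℝ → Model m →ₗ[ℝ] Model m} {t : ℝ}
    (hA : ∀ v, ContDiffAt ℝ ∞ (fun s ↦ A s v) t) :
    ContDiffAt ℝ ∞ (fun s ↦ LinearMap.trace ℝ _ (A s)) t := by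
  set b := (EuclideanSpace.basisFun (Fin m) ℝ).toBasis
  simp only [LinearMap.trace_eq_matrix_trace ℝ b, Matrix.trace, Matrix.diag_apply,
    LinearMap.toMatrix_apply]
  exact ContDiffAt.sum fun i _ ↦
    (LinearMap.toContinuousLinearMap (b.coord i)).contDiff.contDiffAt.comp t (hA (b i))

variable {E : Type*} [NormedAddCommGroup E] [NormedSpace ℝ E]

/-- The local Jacobi operator as a linear map. -/
noncomputable def localJacobiMap (Γ : E → E →L[ℝ] E →L[ℝ] E) (y w : E) : E →ₗ[ℝ] E where
  toFun := localJacobi Γ y w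
  map_add' u v := by
    simp only [localJacobi, map_add, add_apply]
    abel
  map_smul' c v := by
    simp only [localJacobi, map_smul, smul_apply, RingHom.id_apply, smul_sub, smul_add]

lemma contDiffAt_localJacobi {Γ : E → E →L[ℝ] E →L[ℝ] E} {c w : ℝ → E} {t : ℝ}
    (hΓ : ContDiffAt ℝ ∞ Γ (c t)) (hc : ContDiffAt ℝ ∞ c t) (hw : ContDiffAt ℝ ∞ w t) (v : E) :
    ContDiffAt ℝ ∞ (fun s ↦ localJacobi Γ (c s) (w s) v) t := by
  have h1 : ContDiffAt ℝ ∞ (fun s ↦ Γ (c s)) t := hΓ.comp t hc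
  have h2 := (hΓ.fderiv_right (m := ∞) (by simp)).comp t hc
  have hv : ContDiffAt ℝ ∞ (fun _ : ℝ ↦ v) t := contDiffAt_const
  exact ((((h2.clm_apply hw).clm_apply hv).clm_apply hw).sub
    (((h2.clm_apply hv).clm_apply hw).clm_apply hw)).add
    ((h1.clm_apply hw).clm_apply ((h1.clm_apply hv).clm_apply hw)) |>.sub
    ((h1.clm_apply hv).clm_apply ((h1.clm_apply hw).clm_apply hw))

/-- The operator `J - lam`, changed to the identity on the line of `w` and on the quotient by `w^⊥`;
here `w` is a null vector of the form `B`, and `T` is a vector which is not orthogonal to it. -/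
noncomputable def transverseExtension (B : E →L[ℝ] E →L[ℝ] ℝ) (J : E →ₗ[ℝ] E) (w T : E) (lam : ℝ) :
    E →ₗ[ℝ] E :=
  J - lam • LinearMap.id + (1 + lam) • (((B w T)⁻¹ • (B.flip T : E →ₗ[ℝ] ℝ)).smulRight w +
    ((B w T)⁻¹ • (B w : E →ₗ[ℝ] ℝ)).smulRight T)

lemma transverseExtension_apply (B : E →L[ℝ] E →L[ℝ] ℝ) (J : E →ₗ[ℝ] E) (w T : E) (lam : ℝ)
    (v : E) : transverseExtension B J w T lam v = J v - lam • v +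
      (1 + lam) • (((B w T)⁻¹ * B v T) • w + ((B w T)⁻¹ * B w v) • T) := by
  simp [transverseExtension]

end Operators

namespace Spacetime

variable {m : ℕ} {M : Type*} [TopologicalSpace M] [ChartedSpace (Model m) M]
  [IsManifold 𝓘(ℝ, Model m) ∞ M] {S : Spacetime m M} {g h : LorentzMetric m M}

lemma nullRicci_eq_trace (hg : g ∈ S.metrics) {x : M} (w : Tan m x) :
    nullRicci hg ⟨x, w⟩ = LinearMap.trace ℝ _ (jacobiMap g w) := by
  refine trace_subquotient (W := S.perp (ℝ ∙ w)) (ℓ := ℝ ∙ w) (jacobiMap_mem hg rfl) ?_ ?_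
  · intro v hv
    obtain ⟨c, rfl⟩ := Submodule.mem_span_singleton.1 hv
    rw [map_smul, show jacobiMap g w w = 0 from riemann_self g x w w, smul_zero]
  · intro v hv
    rfl

/-- The determinant on the quotient `w^⊥ / w` is the determinant of an endomorphism of the whole
tangent space. -/
lemma nullDet_eq_det (hg : g ∈ S.metrics) {x : M} {w : Tan m x} (hw : g.form x w w = 0)
    (e : Model m ≃ₗ[ℝ] Tan m x) {B : Model m →L[ℝ] Model m →L[ℝ] ℝ}
    (hB : ∀ u v, B u v = g.form x (e u) (e v)) {J : Model m →ₗ[ℝ] Model m}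
    (hJ : ∀ v, e (J v) = jacobiMap g w (e v)) {w' T : Model m} (hw' : e w' = w)
    (hT : B w' T ≠ 0) : nullDet hg ⟨x, w⟩ =
      LinearMap.det (transverseExtension B J w' T (nullRicci hg ⟨x, w⟩ / ((m : ℝ) - 2))) := by
  set lam := nullRicci hg ⟨x, w⟩ / ((m : ℝ) - 2) with hlam
  rw [← LinearMap.det_conj _ e, nullDet_eq hg rfl, ← hlam]
  have hLe : ∀ v : Model m, ((e : Model m →ₗ[ℝ] Tan m x) ∘ₗ transverseExtension B J w' T lam ∘ₗ
      (e.symm : Tan m x →ₗ[ℝ] Model m)) (e v) = jacobiMap g w (e v) - lam • e v +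
      (1 + lam) • (((B w' T)⁻¹ * B v T) • w + ((B w' T)⁻¹ * B w' v) • e T) := by
    intro v
    simp only [LinearMap.comp_apply, LinearEquiv.coe_coe, LinearEquiv.symm_apply_apply,
      transverseExtension_apply, map_add, map_sub, map_smul, hJ, hw']
  have hww : B w' w' = 0 := by rw [hB, hw', hw]
  refine det_subquotient (W := S.perp (ℝ ∙ w)) (ℓ := ℝ ∙ w) ?_ ?_ ?_
  · intro v
    obtain ⟨v, rfl⟩ := e.surjective v
    rw [hLe, mem_perp_span hg]
    have h1 : g.form x w (jacobiMap g w (e v)) = 0 :=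
      (mem_perp_span hg).1 (jacobiMap_mem hg rfl (e v))
    have h2 : g.form x w (e v) = B w' v := by rw [hB, hw']
    have h3 : g.form x w (e T) = B w' T := by rw [hB, hw']
    simp only [map_add, map_sub, map_smul, h1, h2, h3, hw, smul_eq_mul]
    field_simp
    ring
  · intro v hv
    obtain ⟨c, rfl⟩ := Submodule.mem_span_singleton.1 hv
    rw [map_smul]
    congr 1
    have := hLe w'
    rw [hw'] at this
    rw [this, show jacobiMap g w w = 0 from riemann_self g x w w, hww, inv_mul_cancel₀ hT]
    module
  · intro v hv hv'
    refine (Submodule.Quotient.eq ((ℝ ∙ w).submoduleOf (S.perp (ℝ ∙ w)))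
      (x := ⟨jacobiMap g w v, jacobiMap_mem hg rfl v⟩ - lam • ⟨v, hv⟩)).2 ?_
    change (jacobiMap g w v - lam • v) - _ ∈ ℝ ∙ w
    obtain ⟨v, rfl⟩ := e.surjective v
    have h2 : B w' v = 0 := by rw [hB, hw', (mem_perp_span hg).1 hv]
    have := hLe v
    rw [h2, mul_zero, zero_smul, add_zero, smul_smul] at this
    refine Submodule.mem_span_singleton.2 ⟨-((1 + lam) * ((B w' T)⁻¹ * B v T)), ?_⟩
    refine Eq.trans ?_ (congrArg (fun z ↦ (jacobiMap g w (e v) - lam • e v) - z) this).symm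
    module

/-- The derivative of a chart, as an isomorphism of the model space with the tangent space. -/
noncomputable def chartEquiv {x x₀ : M} (hx : x ∈ (chartAt (Model m) x₀).source) :
    Model m ≃ₗ[ℝ] Tan m x :=
  LinearEquiv.ofBijective (show Model m →ₗ[ℝ] Tan m x from
    (chartDeriv (E := Model m) x₀ (extChartAt 𝓘(ℝ, Model m) x₀ x)).toLinearMap)
    (chartDeriv_bijective x₀ ((extChartAt 𝓘(ℝ, Model m) x₀).map_source
      (by rwa [extChartAt_source])))

lemma chartEquiv_apply {x x₀ : M} (hx : x ∈ (chartAt (Model m) x₀).source) (v : Model m) :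
    (show Model m from chartEquiv hx v) =
      chartDeriv x₀ (extChartAt 𝓘(ℝ, Model m) x₀ x) v := rfl

lemma form_chartEquiv (g : LorentzMetric m M) {x x₀ : M} (hx : x ∈ (chartAt (Model m) x₀).source)
    (u v : Model m) : localMetric g x₀ (extChartAt 𝓘(ℝ, Model m) x₀ x) u v =
      g.form x (chartEquiv hx u) (chartEquiv hx v) := by
  rw [localMetric_apply]
  exact form_congr ((extChartAt 𝓘(ℝ, Model m) x₀).left_inv (by rwa [extChartAt_source]))
    (chartEquiv_apply hx u).symm (chartEquiv_apply hx v).symm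

lemma chartEquiv_localJacobiMap (g : LorentzMetric m M) {x x₀ : M}
    (hx : x ∈ (chartAt (Model m) x₀).source) (w v : Model m) :
    chartEquiv hx (localJacobiMap (localConnection g x₀) (extChartAt 𝓘(ℝ, Model m) x₀ x) w v) =
      jacobiMap g (chartEquiv hx w) (chartEquiv hx v) :=
  (jacobiMap_chartDeriv g hx (chartEquiv_apply hx w) (chartEquiv_apply hx v)).symm

variable {γ : ℝ → M} {t : ℝ}

lemma contDiffAt_paramRicci (hg : g ∈ S.metrics)
    (hγ : ∀ᶠ s in 𝓝 t, ContMDiffAt 𝓘(ℝ, ℝ) 𝓘(ℝ, Model m) ∞ γ s) :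
    ContDiffAt ℝ ∞ (paramRicci hg γ) t := by
  have hx : γ t ∈ (chartAt (Model m) (γ t)).source := mem_chart_source _ _
  have hc : ContDiffAt ℝ ∞ (chartCurve (m := m) (γ t) γ) t :=
    contDiffAt_chartCurve hγ.self_of_nhds hx
  have hΓ : ContDiffAt ℝ ∞ (localConnection g (γ t)) (chartCurve (m := m) (γ t) γ t) :=
    contDiffAt_localConnection g (γ t) (mem_extChartAt_target (γ t))
  have hsm := contDiffAt_linearMap_trace (A := fun s ↦ localJacobiMap (localConnection g (γ t))
    (chartCurve (m := m) (γ t) γ s) (deriv (chartCurve (m := m) (γ t) γ) s))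
    (contDiffAt_localJacobi hΓ hc (hc.derivWithin (by simp)))
  refine hsm.congr_of_eventuallyEq ?_
  filter_upwards [hγ, hγ.self_of_nhds.continuousAt.preimage_mem_nhds
    ((chartAt _ (γ t)).open_source.mem_nhds hx)] with s hs hxs
  have hv : velocity γ s = chartEquiv hxs (deriv (chartCurve (m := m) (γ t) γ) s) :=
    velocity_eq_chartDeriv hs hxs
  change nullRicci hg ⟨γ s, velocity γ s⟩ = _
  rw [nullRicci_eq_trace, ← LinearMap.trace_conj' _ (chartEquiv hxs)]
  congr 1
  refine LinearMap.ext fun v ↦ ?_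
  obtain ⟨v, rfl⟩ := (chartEquiv hxs).surjective v
  rw [LinearEquiv.conj_apply_apply, LinearEquiv.symm_apply_apply, hv]
  exact (chartEquiv_localJacobiMap g hxs _ v).symm

lemma contDiffAt_tracelessDet (hg : g ∈ S.metrics)
    (hγ : ∀ᶠ s in 𝓝 t, ContMDiffAt 𝓘(ℝ, ℝ) 𝓘(ℝ, Model m) ∞ γ s)
    (hnull : ∀ᶠ s in 𝓝 t, g.form (γ s) (velocity γ s) (velocity γ s) = 0)
    (hne : (velocity γ t : Tan m (γ t)) ≠ 0) : ContDiffAt ℝ ∞ (tracelessDet hg γ) t := by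
  have hx : γ t ∈ (chartAt (Model m) (γ t)).source := mem_chart_source _ _
  set x₀ := γ t with hx₀
  set c := chartCurve (m := m) x₀ γ with hcdef
  have hc : ContDiffAt ℝ ∞ c t := contDiffAt_chartCurve (x₀ := x₀) hγ.self_of_nhds hx
  have hc' : ContDiffAt ℝ ∞ (deriv c) t := hc.derivWithin (by simp)
  have hΓ : ContDiffAt ℝ ∞ (localConnection g x₀) (c t) :=
    contDiffAt_localConnection g x₀ (mem_extChartAt_target x₀)
  have hG : ContDiffAt ℝ ∞ (fun s ↦ localMetric g x₀ (c s)) t :=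
    (contDiffAt_localMetric g x₀ (y := c t) (mem_extChartAt_target x₀)).comp t hc
  have hv : ∀ s, ∀ hs : ContMDiffAt 𝓘(ℝ, ℝ) 𝓘(ℝ, Model m) ∞ γ s,
      ∀ hxs : γ s ∈ (chartAt (Model m) x₀).source, velocity γ s = chartEquiv hxs (deriv c s) :=
    fun s hs hxs ↦ velocity_eq_chartDeriv hs hxs
  obtain ⟨T, hT⟩ : ∃ T : Model m, localMetric g x₀ (c t) (deriv c t) T ≠ 0 := by
    by_contra! hcon
    refine hne (form_nondegenerate g _ _ fun u ↦ ?_)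
    obtain ⟨u, rfl⟩ := (chartEquiv hx).surjective u
    rw [hv t hγ.self_of_nhds hx]
    exact (form_chartEquiv g hx _ u).symm.trans (hcon u)
  have hT' : ContDiffAt ℝ ∞ (fun s ↦ localMetric g x₀ (c s) (deriv c s) T) t :=
    (hG.clm_apply hc').clm_apply contDiffAt_const
  have hsm := contDiffAt_linearMap_det (A := fun s ↦ transverseExtension (localMetric g x₀ (c s))
    (localJacobiMap (localConnection g x₀) (c s) (deriv c s)) (deriv c s) T
    (paramRicci hg γ s / ((m : ℝ) - 2))) (t := t) (by
    intro v
    simp only [transverseExtension_apply]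
    have hR : ContDiffAt ℝ ∞ (fun s ↦ paramRicci hg γ s / ((m : ℝ) - 2)) t :=
      (contDiffAt_paramRicci hg hγ).div_const _
    have hJ : ContDiffAt ℝ ∞
        (fun s ↦ localJacobiMap (localConnection g x₀) (c s) (deriv c s) v) t :=
      contDiffAt_localJacobi hΓ hc hc' v
    have h1 : ContDiffAt ℝ ∞ (fun s ↦ localMetric g x₀ (c s) v T) t :=
      (hG.clm_apply contDiffAt_const).clm_apply contDiffAt_const
    have h2 : ContDiffAt ℝ ∞ (fun s ↦ localMetric g x₀ (c s) (deriv c s) v) t :=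
      (hG.clm_apply hc').clm_apply contDiffAt_const
    exact (hJ.sub (hR.smul contDiffAt_const)).add ((contDiffAt_const.add hR).smul
      ((((hT'.inv hT).mul h1).smul hc').add (((hT'.inv hT).mul h2).smul contDiffAt_const))))
  refine hsm.congr_of_eventuallyEq ?_
  filter_upwards [hγ, hγ.self_of_nhds.continuousAt.preimage_mem_nhds
    ((chartAt _ x₀).open_source.mem_nhds hx), hnull, hT'.continuousAt.eventually_ne hT]
    with s hs hxs hns hTs
  exact nullDet_eq_det hg hns (chartEquiv hxs) (form_chartEquiv g hxs)
    (fun v ↦ by rw [hv s hs hxs]; exact chartEquiv_localJacobiMap g hxs _ v) (hv s hs hxs).symm hTs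

end Spacetime

/-! ### Reparametrised null geodesics -/

lemma hasDerivAt_integral_of_continuousOn {k : ℝ → ℝ} {I : Set ℝ} (hI : IsOpen I)
    (hI' : I.OrdConnected) (hk : ContinuousOn k I) {a t : ℝ} (ha : a ∈ I) (ht : t ∈ I) :
    HasDerivAt (fun u ↦ ∫ τ in a..u, k τ) (k t) t :=
  intervalIntegral.integral_hasDerivAt_right
    (hk.mono (hI'.uIcc_subset ha ht)).intervalIntegrable
    (hk.stronglyMeasurableAtFilter hI t ht) (hk.continuousAt (hI.mem_nhds ht))

section Conformal

variable {m : ℕ} {M : Type*} [TopologicalSpace M] [ChartedSpace (Model m) M]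

lemma tangent_congr {γ₁ γ₂ : ℝ → M} {s : ℝ} (h : γ₁ =ᶠ[𝓝 s] γ₂) :
    (⟨γ₁ s, velocity γ₁ s⟩ : TangentBundle 𝓘(ℝ, Model m) M) = ⟨γ₂ s, velocity γ₂ s⟩ :=
  totalSpace_ext h.self_of_nhds (congrArg (fun A : ℝ →L[ℝ] Model m ↦ A 1) h.mfderiv_eq)

lemma velocity_comp {γ : ℝ → M} {φ : ℝ → ℝ} {s a : ℝ}
    (hγ : ContMDiffAt 𝓘(ℝ, ℝ) 𝓘(ℝ, Model m) ∞ γ (φ s))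
    (hφ : HasDerivAt φ a s) :
    (velocity (γ ∘ φ) s : Tan m (γ (φ s))) = a • velocity γ (φ s) := by
  have h1 := (hγ.mdifferentiableAt (by simp)).hasMFDerivAt
  have h2 := h1.comp s hφ.hasFDerivAt.hasMFDerivAt
  unfold velocity
  rw [h2.mfderiv]
  have h3 : ∀ A : ℝ →L[ℝ] Model m, A ((1 : ℝ) • a) = a • A 1 := fun A ↦ by
    rw [one_smul, ← map_smul, smul_eq_mul, mul_one]
  exact h3 (mfderiv 𝓘(ℝ, ℝ) 𝓘(ℝ, Model m) γ (φ s))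

variable [IsManifold 𝓘(ℝ, Model m) ∞ M]

/-- The metric `e^{2f} g`. -/
noncomputable def conformalMetric (g : LorentzMetric m M) (f : M → ℝ)
    (hf : ContMDiff 𝓘(ℝ, Model m) 𝓘(ℝ, ℝ) ∞ f) : LorentzMetric m M where
  form x := Real.exp (2 * f x) • g.form x
  symm x u v := by
    rw [smul_apply, smul_apply, smul_apply, smul_apply, g.symm]
  signature x := by
    obtain ⟨b, h0, hb⟩ := g.signature x
    refine ⟨b.unitsSMul fun _ ↦ Units.mk0 (Real.exp (-f x)) (Real.exp_ne_zero _), h0,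
      fun i j ↦ ?_⟩
    rw [Module.Basis.unitsSMul_apply, Module.Basis.unitsSMul_apply, ← hb, Units.smul_def,
      Units.smul_def, Units.val_mk0]
    simp only [map_smul, smul_apply, smul_eq_mul, ← mul_assoc, ← Real.exp_add]
    ring_nf
    simp
  smooth := by
    have h1 : ContMDiff 𝓘(ℝ, Model m) 𝓘(ℝ, ℝ) ∞ (fun x ↦ Real.exp (2 * f x)) :=
      (Real.contDiff_exp.comp (contDiff_const.mul contDiff_id)).contMDiff.comp hf
    exact h1.smul_section g.smooth

lemma conformalMetric_form (g : LorentzMetric m M) {f : M → ℝ}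
    (hf : ContMDiff 𝓘(ℝ, Model m) 𝓘(ℝ, ℝ) ∞ f) (x : M) (u v : Tan m x) :
    (conformalMetric g f hf).form x u v = Real.exp (2 * f x) * g.form x u v := rfl

variable {γ : ℝ → M}

/-- A smooth function of the parameter of a regular curve extends to the manifold, locally. -/
lemma exists_contMDiff_comp_eventuallyEq [T2Space M]
    (hγ : ∀ᶠ t in 𝓝 (0 : ℝ), ContMDiffAt 𝓘(ℝ, ℝ) 𝓘(ℝ, Model m) ∞ γ t)
    (hne : (velocity γ 0 : Tan m (γ 0)) ≠ 0) {F : ℝ → ℝ}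
    (hF : ∀ᶠ t in 𝓝 (0 : ℝ), ContDiffAt ℝ ∞ F t) :
    ∃ f : M → ℝ, ContMDiff 𝓘(ℝ, Model m) 𝓘(ℝ, ℝ) ∞ f ∧ f ∘ γ =ᶠ[𝓝 0] F := by
  have hx : γ 0 ∈ (chartAt (Model m) (γ 0)).source := mem_chart_source _ _
  set x₀ := γ 0 with hx₀
  set c := chartCurve (m := m) x₀ γ with hcdef
  have hsrc : ∀ᶠ t in 𝓝 (0 : ℝ), γ t ∈ (chartAt (Model m) x₀).source :=
    hγ.self_of_nhds.continuousAt.preimage_mem_nhds ((chartAt _ x₀).open_source.mem_nhds hx)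
  have hc : ∀ᶠ t in 𝓝 (0 : ℝ), ContDiffAt ℝ ∞ c t := by
    filter_upwards [hγ, hsrc] with t ht htx using contDiffAt_chartCurve ht htx
  -- Some coordinate of the curve is a local parameter.
  obtain ⟨k, hk⟩ : ∃ k, (deriv c 0) k ≠ 0 := by
    by_contra! hcon
    refine hne ((velocity_eq_deriv hγ.self_of_nhds).trans ?_)
    ext k
    exact hcon k
  set p : Model m →L[ℝ] ℝ := EuclideanSpace.proj k with hp
  have hpc : ∀ᶠ t in 𝓝 (0 : ℝ), ContDiffAt ℝ ∞ (fun t ↦ p (c t)) t := by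
    filter_upwards [hc] with t ht using p.contDiff.contDiffAt.comp t ht
  have hd : deriv (fun t ↦ p (c t)) 0 ≠ 0 := by
    have := (p.hasFDerivAt.comp_hasDerivAt (0 : ℝ)
      (hc.self_of_nhds.differentiableAt (by simp)).hasDerivAt).deriv
    rw [show (fun t ↦ p (c t)) = p ∘ c from rfl, this]
    exact hk
  obtain ⟨σ, hσ, hσc⟩ := exists_local_leftInverse hpc hd
  have hσ0 : σ (p (c 0)) = 0 := hσc.self_of_nhds
  have hΦ : ∀ᶠ y in 𝓝 (p (c 0)), ContDiffAt ℝ ∞ (F ∘ σ) y := by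
    have : Tendsto σ (𝓝 (p (c 0))) (𝓝 0) := by
      have := hσ.self_of_nhds.continuousAt.tendsto
      rwa [hσ0] at this
    filter_upwards [hσ, this.eventually hF] with y hy hy' using hy'.comp y hy
  obtain ⟨Ψ, hΨ, hΨΦ⟩ := exists_contDiff_eventuallyEq hΦ
  let b : SmoothBumpFunction 𝓘(ℝ, Model m) x₀ := Classical.choice inferInstance
  refine ⟨fun x ↦ b x • Ψ (p (extChartAt 𝓘(ℝ, Model m) x₀ x)), b.contMDiff_smul ?_, ?_⟩
  · intro x hxs
    have h1 := contMDiffAt_extChartAt' (I := 𝓘(ℝ, Model m)) (n := ∞) hxs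
    exact ((hΨ.comp p.contDiff).contMDiff.contMDiffAt.comp x h1).contMDiffWithinAt
  · have hb : ∀ᶠ t in 𝓝 (0 : ℝ), b (γ t) = 1 :=
      hγ.self_of_nhds.continuousAt.eventually b.eventuallyEq_one
    have hpc0 : Tendsto (fun t ↦ p (c t)) (𝓝 0) (𝓝 (p (c 0))) :=
      hpc.self_of_nhds.continuousAt.tendsto
    filter_upwards [hb, hpc0.eventually hΨΦ, hσc] with t h1 h2 h3
    change b (γ t) • Ψ (p (c t)) = F t
    rw [h1, one_smul, h2, Function.comp_apply, h3]

end Conformal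

namespace Spacetime

variable {m : ℕ} {M : Type*} [TopologicalSpace M] [ChartedSpace (Model m) M]
  [IsManifold 𝓘(ℝ, Model m) ∞ M] {S : Spacetime m M} {g h : LorentzMetric m M} {γ : ℝ → M}
  {I : Set ℝ} {t : ℝ}

lemma conformalMetric_mem (hg : g ∈ S.metrics) {f : M → ℝ}
    (hf : ContMDiff 𝓘(ℝ, Model m) 𝓘(ℝ, ℝ) ∞ f) : conformalMetric g f hf ∈ S.metrics := by
  obtain ⟨g₀, hS⟩ := S.isClass
  rw [hS] at hg ⊢
  obtain ⟨a, ha, hga⟩ := hg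
  refine ⟨fun x ↦ f x + a x, hf.add ha, fun x u v ↦ ?_⟩
  rw [conformalMetric_form, hga, ← mul_assoc, ← Real.exp_add]
  ring_nf

namespace IsNullGeodesicOn

lemma contMDiffAt (hγ : S.IsNullGeodesicOn g γ I) (ht : t ∈ I) :
    ContMDiffAt 𝓘(ℝ, ℝ) 𝓘(ℝ, Model m) ∞ γ t :=
  hγ.smooth.contMDiffAt (hγ.isOpen.mem_nhds ht)

lemma eventually_mem (hγ : S.IsNullGeodesicOn g γ I) (ht : t ∈ I) : ∀ᶠ s in 𝓝 t, s ∈ I :=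
  hγ.isOpen.mem_nhds ht

lemma eventually_contMDiffAt (hγ : S.IsNullGeodesicOn g γ I) (ht : t ∈ I) :
    ∀ᶠ s in 𝓝 t, ContMDiffAt 𝓘(ℝ, ℝ) 𝓘(ℝ, Model m) ∞ γ s := by
  filter_upwards [hγ.eventually_mem ht] with s hs using hγ.contMDiffAt hs

/-- The velocity does not vanish because it is not orthogonal to the time orientation. -/
lemma velocity_ne_zero (hγ : S.IsNullGeodesicOn g γ I) (ht : t ∈ I) :
    (velocity γ t : Tan m (γ t)) ≠ 0 := by
  intro h0
  have := hγ.future t ht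
  rw [h0, map_zero] at this
  exact lt_irrefl _ this

lemma contDiffAt_paramRicci (hγ : S.IsNullGeodesicOn g γ I) (hg : g ∈ S.metrics) (ht : t ∈ I) :
    ContDiffAt ℝ ∞ (paramRicci hg γ) t :=
  Spacetime.contDiffAt_paramRicci hg (hγ.eventually_contMDiffAt ht)

lemma contDiffAt_tracelessDet (hγ : S.IsNullGeodesicOn g γ I) (hg : g ∈ S.metrics) (ht : t ∈ I) :
    ContDiffAt ℝ ∞ (tracelessDet hg γ) t := by
  refine Spacetime.contDiffAt_tracelessDet hg (hγ.eventually_contMDiffAt ht) ?_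
    (hγ.velocity_ne_zero ht)
  filter_upwards [hγ.eventually_mem ht] with s hs using hγ.null s hs

lemma contDiffAt_zeta (hγ : S.IsNullGeodesicOn g γ I) (hg : g ∈ S.metrics) (ht : t ∈ I)
    (h0 : tracelessDet hg γ t ≠ 0) : ContDiffAt ℝ ∞ (zeta hg γ) t :=
  ((contDiffAt_abs h0).comp t (hγ.contDiffAt_tracelessDet hg ht)).rpow_const_of_ne
    (abs_ne_zero.2 h0)

/-- The root `ζ` of a null geodesic only depends on the conformal class, apart from the factor due
to the parametrisation. -/
lemma zeta_reparam (hm : 3 ≤ m) (hγ : S.IsNullGeodesicOn g γ I) (hg : g ∈ S.metrics)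
    (hh : h ∈ S.metrics) {γ' : ℝ → M} {φ : ℝ → ℝ} {s a : ℝ} (hφ : HasDerivAt φ a s) (ha : a ≠ 0)
    (hs : φ s ∈ I) (hγ' : γ' =ᶠ[𝓝 s] γ ∘ φ) : zeta hh γ' s = |a| * zeta hg γ (φ s) := by
  rw [zeta_eq_nullZeta, zeta_eq_nullZeta, tangent_congr hγ', ← nullZeta_conformal hm hg hh
    (hγ.null _ hs) (hγ.velocity_ne_zero hs) ha, ← velocity_comp (hγ.contMDiffAt hs) hφ]
  rfl

end IsNullGeodesicOn

end Spacetime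

/-! ### Existence of parametrisations with prescribed speed -/

namespace Spacetime

variable {m : ℕ} {M : Type*} [TopologicalSpace M] [ChartedSpace (Model m) M]
  [IsManifold 𝓘(ℝ, Model m) ∞ M] {S : Spacetime m M} {g h : LorentzMetric m M} {γ : ℝ → M}
  {I : Set ℝ} {t : ℝ}

namespace IsNullGeodesicOn

/-- A null geodesic of `g`, reparametrised with speed `ρ`, is a null geodesic of `e^{2f} g` near the
starting point, as soon as `e^{-2f} = ρ` along it. -/
lemma exists_reparam [T2Space M] (hγ : S.IsNullGeodesicOn g γ I) (h0 : 0 ∈ I)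
    {ρ : ℝ → ℝ} (hρ : ∀ᶠ t in 𝓝 (0 : ℝ), ContDiffAt ℝ ∞ ρ t ∧ 0 < ρ t) {Q : ℝ → Prop}
    (hQ : ∀ᶠ t in 𝓝 (0 : ℝ), Q t) :
    ∃ (f : M → ℝ) (hf : ContMDiff 𝓘(ℝ, Model m) 𝓘(ℝ, ℝ) ∞ f) (φ : ℝ → ℝ) (J : Set ℝ),
      φ 0 = 0 ∧ 0 ∈ J ∧ S.IsNullGeodesicOn (conformalMetric g f hf) (γ ∘ φ) J ∧
      ∀ s ∈ J, φ s ∈ I ∧ HasDerivAt φ (ρ (φ s)) s ∧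
        (f ∘ γ =ᶠ[𝓝 (φ s)] fun t ↦ -(Real.log (ρ t) / 2)) ∧ Q (φ s) := by
  have hF : ∀ᶠ t in 𝓝 (0 : ℝ), ContDiffAt ℝ ∞ (fun t ↦ -(Real.log (ρ t) / 2)) t := by
    filter_upwards [hρ] with t ht using ((ht.1.log ht.2.ne').div_const 2).neg
  obtain ⟨f, hf, hfγ⟩ := exists_contMDiff_comp_eventuallyEq (hγ.eventually_contMDiffAt h0)
    (hγ.velocity_ne_zero h0) hF
  obtain ⟨φ, hφ0, hφ⟩ := exists_integralCurve (hρ.mono fun t ht ↦ ht.1)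
  have hlim : Tendsto φ (𝓝 0) (𝓝 0) := by
    have := hφ.self_of_nhds.2.continuousAt.tendsto
    rwa [hφ0] at this
  have hall := hφ.and (hlim.eventually
    ((hγ.eventually_mem h0).and (hρ.and ((eventually_eventually_nhds.2 hfγ).and hQ))))
  obtain ⟨ε, hε, hJ⟩ := Metric.eventually_nhds_iff_ball.1 hall
  refine ⟨f, hf, φ, Metric.ball 0 ε, hφ0, Metric.mem_ball_self hε, ?_, fun s hs ↦ ?_⟩
  · have hvel : ∀ s ∈ Metric.ball (0 : ℝ) ε,
        (velocity (γ ∘ φ) s : Tan m (γ (φ s))) = ρ (φ s) • velocity γ (φ s) := fun s hs ↦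
      velocity_comp (hγ.contMDiffAt (hJ s hs).2.1) (hJ s hs).1.1
    refine ⟨Metric.isOpen_ball, (convex_ball _ _).ordConnected, fun s hs ↦ ?_, fun s hs ↦ ?_,
      fun s hs ↦ ?_, fun s hs ↦ ?_⟩
    · exact ((hγ.contMDiffAt (hJ s hs).2.1).comp s
        (hJ s hs).1.2.contMDiffAt).contMDiffWithinAt
    · change (conformalMetric g f hf).form (γ (φ s)) (velocity (γ ∘ φ) s) (velocity (γ ∘ φ) s) = 0
      rw [hvel s hs, conformalMetric_form, map_smul, map_smul, smul_apply,
        hγ.null _ (hJ s hs).2.1, smul_zero, smul_zero, mul_zero]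
    · change (conformalMetric g f hf).form (γ (φ s)) (velocity (γ ∘ φ) s) (S.time (γ (φ s))) < 0
      rw [hvel s hs, conformalMetric_form, map_smul, smul_apply, smul_eq_mul]
      exact mul_neg_of_pos_of_neg (Real.exp_pos _)
        (mul_neg_of_pos_of_neg (hJ s hs).2.2.1.2 (hγ.future _ (hJ s hs).2.1))
    · obtain ⟨⟨hd, hsm⟩, hI, ⟨hρs, hρ0⟩, hfs, -⟩ := hJ s hs
      refine geodesicEqAt_conformal (g := g) hf (conformalMetric_form g hf) hsm (hγ.contMDiffAt hI)
        (hγ.geodesic _ hI) (hγ.null _ hI) ?_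
      have hd2 : deriv φ =ᶠ[𝓝 s] ρ ∘ φ := by
        filter_upwards [Metric.isOpen_ball.mem_nhds hs] with r hr using (hJ r hr).1.1.deriv
      have hρd := (hρs.differentiableAt (by simp)).hasDerivAt
      rw [hd2.deriv_eq, (hρd.comp s hd).deriv, hd.deriv, EventuallyEq.deriv_eq hfs,
        ((hρd.log hρ0.ne').div_const 2).fun_neg.deriv]
      field_simp
      ring
  · exact ⟨(hJ s hs).2.1, (hJ s hs).1.1, (hJ s hs).2.2.2.1, (hJ s hs).2.2.2.2⟩

end IsNullGeodesicOn

end Spacetime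

/-! ### Uniqueness of the sky-curvature -/

namespace Spacetime

variable {m : ℕ} {M : Type*} [TopologicalSpace M] [ChartedSpace (Model m) M]

lemma StartsAt.comp {γ : ℝ → M} {p : M} {w : Tan m p} (h : StartsAt γ w) {φ : ℝ → ℝ} {c : ℝ}
    (hφ0 : φ 0 = 0) (hφ : HasDerivAt φ c 0)
    (hγ : ContMDiffAt 𝓘(ℝ, ℝ) 𝓘(ℝ, Model m) ∞ γ 0) : StartsAt (γ ∘ φ) (c • w) := by
  have h1 : (⟨γ (φ 0), velocity (γ ∘ φ) 0⟩ : TangentBundle 𝓘(ℝ, Model m) M) =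
      ⟨γ (φ 0), c • velocity γ (φ 0)⟩ :=
    congrArg (Bundle.TotalSpace.mk _) (velocity_comp (hφ0.symm ▸ hγ) hφ)
  have h2 : (⟨γ (φ 0), c • velocity γ (φ 0)⟩ : TangentBundle 𝓘(ℝ, Model m) M) =
      ⟨γ 0, c • velocity γ 0⟩ :=
    congrArg (fun t ↦ (⟨γ t, c • velocity γ t⟩ : TangentBundle 𝓘(ℝ, Model m) M)) hφ0
  exact (h1.trans h2).trans (congrArg (fun X : TangentBundle 𝓘(ℝ, Model m) M ↦
    (⟨X.1, c • X.2⟩ : TangentBundle 𝓘(ℝ, Model m) M)) h)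

variable [IsManifold 𝓘(ℝ, Model m) ∞ M] {S : Spacetime m M}

lemma NullRay.exists_smul_eq {α : S.NullRay} {w w' : Tan m α.pt} (hw : w ∈ α.carrier)
    (hw' : w' ∈ α.carrier) : ∃ c : ℝ, 0 < c ∧ w' = c • w := by
  obtain ⟨u, -, hu⟩ := α.isRay
  rw [hu] at hw hw'
  obtain ⟨a, ha, rfl⟩ := hw
  obtain ⟨b, hb, rfl⟩ := hw'
  exact ⟨b / a, div_pos hb ha, by rw [smul_smul, div_mul_cancel₀ _ ha.ne']⟩

lemma NullRay.smul_mem {α : S.NullRay} {w : Tan m α.pt} (hw : w ∈ α.carrier) {c : ℝ} (hc : 0 < c) :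
    c • w ∈ α.carrier := by
  obtain ⟨u, -, hu⟩ := α.isRay
  rw [hu] at hw ⊢
  obtain ⟨a, ha, rfl⟩ := hw
  exact ⟨c * a, mul_pos hc ha, smul_smul _ _ _⟩

variable {g h : LorentzMetric m M} {γ γ' : ℝ → M} {I J : Set ℝ}

/-- If `ζ = 1` along a null geodesic `γ'` of `e^{2f} g`, and `γ` is the null geodesic of `g` on the
same light ray, then `ζ` is a constant multiple of `e^{2f}` along `γ`. The derivatives of `f` which
enter the conformal change of the curvature can therefore be expressed in terms of `ζ`. -/
lemma curvature_of_zeta_eq_one (hm : 3 ≤ m) (hg : g ∈ S.metrics) (hγ : S.IsNullGeodesicOn g γ I)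
    (h0 : 0 ∈ I) (hh : h ∈ S.metrics) (hγ' : S.IsNullGeodesicOn h γ' J) (h0' : 0 ∈ J)
    {α : S.NullRay} {w w' : Tan m α.pt} (hw : w ∈ α.carrier) (hw' : w' ∈ α.carrier)
    (hst : StartsAt γ w) (hst' : StartsAt γ' w') (hζ : ∀ᶠ s in 𝓝 0, zeta hh γ' s = 1) :
    α.curvature hh hw' = (1 / zeta hg γ 0 ^ 2) • (α.curvature hg hw +
      (1 / 2 * (deriv (deriv (zeta hg γ)) 0 / zeta hg γ 0 -
        3 / 2 * (deriv (zeta hg γ) 0 / zeta hg γ 0) ^ 2)) • LinearMap.id) := by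
  obtain ⟨f, hf, hfg⟩ := exists_conformal_factor hg hh
  obtain ⟨c, hc, rfl⟩ := NullRay.exists_smul_eq hw hw'
  set F : ℝ → ℝ := f ∘ γ with hFdef
  have hF : ∀ t ∈ I, ContDiffAt ℝ ∞ F t := fun t ht ↦
    (hf.contMDiffAt.comp t (hγ.contMDiffAt ht)).contDiffAt
  -- The speed for which the reparametrisation of `γ` is a geodesic with initial velocity `c • w`.
  set V : ℝ → ℝ := fun t ↦ c * Real.exp (-2 * (F t - F 0)) with hVdef
  have hVpos : ∀ t, 0 < V t := fun t ↦ mul_pos hc (Real.exp_pos _)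
  have hV : ∀ t ∈ I, ContDiffAt ℝ ∞ V t := fun t ht ↦
    contDiffAt_const.mul ((contDiffAt_const.mul ((hF t ht).sub contDiffAt_const)).exp)
  have hV' : ∀ t ∈ I, HasDerivAt V (-2 * deriv F t * V t) t := by
    intro t ht
    have h1 := ((hF t ht).differentiableAt (by simp)).hasDerivAt
    refine (((h1.sub_const (F 0)).const_mul (-2)).exp.const_mul c).congr_deriv ?_
    rw [hVdef]
    ring
  obtain ⟨φ, hφ0, hφ⟩ := exists_integralCurve (x₀ := (0 : ℝ)) (V := V)
    (by filter_upwards [hγ.eventually_mem h0] with t ht using hV t ht)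
  have hV0 : V 0 = c := by simp [hVdef]
  have hφd : HasDerivAt φ c 0 := by
    have := hφ.self_of_nhds.1
    rwa [hφ0, hV0] at this
  have hlim : Tendsto φ (𝓝 0) (𝓝 0) := by
    have := hφd.continuousAt.tendsto
    rwa [hφ0] at this
  -- The reparametrised curve `γ ∘ φ` is the geodesic `γ'`.
  have heq : γ' =ᶠ[𝓝 0] γ ∘ φ := by
    refine eventuallyEq_of_geodesicEqAt h ?_ ?_
      (hst'.trans (hst.comp hφ0 hφd (hγ.contMDiffAt h0)).symm)
    · filter_upwards [hγ'.eventually_mem h0'] with s hs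
        using ⟨hγ'.contMDiffAt hs, hγ'.geodesic s hs⟩
    · filter_upwards [hφ.eventually_nhds, hlim.eventually (hγ.eventually_mem h0)] with s hs hsI
      obtain ⟨hd, hsm⟩ := hs.self_of_nhds
      refine ⟨(hγ.contMDiffAt hsI).comp s hsm.contMDiffAt, geodesicEqAt_conformal hf hfg hsm
        (hγ.contMDiffAt hsI) (hγ.geodesic _ hsI) (hγ.null _ hsI) ?_⟩
      have hd2 : deriv φ =ᶠ[𝓝 s] V ∘ φ := by
        filter_upwards [hs] with r hr using hr.1.deriv
      rw [hd2.deriv_eq, ((hV' _ hsI).comp s hd).deriv, hd.deriv]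
      ring
  -- Hence `ζ` is determined along `γ`.
  have hmap : map φ (𝓝 0) = 𝓝 0 := by
    have h1 := hφ.self_of_nhds.2.hasStrictDerivAt (by simp)
    rw [hφd.deriv] at h1
    rw [h1.map_nhds_eq hc.ne', hφ0]
  have hζV : ∀ᶠ t in 𝓝 (0 : ℝ), t ∈ I ∧ zeta hg γ t = (V t)⁻¹ := by
    rw [← hmap, eventually_map]
    filter_upwards [hζ, hφ, heq.eventually_nhds, hlim.eventually (hγ.eventually_mem h0)]
      with s h1 h2 h3 h4
    refine ⟨h4, ?_⟩
    have h5 := hγ.zeta_reparam hm hg hh h2.1 (hVpos _).ne' h4 h3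
    rw [h1, abs_of_pos (hVpos _)] at h5
    exact eq_inv_of_mul_eq_one_right h5.symm
  have hinv : ∀ t ∈ I, HasDerivAt (fun t ↦ (V t)⁻¹) (2 * deriv F t * (V t)⁻¹) t := by
    intro t ht
    refine ((hV' t ht).inv (hVpos t).ne').congr_deriv ?_
    have := (hVpos t).ne'
    field_simp
  have hζe : zeta hg γ =ᶠ[𝓝 0] fun t ↦ (V t)⁻¹ := hζV.mono fun t ht ↦ ht.2
  have hζ1 : deriv (zeta hg γ) =ᶠ[𝓝 0] fun t ↦ 2 * deriv F t * (V t)⁻¹ := by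
    filter_upwards [hζe.eventually_nhds, hγ.eventually_mem h0] with t h1 h2
    rw [EventuallyEq.deriv_eq h1, (hinv t h2).deriv]
  have hζ2 : deriv (deriv (zeta hg γ)) 0 =
      2 * deriv (deriv F) 0 * c⁻¹ + 2 * deriv F 0 * (2 * deriv F 0 * c⁻¹) := by
    have h1 := (differentiableAt_deriv (hF 0 h0)).hasDerivAt
    rw [hζ1.deriv_eq, ((h1.const_mul 2).fun_mul (hinv 0 h0)).deriv, hV0]
  have hκ : conformalTerm g f w = deriv (deriv F) 0 - deriv F 0 ^ 2 := by
    rw [hFdef, ← conformalTerm_velocity hf (hγ.contMDiffAt h0) (hγ.geodesic 0 h0)]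
    exact (congrArg (fun X : TangentBundle 𝓘(ℝ, Model m) M ↦ conformalTerm g f X.2) hst).symm
  have hnull : g.form α.pt w w = 0 :=
    (congrArg (fun X : TangentBundle 𝓘(ℝ, Model m) M ↦ g.form X.1 X.2 X.2) hst).symm.trans
      (hγ.null 0 h0)
  have hcurv : α.curvature hh hw' = c ^ 2 • (α.curvature hg hw +
      conformalTerm g f w • (LinearMap.id : Module.End ℝ α.SkyTangent)) :=
    jacobiEnd_conformal hg hh hf hfg (α.span_eq_line hw) (α.span_eq_line hw') hnull
  have e0 : zeta hg γ 0 = c⁻¹ := hζe.self_of_nhds.trans (congrArg _ hV0)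
  have e1 : deriv (zeta hg γ) 0 = 2 * deriv F 0 * c⁻¹ := by rw [← hV0, hζ1.self_of_nhds]
  rw [hcurv, hκ, hζ2, e1, e0]
  congr 1
  · rw [one_div, inv_pow, inv_inv]
  · congr 2
    field_simp
    ring

lemma IsNullGeodesicOn.contDiffAt_zetaProj (hm : 3 ≤ m) (hγ : S.IsNullGeodesicOn g γ I)
    (hg : g ∈ S.metrics) (hRic : ∀ t ∈ I, paramRicci hg γ t = 0)
    (hpos : ∀ t ∈ I, 0 < zetaProj hg γ t) {t : ℝ} (ht : t ∈ I) :
    ContDiffAt ℝ ∞ (zetaProj hg γ) t := by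
  have hm0 : 0 < (m : ℝ) - 2 := by
    have : (3 : ℝ) ≤ m := by exact_mod_cast hm
    linarith
  have heq : zetaProj hg γ =ᶠ[𝓝 t] zeta hg γ := by
    filter_upwards [hγ.eventually_mem ht] with s hs using zetaProj_eq_zeta (hRic s hs)
  refine (hγ.contDiffAt_zeta hg ht fun hD ↦ ?_).congr_of_eventuallyEq heq
  have h1 := hpos t ht
  rw [heq.self_of_nhds, zeta, hD, abs_zero, Real.zero_rpow (by positivity)] at h1
  exact lt_irrefl _ h1

/-- A parametrisation by the conformal parameter has `ζ = 1`. -/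
lemma zeta_eq_one_of_integral (hm : 3 ≤ m) (hg : g ∈ S.metrics) (hγ : S.IsNullGeodesicOn g γ I)
    (hRic : ∀ t ∈ I, paramRicci hg γ t = 0) (hpos : ∀ t ∈ I, 0 < zetaProj hg γ t)
    (hh : h ∈ S.metrics) (hγ' : S.IsNullGeodesicOn h γ' J) {ψ : ℝ → ℝ}
    (hψ : ∀ s ∈ J, ψ s ∈ I ∧ s = ∫ τ in (ψ 0)..(ψ s), zetaProj hg γ τ)
    (h0' : 0 ∈ J) (hγγ' : ∀ s ∈ J, γ' s = γ (ψ s)) {s : ℝ} (hs : s ∈ J) : zeta hh γ' s = 1 := by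
  have hcont : ContinuousOn (zetaProj hg γ) I := fun t ht ↦
    (hγ.contDiffAt_zetaProj hm hg hRic hpos ht).continuousAt.continuousWithinAt
  -- `ψ` is a right inverse of `Z`, which is injective on `I` and open there: this makes `ψ`
  -- continuous, and then differentiable.
  set Z : ℝ → ℝ := fun u ↦ ∫ τ in (ψ 0)..u, zetaProj hg γ τ with hZ
  have hZd : ∀ t ∈ I, HasDerivAt Z (zetaProj hg γ t) t := fun t ht ↦
    hasDerivAt_integral_of_continuousOn hγ.isOpen hγ.ordConnected hcont (hψ 0 h0').1 ht
  have hZmono : StrictMonoOn Z I := by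
    refine strictMonoOn_of_deriv_pos hγ.ordConnected.convex
      (fun t ht ↦ (hZd t ht).continuousAt.continuousWithinAt) fun t ht ↦ ?_
    rw [(hZd t (interior_subset ht)).deriv]
    exact hpos t (interior_subset ht)
  have hZψ : ∀ r ∈ J, Z (ψ r) = r := fun r hr ↦ (hψ r hr).2.symm
  have hψcont : ContinuousAt ψ s := by
    have hI := hγ.isOpen.mem_nhds (hψ s hs).1
    have hstrict : HasStrictDerivAt Z (zetaProj hg γ (ψ s)) (ψ s) := by
      refine hasStrictDerivAt_of_hasDerivAt_of_continuousAt ?_ (hcont.continuousAt hI)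
      filter_upwards [hI] with t ht using hZd t ht
    have hmap := hstrict.map_nhds_eq (hpos _ (hψ s hs).1).ne'
    rw [hZψ s hs] at hmap
    intro U hU
    have h1 : Z '' (U ∩ I) ∈ 𝓝 s := hmap ▸ image_mem_map (inter_mem hU hI)
    refine mem_map.2 ?_
    filter_upwards [h1, hγ'.eventually_mem hs] with r hr hrJ
    obtain ⟨t, ⟨htU, htI⟩, htr⟩ := hr
    have : t = ψ r := hZmono.injOn htI (hψ r hrJ).1 (htr.trans (hZψ r hrJ).symm)
    rw [Set.mem_preimage, ← this]
    exact htU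
  have hψd : HasDerivAt ψ (zetaProj hg γ (ψ s))⁻¹ s := by
    refine HasDerivAt.of_local_left_inverse hψcont (hZd _ (hψ s hs).1) (hpos _ (hψ s hs).1).ne' ?_
    filter_upwards [hγ'.eventually_mem hs] with r hr using hZψ r hr
  have heq : γ' =ᶠ[𝓝 s] γ ∘ ψ := by
    filter_upwards [hγ'.eventually_mem hs] with r hr using hγγ' r hr
  have hp := hpos _ (hψ s hs).1
  rw [hγ.zeta_reparam hm hg hh hψd (inv_pos.2 hp).ne' (hψ s hs).1 heq, abs_of_pos (inv_pos.2 hp),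
    ← zetaProj_eq_zeta (hRic _ (hψ s hs).1), inv_mul_cancel₀ hp.ne']

/-- Whichever projective parametrisation and conformal parametrisation are chosen, the sky-curvature
is given by the same formula in terms of `ζ`. -/
lemma IsSkyCurvature.eq (hm : 3 ≤ m) (hg : g ∈ S.metrics) (hγ : S.IsNullGeodesicOn g γ I)
    (h0 : 0 ∈ I) {α : S.NullRay} {w : Tan m α.pt} (hw : w ∈ α.carrier) (hst : StartsAt γ w)
    {C : Module.End ℝ α.SkyTangent} (hC : IsSkyCurvature α C) :
    C = (1 / zeta hg γ 0 ^ 2) • (α.curvature hg hw +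
      (1 / 2 * (deriv (deriv (zeta hg γ)) 0 / zeta hg γ 0 -
        3 / 2 * (deriv (zeta hg γ) 0 / zeta hg γ 0) ^ 2)) • LinearMap.id) := by
  obtain ⟨gP, hP, γP, I', gC, hC, γC, J, ψ, w', hw', hγP, hRic, hpos, hγC, h0', hst', hψ, hγγ,
    rfl⟩ := hC
  refine curvature_of_zeta_eq_one hm hg hγ h0 hC hγC h0' hw hw' hst hst' ?_
  filter_upwards [hγC.eventually_mem h0'] with s hs
    using zeta_eq_one_of_integral hm hP hγP hRic hpos hC hγC hψ h0' hγγ hs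

end Spacetime

/-! ### Existence of the sky-curvature -/

/-- If `F = -log u` then `F'' - F'² = -u'' / u`. -/
lemma deriv_deriv_sub_sq_of_neg_log {F u : ℝ → ℝ} {t : ℝ} (hu : ∀ᶠ r in 𝓝 t, 0 < u r)
    (hu' : ContDiffAt ℝ ∞ u t) (hF : F =ᶠ[𝓝 t] fun r ↦ -(Real.log (u r ^ 2) / 2)) :
    deriv (deriv F) t - deriv F t ^ 2 = -(deriv (deriv u) t / u t) := by
  have h1 : deriv F =ᶠ[𝓝 t] fun r ↦ -(deriv u r / u r) := by
    filter_upwards [hF.eventually_nhds, hu, eventually_differentiableAt hu'] with r hr hr0 hrd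
    have h2 := (((hrd.hasDerivAt.fun_pow 2).log (pow_pos hr0 2).ne').div_const 2).fun_neg.deriv
    rw [EventuallyEq.deriv_eq hr, h2]
    field_simp
    norm_num
    ring
  have hne := hu.self_of_nhds.ne'
  have h2 := ((differentiableAt_deriv hu').hasDerivAt.fun_div
    (hu'.differentiableAt (by simp)).hasDerivAt hne).fun_neg.deriv
  rw [h1.deriv_eq, h2, h1.self_of_nhds]
  field_simp
  ring

namespace Spacetime

variable {m : ℕ} {M : Type*} [TopologicalSpace M] [ChartedSpace (Model m) M]
  [IsManifold 𝓘(ℝ, Model m) ∞ M] {S : Spacetime m M} {g : LorentzMetric m M} {γ : ℝ → M}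
  {I : Set ℝ}

/-- A null geodesic has a projective reparametrisation: its speed is `u²` for a solution `u` of
`u'' = Ric_γ u / (m - 2)`. -/
lemma IsNullGeodesicOn.exists_projective [T2Space M] (hm : 3 ≤ m) (hg : g ∈ S.metrics)
    (hγ : S.IsNullGeodesicOn g γ I) (h0 : 0 ∈ I) (hD : tracelessDet hg γ 0 ≠ 0) :
    ∃ (h : LorentzMetric m M) (hh : h ∈ S.metrics) (φ : ℝ → ℝ) (c : ℝ) (J : Set ℝ),
      φ 0 = 0 ∧ 0 ∈ J ∧ 0 < c ∧ HasDerivAt φ c 0 ∧ S.IsNullGeodesicOn h (γ ∘ φ) J ∧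
      (∀ s ∈ J, paramRicci hh (γ ∘ φ) s = 0) ∧ ∀ s ∈ J, 0 < zetaProj hh (γ ∘ φ) s := by
  have hm0 : (m : ℝ) - 2 ≠ 0 := by
    have : (3 : ℝ) ≤ m := by exact_mod_cast hm
    linarith
  obtain ⟨u, hu0, hu⟩ := exists_linear_second_order
    (r := fun t ↦ paramRicci hg γ t / ((m : ℝ) - 2)) (by
      filter_upwards [hγ.eventually_mem h0] with t ht
        using (hγ.contDiffAt_paramRicci hg ht).div_const _)
  have hupos : ∀ᶠ t in 𝓝 (0 : ℝ), 0 < u t :=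
    hu.self_of_nhds.1.continuousAt.eventually (lt_mem_nhds (by rw [hu0]; exact one_pos))
  have hDne : ∀ᶠ t in 𝓝 (0 : ℝ), tracelessDet hg γ t ≠ 0 :=
    (hγ.contDiffAt_tracelessDet hg h0).continuousAt.eventually_ne hD
  obtain ⟨f, hf, φ, J, hφ0, h0J, hgeo, hJ⟩ := hγ.exists_reparam h0 (ρ := fun t ↦ u t ^ 2)
    (by filter_upwards [hu, hupos] with t ht ht' using ⟨ht.1.pow 2, pow_pos ht' 2⟩)
    ((eventually_eventually_nhds.2 hupos).and (hu.and hDne))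
  have hRic : ∀ s ∈ J, paramRicci (conformalMetric_mem hg hf) (γ ∘ φ) s = 0 := by
    intro s hs
    obtain ⟨hI, hφ, hF, hup, ⟨husm, hode⟩, -⟩ := hJ s hs
    have h1 : paramRicci (conformalMetric_mem hg hf) (γ ∘ φ) s =
        nullRicci (conformalMetric_mem hg hf) ⟨γ (φ s), u (φ s) ^ 2 • velocity γ (φ s)⟩ := by
      rw [← velocity_comp (hγ.contMDiffAt hI) hφ]
      rfl
    rw [h1, nullRicci_conformal hg _ hf (conformalMetric_form g hf) (hγ.null _ hI)
      (hγ.velocity_ne_zero hI) (pow_pos hup.self_of_nhds 2).ne',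
      conformalTerm_velocity hf (hγ.contMDiffAt hI) (hγ.geodesic _ hI),
      deriv_deriv_sub_sq_of_neg_log hup husm hF, hode,
      mul_div_cancel_right₀ _ hup.self_of_nhds.ne']
    change _ * (paramRicci hg γ (φ s) + _) = 0
    field_simp
    ring
  refine ⟨_, conformalMetric_mem hg hf, φ, 1, J, hφ0, h0J, one_pos, ?_, hgeo, hRic,
    fun s hs ↦ ?_⟩
  · have := (hJ 0 h0J).2.1
    rwa [hφ0, hu0, one_pow] at this
  · obtain ⟨hI, hφ, -, hup, -, hDs⟩ := hJ s hs
    have hρ := pow_pos hup.self_of_nhds 2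
    rw [zetaProj_eq_zeta (hRic s hs), hγ.zeta_reparam hm hg _ hφ hρ.ne' hI EventuallyEq.rfl]
    exact mul_pos (abs_pos.2 hρ.ne') (zeta_pos hDs)

/-- The speed `1 / ζ`, along a projective parametrisation, gives the conformal parameter. -/
lemma exists_isSkyCurvature [T2Space M] (hm : 3 ≤ m) (hg : g ∈ S.metrics)
    (hγ : S.IsNullGeodesicOn g γ I) (h0 : 0 ∈ I) {α : S.NullRay} {w : Tan m α.pt}
    (hw : w ∈ α.carrier) (hst : StartsAt γ w) (hD : tracelessDet hg γ 0 ≠ 0) :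
    ∃ C, IsSkyCurvature α C := by
  obtain ⟨gP, hP, φ, c, I', hφ0, h0P, hc, hφ, hγP, hRic, hpos⟩ :=
    hγ.exists_projective hm hg h0 hD
  set γP := γ ∘ φ with hγPdef
  have hsm := fun t ht ↦ hγP.contDiffAt_zetaProj hm hP hRic hpos (t := t) ht
  obtain ⟨f, hf, ψ, J, hψ0, h0J, hγC, hJ⟩ := hγP.exists_reparam h0P
    (ρ := fun t ↦ (zetaProj hP γP t)⁻¹) (Q := fun _ ↦ True)
    (by filter_upwards [hγP.eventually_mem h0P] with t ht
          using ⟨(hsm t ht).inv (hpos t ht).ne', inv_pos.2 (hpos t ht)⟩) (by simp)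
  have hψ := (hJ 0 h0J).2.1
  rw [hψ0] at hψ
  have hd := inv_pos.2 (hpos 0 h0P)
  refine ⟨_, gP, hP, γP, I', conformalMetric gP f hf, conformalMetric_mem hP hf, γP ∘ ψ, J, ψ,
    _, NullRay.smul_mem (NullRay.smul_mem hw hc) hd, hγP, hRic, hpos, hγC, h0J,
    (hst.comp hφ0 hφ (hγ.contMDiffAt h0)).comp hψ0 hψ (hγP.contMDiffAt h0P), ?_, fun _ _ ↦ rfl,
    rfl⟩
  have hZ : ∀ s ∈ J, HasDerivAt (fun s ↦ ∫ τ in (ψ 0)..(ψ s), zetaProj hP γP τ) 1 s := by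
    intro s hs
    have h1 := hasDerivAt_integral_of_continuousOn hγP.isOpen hγP.ordConnected
      (fun t ht ↦ (hsm t ht).continuousAt.continuousWithinAt) (hJ 0 h0J).1 (hJ s hs).1
    refine (h1.comp s (hJ s hs).2.1).congr_deriv (mul_inv_cancel₀ (hpos _ (hJ s hs).1).ne')
  have heq := hγC.isOpen.eqOn_of_deriv_eq hγC.ordConnected.isPreconnected
    (f := fun s : ℝ ↦ s) (fun s _ ↦ differentiableAt_id.differentiableWithinAt)
    (fun s hs ↦ (hZ s hs).differentiableAt.differentiableWithinAt)
    (fun s hs ↦ by rw [(hZ s hs).deriv, deriv_id'']) h0J (by simp)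
  exact fun s hs ↦ ⟨(hJ s hs).1, heq hs⟩

end Spacetime

/-! ### The formula in terms of the determinant -/

/-- The logarithmic derivatives of `ζ = |D|^k` in terms of those of `D`. -/
lemma deriv_abs_rpow {D : ℝ → ℝ} {k : ℝ} (hD : ContDiffAt ℝ ∞ D 0) (h0 : D 0 ≠ 0) :
    deriv (fun t ↦ |D t| ^ k) 0 / |D 0| ^ k = k * (deriv D 0 / D 0) ∧
    deriv (deriv fun t ↦ |D t| ^ k) 0 / |D 0| ^ k =
      k * (deriv (deriv D) 0 / D 0) + (k ^ 2 - k) * (deriv D 0 / D 0) ^ 2 := by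
  have hne : ∀ᶠ t in 𝓝 (0 : ℝ), D t ≠ 0 := hD.continuousAt.eventually_ne h0
  have hder : ∀ᶠ t in 𝓝 (0 : ℝ),
      HasDerivAt (fun t ↦ |D t| ^ k) (k * (deriv D t / D t) * |D t| ^ k) t := by
    filter_upwards [hne.eventually_nhds, eventually_differentiableAt hD] with t ht htd
    have hexp : (fun t ↦ |D t| ^ k) =ᶠ[𝓝 t] fun r ↦ Real.exp (k * Real.log (D r)) := by
      filter_upwards [ht] with r hr
      rw [Real.rpow_def_of_pos (abs_pos.2 hr), Real.log_abs, mul_comm]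
    have h1 := ((htd.hasDerivAt.log ht.self_of_nhds).const_mul k).exp
    have h2 : |D t| ^ k = Real.exp (k * Real.log (D t)) := hexp.self_of_nhds
    rw [h2, mul_comm]
    exact h1.congr_of_eventuallyEq hexp
  have hd : deriv (fun t ↦ |D t| ^ k) =ᶠ[𝓝 0] fun t ↦ k * (deriv D t / D t) * |D t| ^ k :=
    hder.mono fun t ht ↦ ht.deriv
  have hp : |D 0| ^ k ≠ 0 := (Real.rpow_pos_of_pos (abs_pos.2 h0) _).ne'
  have h2 := ((((differentiableAt_deriv hD).hasDerivAt.fun_div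
    (hD.differentiableAt (by simp)).hasDerivAt h0).const_mul k).fun_mul hder.self_of_nhds).deriv
  constructor
  · rw [hd.self_of_nhds, mul_div_cancel_right₀ _ hp]
  · rw [hd.deriv_eq, h2]
    field_simp
    ring

end SkyCurv

theorem theorem2 (m : ℕ) (hm : 3 ≤ m) (M : Type*) [TopologicalSpace M] [T2Space M]
    [SecondCountableTopology M] [ChartedSpace (SkyCurv.Model m) M]
    [IsManifold 𝓘(ℝ, SkyCurv.Model m) ∞ M] (S : SkyCurv.Spacetime m M)
    (g : SkyCurv.LorentzMetric m M) (hg : g ∈ S.metrics) (α : S.NullRay)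
    (γ : ℝ → M) (I : Set ℝ) (h0 : 0 ∈ I) (hγ : S.IsNullGeodesicOn g γ I)
    (w : SkyCurv.Tan m α.pt) (hw : w ∈ α.carrier) (hstart : SkyCurv.Spacetime.StartsAt γ w)
    (D ζ : ℝ → ℝ) (hDdef : D = SkyCurv.Spacetime.tracelessDet hg γ)
    (hζdef : ζ = SkyCurv.Spacetime.zeta hg γ) (hD : D 0 ≠ 0) :
    ContDiffAt ℝ ∞ D 0 ∧ ContDiffAt ℝ ∞ ζ 0 ∧
    ∃ C : Module.End ℝ α.SkyTangent,
      (∀ C' : Module.End ℝ α.SkyTangent, SkyCurv.Spacetime.IsSkyCurvature α C' ↔ C' = C) ∧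
      C = (1 / ζ 0 ^ 2) • (α.curvature hg hw +
        (1 / 2 * (deriv (deriv ζ) 0 / ζ 0 - 3 / 2 * (deriv ζ 0 / ζ 0) ^ 2)) • LinearMap.id) ∧
      C = (1 / |D 0| ^ (1 / ((m : ℝ) - 2))) • (α.curvature hg hw +
        (1 / (4 * ((m : ℝ) - 2)) * (deriv (deriv D) 0 / D 0 +
          (7 - 4 * (m : ℝ)) / (4 * ((m : ℝ) - 2)) * (deriv D 0 / D 0) ^ 2)) • LinearMap.id) := by
  have hm0 : (m : ℝ) - 2 ≠ 0 := by
    have : (3 : ℝ) ≤ m := by exact_mod_cast hm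
    linarith
  subst hDdef hζdef
  have hDsm := hγ.contDiffAt_tracelessDet hg h0
  obtain ⟨C, hC⟩ := SkyCurv.Spacetime.exists_isSkyCurvature hm hg hγ h0 hw hstart hD
  have hCeq := hC.eq hm hg hγ h0 hw hstart
  refine ⟨hDsm, hγ.contDiffAt_zeta hg h0 hD, C, fun C' ↦ ⟨fun hC' ↦ ?_, ?_⟩, hCeq, ?_⟩
  · rw [hC'.eq hm hg hγ h0 hw hstart, ← hCeq]
  · rintro rfl
    exact hC
  · obtain ⟨h1, h2⟩ := SkyCurv.deriv_abs_rpow (k := 1 / (2 * ((m : ℝ) - 2))) hDsm hD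
    have h3 : SkyCurv.Spacetime.zeta hg γ 0 ^ 2 =
        |SkyCurv.Spacetime.tracelessDet hg γ 0| ^ (1 / ((m : ℝ) - 2)) := by
      rw [SkyCurv.Spacetime.zeta, ← Real.rpow_natCast, ← Real.rpow_mul (abs_nonneg _)]
      congr 1
      push_cast
      field_simp
    change deriv (SkyCurv.Spacetime.zeta hg γ) 0 / SkyCurv.Spacetime.zeta hg γ 0 = _ at h1
    change deriv (deriv (SkyCurv.Spacetime.zeta hg γ)) 0 / SkyCurv.Spacetime.zeta hg γ 0 = _ at h2
    rw [hCeq, h3, h1, h2]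
    congr 3
    field_simp
    ring
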